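/- Let $(M,g)$ be a finite-dimensional smooth Riemannian manifold, let $\nabla$ be its Levi-Civita connection, $R_{XY}=[\nabla_X,\nabla_Y]-\nabla_{[X,Y]}$ its curvature operator, and let $c\neq 0$ be a real number. Let $TM$ carry the Sasaki metric $d\sigma^2=ds^2+|D\xi|^2$, where $ds^2$ is the line element of $M$ and $D\xi$ is the covariant differential of $\xi$, and let $T_1M=\{\xi\in TM:|\xi|=1\}$ carry the induced metric. Let $I\subseteq\mathbb R$ be an open interval and let $\Gamma:I\to TM$ be an affinely parametrized geodesic of $TM$, or a curve $\Gamma : I\to T_1M$ that is an affinely parametrized geodesic of $T_1M$. Suppose that $\Gamma$ is non-vertical, i.e. it is not contained in a single fibre, and let $\gamma=\pi\circ\Gamma$ be its projection to $M$. The geodesic curvatures $k_1,k_2,\dots\ge 0$ of a regular curve $\gamma$ are those of its Frenet formulas $e_1=\gamma'/|\gamma'|$, $\nabla_s e_i=-k_{i-1}e_{i-1}+k_ie_{i+1}$ with $k_0=0$, $e_0 = 0$, where $s$ is the arc length of $\gamma$ and $e_1,e_2,\dots$ are orthonormal; if $k_i$ vanishes identically, then the Frenet frame ends with $e_i$, and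 one sets $k_j=0$ for $j\geq i$. **Theorem 1.1.** In each of the following cases $\gamma$ is regular, its Frenet vectors are smooth along $\gamma$, all geodesic curvatures $k_1,k_2,\dots$ of $\gamma$ are constant, and moreover: (a) if $(M,g)$ is a real space form, i.e. has constant sectional curvature $c$, then $k_i=0$ for all $i\ge 3$; (b) if $(M,g,J)$ is a complex space form, i.e. a Kähler manifold ($J^2=-1$, $J$ orthogonal, $\nabla J=0$) of constant holomorphic sectional curvature $c$ (every plane spanned by vectors $X$, $JX$ has sectional curvature $c$), then $k_i=0$ for all $i\ge 6$; (c) if $(M,g,Q)$ is a quaternionic space form, i.e. a quaternionic Kähler manifold of constant quaternionic sectional curvature $c$, then $k_i=0$ for all $i\ge 10$. Here $Q\subset\mathrm{End}(TM)$ is a $\nabla$-parallel subbundle with smooth local bases $J_1,J_2,J_3$ of skew-symmetric endomorphisms such that $J_a^2=-1$, $J_1J_2=J_3$, $J_2J_3=J_1$, $J_3J_1=J_2$; and constant quaternionic sectional curvature $c$ means that every plane contained in a subspace $\mathrm{span}\{X,J_1X,J_2X,J_3X\}$ has sectional curvature $c$. -/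

import Mathlib

set_option maxSynthPendingDepth 3

open Set Filter Topology
open scoped Manifold ContDiff

namespace SpaceFormGeodesics

noncomputable section

/-! ### Riemannian geometry in an open piece of a normed space

A metric field `G` assigns to each point `u` of the coordinate space a bilinear form `G u`. -/

section Local

variable {F : Type*} [NormedAddCommGroup F] [NormedSpace ℝ F]

/-- The trilinear form `(v, w, z) ↦ T (z, v, w)`. -/
def rotate (T : F →L[ℝ] F →L[ℝ] F →L[ℝ] ℝ) : F →L[ℝ] F →L[ℝ] F →L[ℝ] ℝ :=
  (ContinuousLinearMap.flipₗᵢ ℝ F F ℝ).toContinuousLinearEquiv.toContinuousLinearMap ∘L T.flip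

lemma rotate_apply (T : F →L[ℝ] F →L[ℝ] F →L[ℝ] ℝ) (v w z : F) : rotate T v w z = T z v w := rfl

/-- Christoffel symbols of the first kind:
`(v, w, z) ↦ (1/2) (D_v G (w, z) + D_w G (v, z) - D_z G (v, w))`. -/
def christoffelFirst (G : F → F →L[ℝ] F →L[ℝ] ℝ) (u : F) : F →L[ℝ] F →L[ℝ] F →L[ℝ] ℝ :=
  (1 / 2 : ℝ) • (fderiv ℝ G u + (fderiv ℝ G u).flip - rotate (fderiv ℝ G u))

lemma christoffelFirst_apply (G : F → F →L[ℝ] F →L[ℝ] ℝ) (u v w z : F) :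
    christoffelFirst G u v w z =
      1 / 2 * (fderiv ℝ G u v w z + fderiv ℝ G u w v z - fderiv ℝ G u z v w) := by
  simp [christoffelFirst, rotate_apply]

/-- Christoffel symbols (of the second kind) of the Levi-Civita connection of `G`: the index of
`christoffelFirst` is raised by the inverse of `G u : F → F*`. -/
def christoffel (G : F → F →L[ℝ] F →L[ℝ] ℝ) (u : F) : F →L[ℝ] F →L[ℝ] F :=
  (ContinuousLinearMap.compL ℝ F (F →L[ℝ] ℝ) F (ContinuousLinearMap.inverse (G u))).comp
    (christoffelFirst G u)

lemma christoffel_apply (G : F → F →L[ℝ] F →L[ℝ] ℝ) (u v w : F) :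
    christoffel G u v w = ContinuousLinearMap.inverse (G u) (christoffelFirst G u v w) := rfl

/-- The Riemann curvature operator
`R_{XY} Z = ∇_X ∇_Y Z - ∇_Y ∇_X Z - ∇_{[X,Y]} Z` in coordinates. -/
def curvatureOp (G : F → F →L[ℝ] F →L[ℝ] ℝ) (u X Y Z : F) : F :=
  fderiv ℝ (christoffel G) u X Y Z - fderiv ℝ (christoffel G) u Y X Z
    + christoffel G u X (christoffel G u Y Z) - christoffel G u Y (christoffel G u X Z)

/-- The covariant derivative of the vector field `V` along the coordinate curve `c`. -/
def covDerivAlong (G : F → F →L[ℝ] F →L[ℝ] ℝ) (c V : ℝ → F) (t : ℝ) : F :=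
  deriv V t + christoffel G (c t) (deriv c t) (V t)

/-- The covariant derivative `(∇_v A) w` of a field `A` of endomorphisms. -/
def covDerivEnd (G : F → F →L[ℝ] F →L[ℝ] ℝ) (A : F → F →L[ℝ] F) (u v : F) : F →L[ℝ] F :=
  fderiv ℝ A u v + (christoffel G u v).comp (A u) - (A u).comp (christoffel G u v)

/-- The connection map in natural induced coordinates `(u, ξ)`: it sends the tangent vector
`(v, a)` of the tangent bundle to the covariant differential `a + Γ(v, ξ)`. -/
def connector (G : F → F →L[ℝ] F →L[ℝ] ℝ) (c : F × F) : F × F →L[ℝ] F :=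
  ContinuousLinearMap.snd ℝ F F
    + ((christoffel G c.1).flip c.2).comp (ContinuousLinearMap.fst ℝ F F)

/-- The Sasaki metric `dσ² = ds² + |Dξ|²` in natural induced coordinates `(u, ξ)`. -/
def sasaki (G : F → F →L[ℝ] F →L[ℝ] ℝ) (c : F × F) : F × F →L[ℝ] F × F →L[ℝ] ℝ :=
  (G c.1).bilinearComp (ContinuousLinearMap.fst ℝ F F) (ContinuousLinearMap.fst ℝ F F)
    + (G c.1).bilinearComp (connector G c) (connector G c)

lemma sasaki_apply (G : F → F →L[ℝ] F →L[ℝ] ℝ) (u ξ v a w b : F) :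
    sasaki G (u, ξ) (v, a) (w, b) =
      G u v w + G u (a + christoffel G u v ξ) (b + christoffel G u w ξ) := by
  simp [sasaki, connector]

/-- The covariant acceleration of a curve `c` in the tangent bundle, for the Levi-Civita
connection of the Sasaki metric. -/
def sasakiAcceleration (G : F → F →L[ℝ] F →L[ℝ] ℝ) (c : ℝ → F × F) (t : ℝ) : F × F :=
  covDerivAlong (sasaki G) c (deriv c) t

end Local

/-! ### Riemannian manifolds -/

section Manifold

variable {E : Type*} [NormedAddCommGroup E] [NormedSpace ℝ E]
  {M : Type*} [TopologicalSpace M] [ChartedSpace E M]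

/-- The coordinate representation, in the chart centred at `p`, of the tangent vector `V` at `x`. -/
def toCoord (p x : M) : TangentSpace 𝓘(ℝ, E) x →L[ℝ] E :=
  mfderiv 𝓘(ℝ, E) 𝓘(ℝ, E) (extChartAt 𝓘(ℝ, E) p) x

/-- The tangent vector of `M` at the point with coordinates `u` in the chart centred at `p`
whose coordinate representation is a given vector. -/
def ofCoord (p : M) (u : E) :
    E →L[ℝ] TangentSpace 𝓘(ℝ, E) ((extChartAt 𝓘(ℝ, E) p).symm u) :=
  mfderiv 𝓘(ℝ, E) 𝓘(ℝ, E) (extChartAt 𝓘(ℝ, E) p).symm u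

/-- A field of endomorphisms of the tangent spaces of `M`. -/
abbrev EndField (E : Type*) [NormedAddCommGroup E] [NormedSpace ℝ E]
    (M : Type*) [TopologicalSpace M] [ChartedSpace E M] :=
  ∀ x : M, TangentSpace 𝓘(ℝ, E) x →L[ℝ] TangentSpace 𝓘(ℝ, E) x

/-- The field of endomorphisms `J` in the chart centred at `p`. -/
def localEnd (J : EndField E M) (p : M) (u : E) : E →L[ℝ] E :=
  (toCoord p ((extChartAt 𝓘(ℝ, E) p).symm u)).comp
    ((J ((extChartAt 𝓘(ℝ, E) p).symm u)).comp (ofCoord p u))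

/-- The natural induced coordinates `(u, ξ)` on the tangent bundle given by the chart centred
at `p`. -/
def natCoord (p : M) (z : TangentBundle 𝓘(ℝ, E) M) : E × E :=
  (extChartAt 𝓘(ℝ, E) p z.proj, toCoord p z.proj z.snd)

/-- The velocity `γ'` of a curve. -/
def velocity (γ : ℝ → M) (t : ℝ) : TangentSpace 𝓘(ℝ, E) (γ t) :=
  mfderiv 𝓘(ℝ, ℝ) 𝓘(ℝ, E) γ t (1 : ℝ)

/-- A curve in the tangent bundle is vertical if it stays in one fibre. -/
def IsVertical (Γ : ℝ → TangentBundle 𝓘(ℝ, E) M) (I : Set ℝ) : Prop :=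
  ∃ p : M, ∀ t ∈ I, (Γ t).proj = p

variable [IsManifold 𝓘(ℝ, E) ∞ M]

/-- The vector field `V` along `γ` is smooth on `I`. -/
def SmoothAlong (γ : ℝ → M) (V : ∀ t, TangentSpace 𝓘(ℝ, E) (γ t)) (I : Set ℝ) : Prop :=
  ContMDiffOn 𝓘(ℝ, ℝ) 𝓘(ℝ, E).tangent ∞
    (fun t => (⟨γ t, V t⟩ : TangentBundle 𝓘(ℝ, E) M)) I

/-- Smooth Riemannian metrics on `M`. -/
abbrev RMetric (E : Type*) [NormedAddCommGroup E] [NormedSpace ℝ E]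
    (M : Type*) [TopologicalSpace M] [ChartedSpace E M] [IsManifold 𝓘(ℝ, E) ∞ M] :=
  Bundle.ContMDiffRiemannianMetric 𝓘(ℝ, E) ∞ E (fun x : M => TangentSpace 𝓘(ℝ, E) x)

/-- The metric in the chart centred at `p`. -/
def localMetric (g : RMetric E M) (p : M) (u : E) : E →L[ℝ] E →L[ℝ] ℝ :=
  (ContinuousLinearMap.precomp ℝ (ofCoord p u)).comp
    ((g.inner ((extChartAt 𝓘(ℝ, E) p).symm u)).comp (ofCoord p u))

lemma localMetric_apply (g : RMetric E M) (p : M) (u v w : E) :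
    localMetric g p u v w =
      g.inner ((extChartAt 𝓘(ℝ, E) p).symm u) (ofCoord p u v) (ofCoord p u w) := rfl

/-! ### Space forms -/

/-- At the point with coordinates `u` in the chart centred at `p`, the plane spanned by `X` and `Y`
has sectional curvature `c`, that is, `⟨R_{XY} Y, X⟩ = c |X ∧ Y|²`. The condition is empty if `X`
and `Y` are linearly dependent. -/
def HasSectionalCurvature (g : RMetric E M) (p : M) (u X Y : E) (c : ℝ) : Prop :=
  localMetric g p u (curvatureOp (localMetric g p) u X Y Y) X =
    c * (localMetric g p u X X * localMetric g p u Y Y - localMetric g p u X Y ^ 2)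

/-- Riemannian manifolds of constant (sectional) curvature `c`. -/
def IsRealSpaceForm (g : RMetric E M) (c : ℝ) : Prop :=
  ∀ p : M, ∀ u ∈ (extChartAt 𝓘(ℝ, E) p).target, ∀ X Y : E, HasSectionalCurvature g p u X Y c

/-- Kähler structures: smooth orthogonal parallel almost complex structures `J`. -/
structure IsKahler (g : RMetric E M) (J : EndField E M) : Prop where
  smooth : ∀ p : M, ContDiffOn ℝ ∞ (localEnd J p) (extChartAt 𝓘(ℝ, E) p).target
  sq : ∀ x v, J x (J x v) = -v
  orthogonal : ∀ x v w, g.inner x (J x v) (J x w) = g.inner x v w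
  parallel : ∀ p : M, ∀ u ∈ (extChartAt 𝓘(ℝ, E) p).target, ∀ v : E,
    covDerivEnd (localMetric g p) (localEnd J p) u v = 0

/-- Kähler manifolds of constant holomorphic (sectional) curvature `c`: every plane spanned by `X`
and `J X` has sectional curvature `c`. -/
structure IsComplexSpaceForm (g : RMetric E M) (J : EndField E M) (c : ℝ) : Prop where
  kahler : IsKahler g J
  curvature : ∀ p : M, ∀ u ∈ (extChartAt 𝓘(ℝ, E) p).target, ∀ X : E,
    HasSectionalCurvature g p u X (localEnd J p u X) c

/-- A field of spaces of endomorphisms of the tangent spaces of `M`. -/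
abbrev EndSubspaceField (E : Type*) [NormedAddCommGroup E] [NormedSpace ℝ E]
    (M : Type*) [TopologicalSpace M] [ChartedSpace E M] :=
  ∀ x : M, Submodule ℝ (TangentSpace 𝓘(ℝ, E) x →L[ℝ] TangentSpace 𝓘(ℝ, E) x)

/-- `J 0, J 1, J 2` is, on the open set `U`, a local basis `J₁, J₂, J₃` of the quaternionic Kähler
structure `Q`: smooth skew-symmetric almost complex structures that satisfy the quaternion
relations, span `Q`, and whose covariant derivatives are again in `Q`. -/
structure IsQuaternionicBasisOn (g : RMetric E M) (Q : EndSubspaceField E M)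
    (J : Fin 3 → EndField E M) (U : Set M) : Prop where
  smooth : ∀ a, ∀ p : M, ContDiffOn ℝ ∞ (localEnd (J a) p)
    ((extChartAt 𝓘(ℝ, E) p).target ∩ (extChartAt 𝓘(ℝ, E) p).symm ⁻¹' U)
  sq : ∀ a, ∀ x ∈ U, ∀ v, J a x (J a x v) = -v
  mul01 : ∀ x ∈ U, ∀ v, J 0 x (J 1 x v) = J 2 x v
  mul12 : ∀ x ∈ U, ∀ v, J 1 x (J 2 x v) = J 0 x v
  mul20 : ∀ x ∈ U, ∀ v, J 2 x (J 0 x v) = J 1 x v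
  skew : ∀ a, ∀ x ∈ U, ∀ v w, g.inner x v (J a x w) = -g.inner x (J a x v) w
  span_eq : ∀ x ∈ U, Q x = Submodule.span ℝ (range fun a => J a x)
  parallel : ∀ a, ∀ p : M, ∀ u ∈ (extChartAt 𝓘(ℝ, E) p).target,
    (extChartAt 𝓘(ℝ, E) p).symm u ∈ U → ∀ v : E,
      covDerivEnd (localMetric g p) (localEnd (J a) p) u v ∈
        Submodule.span ℝ (range fun b => localEnd (J b) p u)

/-- Quaternionic Kähler structures: a parallel rank three bundle `Q` of endomorphisms of the
tangent bundle which locally has bases `J₁, J₂, J₃` as above. -/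
def IsQuaternionKahler (g : RMetric E M) (Q : EndSubspaceField E M) : Prop :=
  ∀ x : M, ∃ U : Set M, IsOpen U ∧ x ∈ U ∧
    ∃ J : Fin 3 → EndField E M, IsQuaternionicBasisOn g Q J U

/-- The quaternionic section of `X`, that is, the span of `X, J₁ X, J₂ X, J₃ X`, in coordinates. -/
def quaternionicSection (Q : EndSubspaceField E M) (p : M) (u X : E) : Submodule ℝ E :=
  Submodule.span ℝ (insert X
    {Y : E | ∃ A ∈ Q ((extChartAt 𝓘(ℝ, E) p).symm u), Y = toCoord p _ (A (ofCoord p u X))})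

/-- Quaternionic Kähler manifolds of constant quaternionic (sectional) curvature `c`: every plane in
a quaternionic section has sectional curvature `c`. -/
structure IsQuaternionicSpaceForm (g : RMetric E M) (Q : EndSubspaceField E M) (c : ℝ) :
    Prop where
  kahler : IsQuaternionKahler g Q
  curvature : ∀ p : M, ∀ u ∈ (extChartAt 𝓘(ℝ, E) p).target, ∀ X : E,
    ∀ Y ∈ quaternionicSection Q p u X, ∀ Z ∈ quaternionicSection Q p u X,
      HasSectionalCurvature g p u Y Z c

/-! ### Geodesics of the tangent bundle and of the tangent sphere bundle -/

/-- `Γ` is on `I` a geodesic, in affine parametrization, of the tangent bundle with the Sasaki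
metric: its acceleration vanishes. -/
structure IsTangentGeodesic (g : RMetric E M) (Γ : ℝ → TangentBundle 𝓘(ℝ, E) M) (I : Set ℝ) :
    Prop where
  smooth : ContMDiffOn 𝓘(ℝ, ℝ) 𝓘(ℝ, E).tangent ∞ Γ I
  geodesic : ∀ p : M, ∀ t ∈ I, (Γ t).proj ∈ (chartAt E p).source →
    sasakiAcceleration (localMetric g p) (fun s => natCoord p (Γ s)) t = 0

/-- `Γ` is on `I` a geodesic, in affine parametrization, of the tangent sphere bundle `|ξ| = 1`
with the metric induced by the Sasaki metric: it lies in this hypersurface, and its acceleration in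
the tangent bundle is Sasaki-orthogonal to the hypersurface, so to every vector in the kernel of the
differential of `(u, ξ) ↦ |ξ|²`. -/
structure IsSphereGeodesic (g : RMetric E M) (Γ : ℝ → TangentBundle 𝓘(ℝ, E) M) (I : Set ℝ) :
    Prop where
  smooth : ContMDiffOn 𝓘(ℝ, ℝ) 𝓘(ℝ, E).tangent ∞ Γ I
  unit : ∀ t ∈ I, g.inner (Γ t).proj (Γ t).snd (Γ t).snd = 1
  geodesic : ∀ p : M, ∀ t ∈ I, (Γ t).proj ∈ (chartAt E p).source → ∀ w : E × E,
    fderiv ℝ (fun c : E × E => localMetric g p c.1 c.2 c.2) (natCoord p (Γ t)) w = 0 →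
      sasaki (localMetric g p) (natCoord p (Γ t))
        (sasakiAcceleration (localMetric g p) (fun s => natCoord p (Γ s)) t) w = 0

/-! ### Geodesic curvatures of curves -/

/-- The norm of a tangent vector. -/
def tnorm (g : RMetric E M) {x : M} (v : TangentSpace 𝓘(ℝ, E) x) : ℝ := √(g.inner x v v)

/-- The covariant derivative along `γ` of the vector field `V`, computed at time `t` in the chart
centred at `γ t`. -/
def covDeriv (g : RMetric E M) (γ : ℝ → M) (V : ∀ t, TangentSpace 𝓘(ℝ, E) (γ t)) (t : ℝ) :
    TangentSpace 𝓘(ℝ, E) (γ t) :=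
  (toCoord (γ t) (γ t)).inverse
    (covDerivAlong (localMetric g (γ t)) (fun s => extChartAt 𝓘(ℝ, E) (γ t) (γ s))
      (fun s => toCoord (γ t) (γ s) (V s)) t)

/-- One step of the Frenet construction for `γ`. Given `e_i`, `k_i` and `e_{i+1}`, the Frenet
formula `∇_s e_{i+1} = - k_i e_i + k_{i+1} e_{i+2}` with `|e_{i+2}| = 1` and `k_{i+1} ≥ 0` gives
`k_{i+1} = |∇_s e_{i+1} + k_i e_i|` and, if this is not zero, `e_{i+2}`. Here
`∇_s = |γ'|⁻¹ ∇_t` is the covariant derivative with respect to arc length. -/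
def frenetRest (g : RMetric E M) (γ : ℝ → M) (e : ∀ t, TangentSpace 𝓘(ℝ, E) (γ t)) (k : ℝ → ℝ)
    (f : ∀ t, TangentSpace 𝓘(ℝ, E) (γ t)) (t : ℝ) : TangentSpace 𝓘(ℝ, E) (γ t) :=
  (tnorm g (velocity γ t : TangentSpace 𝓘(ℝ, E) (γ t)))⁻¹ • covDeriv g γ f t + k t • e t

/-- The triples `(e_i, k_i, e_{i+1})` of the Frenet construction, where `e_1 = γ' / |γ'|` and, as a
convention, `e_0 = 0`, `k_0 = 0`. If `k_i = 0` then `e_{i+1} = 0`, and the construction goes on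
with zero curvatures. -/
def frenet (g : RMetric E M) (γ : ℝ → M) :
    ℕ → (∀ t, TangentSpace 𝓘(ℝ, E) (γ t)) × (ℝ → ℝ) × (∀ t, TangentSpace 𝓘(ℝ, E) (γ t))
  | 0 => (fun _ => 0, fun _ => 0, fun t =>
      (tnorm g (velocity γ t : TangentSpace 𝓘(ℝ, E) (γ t)))⁻¹ • velocity γ t)
  | i + 1 =>
      ((frenet g γ i).2.2,
        fun t => tnorm g
          (frenetRest g γ (frenet g γ i).1 (frenet g γ i).2.1 (frenet g γ i).2.2 t),
        fun t => (tnorm g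
          (frenetRest g γ (frenet g γ i).1 (frenet g γ i).2.1 (frenet g γ i).2.2 t))⁻¹ •
            frenetRest g γ (frenet g γ i).1 (frenet g γ i).2.1 (frenet g γ i).2.2 t)

/-- The Frenet vector `e_i`, `i ≥ 1`, of `γ`. -/
def frenetVector (g : RMetric E M) (γ : ℝ → M) (i : ℕ) (t : ℝ) : TangentSpace 𝓘(ℝ, E) (γ t) :=
  (frenet g γ i).1 t

/-- The geodesic curvature `k_i`, `i ≥ 1`, of `γ`. -/
def geodesicCurvature (g : RMetric E M) (γ : ℝ → M) (i : ℕ) (t : ℝ) : ℝ :=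
  (frenet g γ i).2.1 t

/-- The curve `γ` is regular on `I`, its Frenet vectors are smooth on `I` (so that the Frenet
construction is meaningful), all its geodesic curvatures `k_1, k_2, …` are constant on `I`, and
`k_i = 0` for `i ≥ N`. -/
structure HasConstantCurvaturesVanishingFrom (g : RMetric E M) (γ : ℝ → M) (I : Set ℝ) (N : ℕ) :
    Prop where
  regular : ∀ t ∈ I, (velocity γ t : TangentSpace 𝓘(ℝ, E) (γ t)) ≠ 0
  frenet_smooth : ∀ i, 1 ≤ i → SmoothAlong γ (frenetVector g γ i) I
  constant : ∀ i, 1 ≤ i → ∃ κ : ℝ, ∀ t ∈ I, geodesicCurvature g γ i t = κ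
  vanishing : ∀ i, N ≤ i → ∀ t ∈ I, geodesicCurvature g γ i t = 0

end Manifold

end

end SpaceFormGeodesics

open SpaceFormGeodesics

/-!
Work in a chart and let `u` be the projection of the geodesic, `ξ` the vector field along `u` that
it carries, and let `'` denote the covariant derivative along `u`. The geodesic equations of the
Sasaki metric are
`u'' = -R(ξ, ξ') u'` and `ξ'' = λ ξ`,
with `λ = 0` for the tangent bundle and `λ = -|ξ'|²` for the unit tangent bundle
(`IsMetricOn.tangentGeodesic_equations`, `IsMetricOn.sphereGeodesic_equations`).

In the three kinds of space forms the curvature is a universal algebraic expression in the metric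
and in `0`, `1` or `3` skew-symmetric endomorphisms `Jₐ` (`eq_modelCurvature_of_real`,
`eq_modelCurvature_of_complex`, `IsQuaternionTriple.eq_modelCurvature`): a tensor with the
symmetries of a curvature tensor is determined by its sectional curvatures, and in the quaternionic
case the Ricci identity for the parallel bundle spanned by the `Jₐ` controls the remaining
components. The operator field `A = -R(ξ, ξ')` along `u` is skew-symmetric, and it is parallel,
because the curvature is parallel and the bivector `ξ ∧ ξ'` is
(`IsModelSpace.hasCovDerivAt_modelCurvature`). Hence the iterated covariant derivatives of the
velocity are `Aᵐ u'`, and their inner products are constant. Gram–Schmidt therefore produces Frenet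
vectors that are combinations of the `Aᵐ u'` with constant coefficients (`exists_frenet_eq_comb`),
with constant curvatures.

Every `Aᵐ u'` lies in one `A`-invariant subspace: the sum of the span of `ξ`, `ξ'`, `Jₐ ξ`, `Jₐ ξ'`
and of the span of `u'` and `S u'`, where `S = ∑ₐ ⟨ξ, Jₐ ξ'⟩ Jₐ` has a scalar square
(`IsModelSpace.exists_invariant_submodule`). Its dimension is at most `3`, `6` or `10`; in the real
case `S = 0`. The Frenet vectors are orthonormal in this subspace, so the curvatures vanish from the
index equal to that bound on (`frenet_curvature_eq_zero`). As the velocity has constant length, a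
non-vertical geodesic has a regular projection.
-/

namespace SpaceFormGeodesics

noncomputable section

/-! ### Algebraic curvature tensors -/

section Algebra

variable {F : Type*} [NormedAddCommGroup F] [NormedSpace ℝ F]

/-- Algebraic curvature tensors: quadrilinear forms with the symmetries of `⟨R_{xy} z, w⟩`.
Linearity in the last three arguments follows from the symmetries. -/
structure IsCurvatureLike (K : F → F → F → F → ℝ) : Prop where
  add_left : ∀ x x' y z w, K (x + x') y z w = K x y z w + K x' y z w
  smul_left : ∀ (r : ℝ) x y z w, K (r • x) y z w = r * K x y z w
  antisymm_left : ∀ x y z w, K x y z w = -K y x z w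
  antisymm_right : ∀ x y z w, K x y z w = -K x y w z
  bianchi : ∀ x y z w, K x y z w + K y z x w + K z x y w = 0

namespace IsCurvatureLike

variable {K K' : F → F → F → F → ℝ}

lemma pair_symm (h : IsCurvatureLike K) (x y z w : F) : K x y z w = K z w x y := by
  have a := h.antisymm_left
  have b := h.antisymm_right
  have h1 := h.bianchi x y z w
  have h2 := h.bianchi y z w x
  have h3 := h.bianchi z w x y
  have h4 := h.bianchi w x y z
  linarith [a x y z w, a y z x w, a z x y w, a y z w x, a z w y x, a w y z x, a z w x y, a w x z y,
    a x z w y, a w x y z, a x y w z, a y w x z, b x y z w, b y z x w, b z x y w, b z w y x,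
    b w y z x, b w x z y, b x z w y, b x y w z, b y w x z, b y x z w, b z y x w, b x z y w,
    b w z x y, b x w y z, b y w z x]

lemma add_snd (h : IsCurvatureLike K) (x y y' z w : F) :
    K x (y + y') z w = K x y z w + K x y' z w := by
  rw [h.antisymm_left, h.add_left, h.antisymm_left x y, h.antisymm_left x y']; ring

lemma add_trd (h : IsCurvatureLike K) (x y z z' w : F) :
    K x y (z + z') w = K x y z w + K x y z' w := by
  rw [h.pair_symm, h.add_left, h.pair_symm x y z, h.pair_symm x y z']

lemma add_right (h : IsCurvatureLike K) (x y z w w' : F) :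
    K x y z (w + w') = K x y z w + K x y z w' := by
  rw [h.pair_symm, h.add_snd, h.pair_symm x y z w, h.pair_symm x y z w']

lemma neg_left (h : IsCurvatureLike K) (x y z w : F) : K (-x) y z w = -K x y z w := by
  simpa using h.smul_left (-1) x y z w

lemma neg_snd (h : IsCurvatureLike K) (x y z w : F) : K x (-y) z w = -K x y z w := by
  rw [h.antisymm_left, h.neg_left, h.antisymm_left x y]

lemma neg_trd (h : IsCurvatureLike K) (x y z w : F) : K x y (-z) w = -K x y z w := by
  rw [h.pair_symm, h.neg_left, h.pair_symm x y]

lemma neg_right (h : IsCurvatureLike K) (x y z w : F) : K x y z (-w) = -K x y z w := by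
  rw [h.pair_symm, h.neg_snd, h.pair_symm x y]

protected lemma add (h : IsCurvatureLike K) (h' : IsCurvatureLike K') :
    IsCurvatureLike fun x y z w => K x y z w + K' x y z w where
  add_left _ _ _ _ _ := by rw [h.add_left, h'.add_left]; ring
  smul_left _ _ _ _ _ := by rw [h.smul_left, h'.smul_left]; ring
  antisymm_left _ _ _ _ := by rw [h.antisymm_left, h'.antisymm_left]; ring
  antisymm_right _ _ _ _ := by rw [h.antisymm_right, h'.antisymm_right]; ring
  bianchi x y z w := by linarith [h.bianchi x y z w, h'.bianchi x y z w]

protected lemma const_mul (h : IsCurvatureLike K) (r : ℝ) :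
    IsCurvatureLike fun x y z w => r * K x y z w where
  add_left _ _ _ _ _ := by rw [h.add_left]; ring
  smul_left _ _ _ _ _ := by rw [h.smul_left]; ring
  antisymm_left _ _ _ _ := by rw [h.antisymm_left]; ring
  antisymm_right _ _ _ _ := by rw [h.antisymm_right]; ring
  bianchi x y z w := by rw [← mul_add, ← mul_add, h.bianchi, mul_zero]

protected lemma sub (h : IsCurvatureLike K) (h' : IsCurvatureLike K') :
    IsCurvatureLike fun x y z w => K x y z w - K' x y z w := by
  simpa [sub_eq_add_neg] using h.add (h'.const_mul (-1))

protected lemma sum {ι : Type*} (s : Finset ι) {K : ι → F → F → F → F → ℝ}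
    (h : ∀ a, IsCurvatureLike (K a)) :
    IsCurvatureLike fun x y z w => ∑ a ∈ s, K a x y z w where
  add_left _ _ _ _ _ := by simp only [(h _).add_left, Finset.sum_add_distrib]
  smul_left _ _ _ _ _ := by simp only [(h _).smul_left, Finset.mul_sum]
  antisymm_left x y z w := by simp only [(h _).antisymm_left x, Finset.sum_neg_distrib]
  antisymm_right x y z w := by simp only [(h _).antisymm_right x y z, Finset.sum_neg_distrib]
  bianchi x y z w := by simp only [← Finset.sum_add_distrib, (h _).bianchi, Finset.sum_const_zero]

/-- An algebraic curvature tensor is determined on a subspace by the sectional curvatures of its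
planes. -/
lemma eq_zero_of_sectional_on (h : IsCurvatureLike K) (L : Submodule ℝ F)
    (h0 : ∀ x ∈ L, ∀ y ∈ L, K x y y x = 0) {x y z w : F} (hx : x ∈ L) (hy : y ∈ L) (hz : z ∈ L)
    (hw : w ∈ L) : K x y z w = 0 := by
  have h1 : ∀ x ∈ L, ∀ y ∈ L, ∀ z ∈ L, K x y z x = 0 := by
    intro x hx y hy z hz
    have e := h0 x hx _ (L.add_mem hy hz)
    rw [h.add_snd, h.add_trd, h.add_trd, h0 x hx y hy, h0 x hx z hz] at e
    linarith [h.pair_symm x z y x, h.antisymm_left y x x z, h.antisymm_right x y x z]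
  have h2 : ∀ x ∈ L, ∀ y ∈ L, ∀ z ∈ L, ∀ w ∈ L, K x y z w = -K w y z x := by
    intro x hx y hy z hz w hw
    have e := h1 _ (L.add_mem hx hw) y hy z hz
    rw [h.add_left, h.add_right, h.add_right, h1 x hx y hy z hz, h1 w hw y hy z hz] at e
    linarith
  have e := h.bianchi x y z w
  have e1 : K y z x w = K x y z w := by
    linarith [h2 y hy z hz x hx w hw, h.antisymm_left w z x y, h.antisymm_right z w x y,
      h2 z hz w hw y hy x hx, h.pair_symm x w y z, h.antisymm_left x w y z,
      h.antisymm_right w x y z,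
      h.pair_symm z w x y, h2 x hx y hy z hz w hw, h.pair_symm w y z x, h.antisymm_right z x w y,
      h2 z hz x hx y hy w hw, h.pair_symm w x y z]
  have e2 : K z x y w = K x y z w := by
    linarith [h2 z hz x hx y hy w hw, h.antisymm_left w x y z,
      h.pair_symm x w y z, h.pair_symm w x y z, h2 y hy z hz x hx w hw, h.antisymm_left w z x y,
      h.pair_symm w z x y, h2 x hx y hy z hz w hw]
  linarith

/-- A Kähler curvature tensor is determined by its holomorphic sectional curvatures. -/
lemma eq_zero_of_holomorphic (h : IsCurvatureLike K) (J : F →L[ℝ] F) (hJ : ∀ v, J (J v) = -v)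
    (hK : ∀ x y z w, K x y (J z) w = -K x y z (J w)) (h0 : ∀ x, K x (J x) (J x) x = 0)
    (x y z w : F) : K x y z w = 0 := by
  have hK' : ∀ x y z w, K x (J y) z w = -K (J x) y z w := by
    intro x y z w
    rw [h.pair_symm, h.pair_symm (J x), hK, neg_neg]
  have f0 : ∀ x, K x (J x) x (J x) = 0 := fun x => by rw [h.antisymm_right, h0, neg_zero]
  have key : ∀ x y, 3 * K x (J y) x (J y) + K x y x y = 0 := by
    intro x y
    have e1 := f0 (x + y)
    have e2 := f0 (x + -y)
    simp only [map_add, map_neg, h.add_left, h.add_snd, h.add_trd, h.add_right, h.neg_left,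
      h.neg_snd, h.neg_trd, h.neg_right, f0] at e1 e2
    have e3 : K x (J x) y (J y) + K x (J y) x (J y) + K x (J y) y (J x) + K y (J x) x (J y)
      + K y (J x) y (J x) + K y (J y) x (J x) = 0 := by linarith
    -- all six terms are expressed through `K x (J x) y (J y)` and `K x (J y) x (J y)`
    have a1 : K y (J x) x (J y) = K x (J y) x (J y) := by
      rw [hK' y x, h.antisymm_left, neg_neg]
    have a2 : K x (J y) y (J x) = K x (J y) x (J y) := by
      rw [h.pair_symm, a1]
    have a3 : K y (J x) y (J x) = K x (J y) x (J y) := by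
      rw [hK' y x, h.antisymm_left, neg_neg, a2]
    have a4 : K y (J y) x (J x) = K x (J x) y (J y) := h.pair_symm _ _ _ _
    have b := h.bianchi x (J x) y (J y)
    have b1 : K (J x) y x (J y) = -K x (J y) x (J y) := by rw [hK', neg_neg]
    have b2 : K y x (J x) (J y) = -K x y x y := by
      rw [hK, hJ, h.neg_right, neg_neg, h.antisymm_left]
    linarith
  have sec : ∀ x y, K x y y x = 0 := by
    intro x y
    have k1 := key x y
    have k2 := key x (J y)
    rw [hJ, h.neg_snd, h.neg_right] at k2
    linarith [h.antisymm_right x y y x]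
  exact h.eq_zero_of_sectional_on ⊤ (fun x _ y _ => sec x y) trivial trivial trivial trivial

end IsCurvatureLike

/-- The curvature operator `κ (X ∧ Y + ∑ₐ (Jₐ X ∧ Jₐ Y + 2 ⟨X, Jₐ Y⟩ Jₐ))`. For no, one and three
endomorphisms `Jₐ` this is the curvature of real, complex and quaternionic space forms. -/
def modelCurvature {ι : Type*} [Fintype ι] (B : F →L[ℝ] F →L[ℝ] ℝ) (κ : ℝ) (J : ι → F →L[ℝ] F)
    (X Y Z : F) : F :=
  κ • (B Y Z • X - B X Z • Y +
    ∑ a, (B (J a Y) Z • J a X - B (J a X) Z • J a Y + (2 * B X (J a Y)) • J a Z))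

section Model

variable {B : F →L[ℝ] F →L[ℝ] ℝ}

lemma isCurvatureLike_wedge (hB : ∀ x y, B x y = B y x) :
    IsCurvatureLike fun X Y Z W => B Y Z * B X W - B X Z * B Y W where
  add_left _ _ _ _ _ := by simp; ring
  smul_left _ _ _ _ _ := by simp; ring
  antisymm_left _ _ _ _ := by ring
  antisymm_right _ _ _ _ := by ring
  bianchi x y z w := by rw [hB z x, hB y x, hB z y]; ring

lemma isCurvatureLike_skew (hB : ∀ x y, B x y = B y x) {J : F →L[ℝ] F}
    (hJ : ∀ x y, B x (J y) = -B (J x) y) :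
    IsCurvatureLike fun X Y Z W =>
      B (J Y) Z * B (J X) W - B (J X) Z * B (J Y) W + 2 * B X (J Y) * B (J Z) W where
  add_left _ _ _ _ _ := by simp; ring
  smul_left _ _ _ _ _ := by simp; ring
  antisymm_left x y z w := by rw [hJ x y, hB (J x) y]; ring
  antisymm_right x y z w := by rw [hB (J z) w, hJ w z]; ring
  bianchi x y z w := by
    rw [hJ x y, hJ y z, hJ z x, hB (J z) x, hJ x z, hB (J y) x, hJ x y, hB (J z) y, hJ y z]; ring

lemma isCurvatureLike_modelCurvature (hB : ∀ x y, B x y = B y x) {ι : Type*} [Fintype ι] (κ : ℝ)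
    {J : ι → F →L[ℝ] F} (hJ : ∀ a x y, B x (J a y) = -B (J a x) y) :
    IsCurvatureLike fun X Y Z W => B (modelCurvature B κ J X Y Z) W := by
  have := ((isCurvatureLike_wedge hB).add
    (IsCurvatureLike.sum Finset.univ fun a => isCurvatureLike_skew hB (hJ a))).const_mul κ
  convert this using 5
  simp [modelCurvature]
  ring

end Model

end Algebra

/-! ### Curvature operators of space forms -/

section SpaceForms

variable {F : Type*} [NormedAddCommGroup F] [NormedSpace ℝ F] {B : F →L[ℝ] F →L[ℝ] ℝ}

lemma eq_of_forall_bilin_eq (hpos : ∀ v, v ≠ 0 → 0 < B v v) {v w : F}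
    (h : ∀ z, B v z = B w z) : v = w := by
  by_contra hne
  have := hpos (v - w) (sub_ne_zero.2 hne)
  simp only [map_sub, sub_apply] at this
  linarith [h v, h w]

variable {R : F → F → F → F}

/-- The curvature operator of a manifold of constant sectional curvature. -/
lemma eq_modelCurvature_of_real (hB : ∀ x y, B x y = B y x) (hpos : ∀ v, v ≠ 0 → 0 < B v v)
    (hR : IsCurvatureLike fun X Y Z W => B (R X Y Z) W) {c : ℝ} (J : Fin 0 → F →L[ℝ] F)
    (hsec : ∀ X Y, B (R X Y Y) X = c * (B X X * B Y Y - B X Y ^ 2)) (X Y Z : F) :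
    R X Y Z = modelCurvature B c J X Y Z := by
  refine eq_of_forall_bilin_eq hpos fun W => ?_
  have h := hR.sub (isCurvatureLike_modelCurvature hB c (J := J) fun a => a.elim0)
  refine sub_eq_zero.1 (h.eq_zero_of_sectional_on ⊤ (fun x _ y _ => ?_) trivial trivial trivial
    trivial)
  rw [hsec]
  simp [modelCurvature, hB y x]
  ring

lemma modelCurvature_comm_one (κ : ℝ) {J : Fin 1 → F →L[ℝ] F}
    (hJ : ∀ v, J 0 (J 0 v) = -v) (hskew : ∀ x y, B x (J 0 y) = -B (J 0 x) y) (X Y Z : F) :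
    modelCurvature B κ J X Y (J 0 Z) = J 0 (modelCurvature B κ J X Y Z) := by
  simp only [modelCurvature, Fin.sum_univ_one, map_smul, map_add, map_sub, hskew, hJ, map_neg,
    neg_apply, Fin.isValue]
  module

/-- The curvature operator of a Kähler manifold of constant holomorphic sectional curvature. -/
lemma eq_modelCurvature_of_complex (hB : ∀ x y, B x y = B y x) (hpos : ∀ v, v ≠ 0 → 0 < B v v)
    (hR : IsCurvatureLike fun X Y Z W => B (R X Y Z) W) {c : ℝ} {J : Fin 1 → F →L[ℝ] F}
    (hJ : ∀ v, J 0 (J 0 v) = -v) (hskew : ∀ x y, B x (J 0 y) = -B (J 0 x) y)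
    (hcomm : ∀ X Y Z, R X Y (J 0 Z) = J 0 (R X Y Z))
    (hsec : ∀ X, B (R X (J 0 X) (J 0 X)) X = c * (B X X * B (J 0 X) (J 0 X) - B X (J 0 X) ^ 2))
    (X Y Z : F) : R X Y Z = modelCurvature B (c / 4) J X Y Z := by
  refine eq_of_forall_bilin_eq hpos fun W => ?_
  have h := hR.sub (isCurvatureLike_modelCurvature hB (c / 4) (J := J)
    fun a => by rw [Subsingleton.elim a 0]; exact hskew)
  refine sub_eq_zero.1 (h.eq_zero_of_holomorphic (J 0) hJ (fun x y z w => ?_) (fun x => ?_) X Y Z W)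
  · rw [hcomm, modelCurvature_comm_one _ hJ hskew, hskew, hskew]
    ring
  · have e : B x (J 0 x) = 0 := by linarith [hskew x x, hB (J 0 x) x]
    have e2 : B (J 0 x) (J 0 x) = B x x := by rw [hskew, hJ]; simp
    rw [hsec, modelCurvature]
    simp [hJ, e, e2]
    ring

/-- `J₁, J₂, J₃` are skew-symmetric and satisfy the quaternion relations. -/
structure IsQuaternionTriple (B : F →L[ℝ] F →L[ℝ] ℝ) (J : Fin 3 → F →L[ℝ] F) : Prop where
  sq : ∀ a v, J a (J a v) = -v
  mul01 : ∀ v, J 0 (J 1 v) = J 2 v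
  mul12 : ∀ v, J 1 (J 2 v) = J 0 v
  mul20 : ∀ v, J 2 (J 0 v) = J 1 v
  skew : ∀ a x y, B x (J a y) = -B (J a x) y

namespace IsQuaternionTriple

variable {J : Fin 3 → F →L[ℝ] F}

lemma mul10 (hJ : IsQuaternionTriple B J) (v : F) : J 1 (J 0 v) = -J 2 v := by
  rw [← hJ.mul12 v, hJ.sq]

lemma mul21 (hJ : IsQuaternionTriple B J) (v : F) : J 2 (J 1 v) = -J 0 v := by
  rw [← hJ.mul20 v, hJ.sq]

lemma mul02 (hJ : IsQuaternionTriple B J) (v : F) : J 0 (J 2 v) = -J 1 v := by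
  rw [← hJ.mul01 v, hJ.sq]

lemma self_left (hJ : IsQuaternionTriple B J) (hB : ∀ x y, B x y = B y x) (a : Fin 3) (x : F) :
    B x (J a x) = 0 := by
  linarith [hJ.skew a x x, hB (J a x) x]

lemma apply_apply (hJ : IsQuaternionTriple B J) (a : Fin 3) (x : F) :
    B (J a x) (J a x) = B x x := by
  rw [hJ.skew, hJ.sq, map_neg, neg_apply, neg_neg]

/-- `J₀ x, J₁ x, J₂ x` are orthogonal. -/
lemma apply_apply_of_ne (hJ : IsQuaternionTriple B J) (hB : ∀ x y, B x y = B y x) {a b : Fin 3}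
    (hab : a ≠ b) (x : F) : B (J a x) (J b x) = 0 := by
  have h (c d : Fin 3) : B (J c x) (J d x) = -B x (J c (J d x)) := by rw [hJ.skew c]; ring
  rw [h]
  fin_cases a <;> fin_cases b <;> first
    | exact absurd rfl hab
    | simp [hJ.mul01, hJ.mul12, hJ.mul20, hJ.mul10, hJ.mul21, hJ.mul02, hJ.self_left hB]

/-- A combination `P` of the members of a quaternion triple has the coefficients
`⟨P x, J b x⟩ / |x|²`. -/
lemma coeff_eq (hJ : IsQuaternionTriple B J) (hB : ∀ x y, B x y = B y x) {x : F} (hx : B x x ≠ 0)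
    {P : F →L[ℝ] F} (hP : P ∈ Submodule.span ℝ (range J)) :
    P = ∑ b, (B (P x) (J b x) / B x x) • J b := by
  obtain ⟨r, rfl⟩ := (Submodule.mem_span_range_iff_exists_fun ℝ).1 hP
  refine Finset.sum_congr rfl fun b _ => ?_
  have e : B ((∑ i, r i • J i) x) (J b x) = r b * B x x := by
    simp only [sum_apply, smul_apply, map_sum, map_smul, smul_eq_mul]
    rw [Finset.sum_eq_single b (fun d _ hd => by rw [hJ.apply_apply_of_ne hB hd, mul_zero])
      (by simp), hJ.apply_apply]
  rw [e, mul_div_cancel_right₀ _ hx]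

lemma clifford (hJ : IsQuaternionTriple B J) (a b : Fin 3) (x : F) :
    J a (J b x) + J b (J a x) = if a = b then (-2 : ℝ) • x else 0 := by
  split_ifs with h
  · rw [h, hJ.sq]
    module
  · fin_cases a <;> fin_cases b <;> first
      | exact absurd rfl h
      | simp [hJ.mul01, hJ.mul12, hJ.mul20, hJ.mul10, hJ.mul21, hJ.mul02]

lemma mul_mem (hJ : IsQuaternionTriple B J) (a b : Fin 3) (x : F) :
    J a (J b x) ∈ Submodule.span ℝ (insert x (range fun d => J d x)) := by
  have h0 : x ∈ Submodule.span ℝ (insert x (range fun d => J d x)) :=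
    Submodule.subset_span (mem_insert _ _)
  have h1 (d : Fin 3) : J d x ∈ Submodule.span ℝ (insert x (range fun d => J d x)) :=
    Submodule.subset_span (mem_insert_of_mem _ ⟨d, rfl⟩)
  fin_cases a <;> fin_cases b <;>
    simp [hJ.sq, hJ.mul01, hJ.mul12, hJ.mul20, hJ.mul10, hJ.mul21, hJ.mul02, h0, h1]

/-- The planes of a quaternionic line have sectional curvature `4 κ` for the model curvature. -/
lemma modelCurvature_sectional (hJ : IsQuaternionTriple B J) (hB : ∀ x y, B x y = B y x) (κ : ℝ)
    (x : F) (y₀ y₁ y₂ y₃ z₀ z₁ z₂ z₃ : ℝ) {y z : F}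
    (hy : y = y₀ • x + y₁ • J 0 x + y₂ • J 1 x + y₃ • J 2 x)
    (hz : z = z₀ • x + z₁ • J 0 x + z₂ • J 1 x + z₃ • J 2 x) :
    B (modelCurvature B κ J y z z) y = 4 * κ * (B y y * B z z - B y z ^ 2) := by
  have e : B y y * B z z - B y z ^ 2 = B y (J 0 z) ^ 2 + B y (J 1 z) ^ 2 + B y (J 2 z) ^ 2 := by
    have h' (a : Fin 3) : B (J a x) x = 0 := by rw [hB, hJ.self_left hB]
    have hn {a b : Fin 3} (hab : a ≠ b) := hJ.apply_apply_of_ne hB hab x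
    subst hy hz
    simp only [map_add, map_smul, add_apply, smul_apply, hJ.sq, hJ.mul01, hJ.mul12, hJ.mul20,
      hJ.mul10, hJ.mul21, hJ.mul02, map_neg, h', hJ.self_left hB, hJ.apply_apply, smul_eq_mul,
      hn (show (0 : Fin 3) ≠ 1 by decide), hn (show (0 : Fin 3) ≠ 2 by decide),
      hn (show (1 : Fin 3) ≠ 0 by decide), hn (show (1 : Fin 3) ≠ 2 by decide),
      hn (show (2 : Fin 3) ≠ 0 by decide), hn (show (2 : Fin 3) ≠ 1 by decide)]
    ring
  have hz' (a : Fin 3) : B (J a z) z = 0 := by rw [hB, hJ.self_left hB]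
  have hzy (a : Fin 3) : B (J a z) y = B y (J a z) := hB _ _
  have hyz (a : Fin 3) : B (J a y) z = -B y (J a z) := by rw [hJ.skew, neg_neg]
  simp only [modelCurvature, Fin.sum_univ_three, map_smul, map_add, map_sub, add_apply, smul_apply,
    sub_apply, smul_eq_mul, hz', hzy, hyz]
  rw [hB z y]
  linear_combination (3 * κ) * e.symm

lemma modelCurvature_comm (hJ : IsQuaternionTriple B J) (κ : ℝ) (X Y Z : F) :
    modelCurvature B κ J X Y (J 0 Z) - J 0 (modelCurvature B κ J X Y Z) =
      (4 * κ * B X (J 2 Y)) • J 1 Z - (4 * κ * B X (J 1 Y)) • J 2 Z := by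
  simp only [modelCurvature, Fin.sum_univ_three, map_smul, map_add, map_sub, hJ.skew, hJ.sq,
    map_neg, neg_apply, Fin.isValue, hJ.mul01, hJ.mul20, hJ.mul10, hJ.mul02]
  module

/-- The curvature operator of a quaternionic Kähler manifold of constant quaternionic sectional
curvature. The difference `K` to the model has vanishing curvatures on quaternionic lines, so the
commutators `[K (x, Jₐ x), J₀]`, which are combinations of the `Jₐ`, vanish. Polarization shows
that `K` commutes with `J₀`, and is therefore determined by its holomorphic curvatures. -/
lemma eq_modelCurvature (hJ : IsQuaternionTriple B J) (hB : ∀ x y, B x y = B y x)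
    (hpos : ∀ v, v ≠ 0 → 0 < B v v)
    (hR : IsCurvatureLike fun X Y Z W => B (R X Y Z) W) {c : ℝ}
    (hcomm : ∀ X Y, ∃ β : Fin 3 → ℝ, ∀ Z, R X Y (J 0 Z) - J 0 (R X Y Z) = ∑ b, β b • J b Z)
    (hsec : ∀ X, ∀ Y ∈ Submodule.span ℝ {X, J 0 X, J 1 X, J 2 X},
      ∀ Z ∈ Submodule.span ℝ {X, J 0 X, J 1 X, J 2 X},
        B (R Y Z Z) Y = c * (B Y Y * B Z Z - B Y Z ^ 2))
    (X Y Z : F) : R X Y Z = modelCurvature B (c / 4) J X Y Z := by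
  refine eq_of_forall_bilin_eq hpos fun W => ?_
  have h := hR.sub (isCurvatureLike_modelCurvature hB (c / 4) hJ.skew)
  set K : F → F → F → F → ℝ :=
    fun X Y Z W => B (R X Y Z) W - B (modelCurvature B (c / 4) J X Y Z) W with hK
  have hline (x : F) : ∀ y ∈ Submodule.span ℝ {x, J 0 x, J 1 x, J 2 x},
      ∀ z ∈ Submodule.span ℝ {x, J 0 x, J 1 x, J 2 x}, K y z z y = 0 := by
    intro y hy z hz
    rw [hK]
    simp only
    rw [hsec x y hy z hz]
    simp only [Submodule.mem_span_insert, Submodule.mem_span_singleton] at hy hz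
    obtain ⟨y₀, _, ⟨y₁, _, ⟨y₂, _, ⟨y₃, rfl⟩, rfl⟩, rfl⟩, hy⟩ := hy
    obtain ⟨z₀, _, ⟨z₁, _, ⟨z₂, _, ⟨z₃, rfl⟩, rfl⟩, rfl⟩, hz⟩ := hz
    rw [hJ.modelCurvature_sectional hB _ x y₀ y₁ y₂ y₃ z₀ z₁ z₂ z₃ (by rw [hy]; abel)
      (by rw [hz]; abel)]
    ring
  have hmem0 (x : F) : x ∈ Submodule.span ℝ {x, J 0 x, J 1 x, J 2 x} :=
    Submodule.subset_span (by simp)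
  have hmem (x : F) (a : Fin 3) : J a x ∈ Submodule.span ℝ {x, J 0 x, J 1 x, J 2 x} :=
    Submodule.subset_span (by fin_cases a <;> simp)
  -- the commutator with `J₀`, as a form
  let T : F → F → F → F → ℝ := fun x y z w => K x y (J 0 z) w + K x y z (J 0 w)
  have hT (x y : F) : ∃ β : Fin 3 → ℝ, ∀ z w, T x y z w = ∑ b, β b * B (J b z) w := by
    obtain ⟨β, hβ⟩ := hcomm x y
    refine ⟨![β 0, β 1 - c * B x (J 2 y), β 2 + c * B x (J 1 y)], fun z w => ?_⟩
    have e1 := congrArg (fun v => B v w) (hβ z)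
    have e2 := congrArg (fun v => B v w) (hJ.modelCurvature_comm (c / 4) x y z)
    simp only [Fin.sum_univ_three, map_sub, sub_apply, map_add, add_apply, map_smul, smul_apply,
      smul_eq_mul] at e1 e2
    simp only [T, hK, Fin.sum_univ_three, hJ.skew 0]
    simp
    linear_combination e1 - e2
  have hT0 (x : F) (a : Fin 3) (z w : F) : T x (J a x) z w = 0 := by
    obtain ⟨β, hβ⟩ := hT x (J a x)
    rcases eq_or_ne x 0 with rfl | hx
    · have h0 : ∀ y z w, K 0 y z w = 0 := fun y z w => by simpa using h.smul_left 0 0 y z w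
      simp [T, h0]
    have hb (b : Fin 3) : β b = 0 := by
      have e := hβ x (J b x)
      have e0 : T x (J a x) x (J b x) = 0 := by
        have m : J 0 (J b x) ∈ Submodule.span ℝ {x, J 0 x, J 1 x, J 2 x} := by
          fin_cases b
          · simpa [hJ.sq] using hmem0 x
          · simpa [hJ.mul01] using hmem x 2
          · simpa [hJ.mul02] using hmem x 1
        simp only [T]
        rw [h.eq_zero_of_sectional_on _ (hline x) (hmem0 x) (hmem x a) (hmem x 0) (hmem x b),
          h.eq_zero_of_sectional_on _ (hline x) (hmem0 x) (hmem x a) (hmem0 x) m, add_zero]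
      rw [e0, Finset.sum_eq_single b (fun d _ hd => by rw [hJ.apply_apply_of_ne hB hd, mul_zero])
        (by simp), hJ.apply_apply] at e
      exact (mul_eq_zero.1 e.symm).resolve_right (hpos x hx).ne'
    rw [hβ]
    simp [hb]
  have hTp (x y z w : F) (a : Fin 3) : T x (J a y) z w = T (J a x) y z w := by
    have e := hT0 (x + y) a z w
    have ex := hT0 x a z w
    have ey := hT0 y a z w
    simp only [T, map_add, h.add_left, h.add_snd] at e ex ey ⊢
    linarith [h.antisymm_left y (J a x) (J 0 z) w, h.antisymm_left y (J a x) z (J 0 w)]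
  have hTz (x y z w : F) : T x y z w = 0 := by
    obtain ⟨x, rfl⟩ : ∃ v, J 2 v = x := ⟨-J 2 x, by rw [map_neg, hJ.sq, neg_neg]⟩
    have e1 : T x (J 0 (J 1 y)) z w = T (J 1 (J 0 x)) y z w := by rw [hTp, hTp]
    have e2 : T x (J 2 y) z w = T (J 2 x) y z w := hTp x y z w 2
    rw [hJ.mul01, hJ.mul10, e2] at e1
    simp only [T, h.neg_left] at e1 ⊢
    linarith
  refine sub_eq_zero.1 (h.eq_zero_of_holomorphic (J 0) (hJ.sq 0) (fun x y z w => ?_)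
    (fun x => hline x _ (hmem0 x) _ (hmem x 0)) X Y Z W)
  linarith [hTz x y z w]

end IsQuaternionTriple

end SpaceForms

/-! ### Levi-Civita connection and curvature in coordinates -/

section LeviCivita

variable {F : Type*} [NormedAddCommGroup F] [NormedSpace ℝ F]

/-- `G` is a smooth Riemannian metric on the open set `O` of the coordinate space. -/
structure IsMetricOn (G : F → F →L[ℝ] F →L[ℝ] ℝ) (O : Set F) : Prop where
  isOpen : IsOpen O
  contDiffOn : ContDiffOn ℝ ∞ G O
  symm : ∀ u ∈ O, ∀ v w, G u v w = G u w v
  pos : ∀ u ∈ O, ∀ v, v ≠ 0 → 0 < G u v v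

lemma hasDerivAt_clm_apply_apply {A : ℝ → F →L[ℝ] F →L[ℝ] ℝ} {A' : F →L[ℝ] F →L[ℝ] ℝ}
    {V W : ℝ → F} {V' W' : F} {t : ℝ} (hA : HasDerivAt A A' t) (hV : HasDerivAt V V' t)
    (hW : HasDerivAt W W' t) :
    HasDerivAt (fun s => A s (V s) (W s)) (A' (V t) (W t) + A t V' (W t) + A t (V t) W') t := by
  simpa using (hA.clm_apply hV).clm_apply hW

lemma hasDerivAt_line (u x : F) : HasDerivAt (fun s : ℝ => u + s • x) x 0 := by
  simpa using ((hasDerivAt_id (0 : ℝ)).smul_const x).const_add u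

/-- The derivative at `u` in the direction `x`, along the line `s ↦ u + s x`. -/
lemma hasDerivAt_comp_line {H : Type*} [NormedAddCommGroup H] [NormedSpace ℝ H] {f : F → H}
    {u : F} (hf : DifferentiableAt ℝ f u) (x : F) :
    HasDerivAt (fun s : ℝ => f (u + s • x)) (fderiv ℝ f u x) 0 := by
  have hf' : HasFDerivAt f (fderiv ℝ f u) (u + (0 : ℝ) • x) := by simpa using hf.hasFDerivAt
  exact hf'.comp_hasDerivAt (0 : ℝ) (hasDerivAt_line u x)

lemma eventually_line_mem {O : Set F} (hO : IsOpen O) {u : F} (hu : u ∈ O) (x : F) :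
    ∀ᶠ s : ℝ in 𝓝 0, u + s • x ∈ O :=
  (hasDerivAt_line u x).continuousAt.eventually_mem (by simpa using hO.mem_nhds hu)

lemma hasDerivAt_apply_apply_line {G : F → F →L[ℝ] F →L[ℝ] ℝ} {u : F}
    (hG : DifferentiableAt ℝ G u) (x v w : F) :
    HasDerivAt (fun s : ℝ => G (u + s • x) v w) (fderiv ℝ G u x v w) 0 := by
  simpa using hasDerivAt_clm_apply_apply (hasDerivAt_comp_line hG x) (hasDerivAt_const 0 v)
    (hasDerivAt_const 0 w)

namespace IsMetricOn

variable {G : F → F →L[ℝ] F →L[ℝ] ℝ} {O : Set F} {u : F}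

lemma contDiffAt (h : IsMetricOn G O) (hu : u ∈ O) : ContDiffAt ℝ ∞ G u :=
  h.contDiffOn.contDiffAt (h.isOpen.mem_nhds hu)

lemma differentiableAt (h : IsMetricOn G O) (hu : u ∈ O) : DifferentiableAt ℝ G u :=
  (h.contDiffAt hu).differentiableAt (by simp)

lemma contDiffOn_fderiv (h : IsMetricOn G O) : ContDiffOn ℝ ∞ (fderiv ℝ G) O :=
  h.contDiffOn.fderiv_of_isOpen h.isOpen (by simp)

lemma fderiv_symm (h : IsMetricOn G O) (hu : u ∈ O) (x v w : F) :
    fderiv ℝ G u x v w = fderiv ℝ G u x w v := by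
  have e := hasDerivAt_apply_apply_line (h.differentiableAt hu) x
  refine (e v w).unique ((e w v).congr_of_eventuallyEq ?_)
  filter_upwards [eventually_line_mem h.isOpen hu x] with s hs using h.symm _ hs _ _

lemma eq_of_forall (h : IsMetricOn G O) (hu : u ∈ O) {v w : F}
    (hvw : ∀ z, G u v z = G u w z) : v = w :=
  eq_of_forall_bilin_eq (h.pos u hu) hvw

lemma snd_fderiv_symm (h : IsMetricOn G O) (hu : u ∈ O) (x y : F) :
    fderiv ℝ (fderiv ℝ G) u x y = fderiv ℝ (fderiv ℝ G) u y x :=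
  ((h.contDiffAt hu).isSymmSndFDerivAt
    (by rw [minSmoothness_of_isRCLikeNormedField]
        exact WithTop.coe_le_coe.2 (le_top : (2 : ℕ∞) ≤ ⊤))).eq x y

variable [FiniteDimensional ℝ F]

lemma exists_equiv (h : IsMetricOn G O) (hu : u ∈ O) :
    ∃ e : F ≃L[ℝ] (F →L[ℝ] ℝ), (e : F →L[ℝ] F →L[ℝ] ℝ) = G u := by
  have hinj : Function.Injective (G u : F →ₗ[ℝ] F →L[ℝ] ℝ) := fun v w hvw =>
    h.eq_of_forall hu fun z => DFunLike.congr_fun hvw z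
  have hfin : Module.finrank ℝ F = Module.finrank ℝ (F →L[ℝ] ℝ) := by
    rw [← LinearEquiv.finrank_eq (LinearMap.toContinuousLinearMap (𝕜 := ℝ) (E := F) (F' := ℝ))]
    exact (Subspace.dual_finrank_eq).symm
  exact ⟨(LinearEquiv.ofInjectiveOfFinrankEq _ hinj hfin).toContinuousLinearEquiv, by ext; rfl⟩

lemma apply_inverse (h : IsMetricOn G O) (hu : u ∈ O) (φ : F →L[ℝ] ℝ) :
    G u (ContinuousLinearMap.inverse (G u) φ) = φ := by
  obtain ⟨e, he⟩ := h.exists_equiv hu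
  rw [← he, ContinuousLinearMap.inverse_equiv]
  simp

lemma apply_christoffel (h : IsMetricOn G O) (hu : u ∈ O) (v w z : F) :
    G u (christoffel G u v w) z = christoffelFirst G u v w z := by
  rw [christoffel_apply, h.apply_inverse hu]

lemma christoffel_symm (h : IsMetricOn G O) (hu : u ∈ O) (v w : F) :
    christoffel G u v w = christoffel G u w v := by
  refine h.eq_of_forall hu fun z => ?_
  rw [h.apply_christoffel hu, h.apply_christoffel hu, christoffelFirst_apply,
    christoffelFirst_apply, h.fderiv_symm hu z v w]
  ring

/-- The Levi-Civita connection is metric. -/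
lemma fderiv_apply (h : IsMetricOn G O) (hu : u ∈ O) (x v w : F) :
    fderiv ℝ G u x v w = G u (christoffel G u x v) w + G u v (christoffel G u x w) := by
  rw [h.symm u hu v, h.apply_christoffel hu, h.apply_christoffel hu, christoffelFirst_apply,
    christoffelFirst_apply, h.fderiv_symm hu x w v, h.fderiv_symm hu w x v,
    h.fderiv_symm hu v x w]
  ring

lemma contDiffOn_christoffel (h : IsMetricOn G O) : ContDiffOn ℝ ∞ (christoffel G) O := by
  have h1 : ContDiffOn ℝ ∞ (fun u => ContinuousLinearMap.inverse (G u)) O := by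
    intro u hu
    obtain ⟨e, he⟩ := h.exists_equiv hu
    have : ContDiffAt ℝ ∞ (ContinuousLinearMap.inverse : (F →L[ℝ] F →L[ℝ] ℝ) → _) (G u) :=
      he ▸ contDiffAt_map_inverse e
    exact (this.comp u (h.contDiffAt hu)).contDiffWithinAt
  have h2 : ContDiffOn ℝ ∞ (christoffelFirst G) O := by
    have hD := h.contDiffOn_fderiv
    have hflip : ContDiffOn ℝ ∞ (fun u => (fderiv ℝ G u).flip) O :=
      (ContinuousLinearMap.flipₗᵢ ℝ F F (F →L[ℝ] ℝ)).contDiff.comp_contDiffOn hD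
    have hrot : ContDiffOn ℝ ∞ (fun u => rotate (fderiv ℝ G u)) O :=
      contDiffOn_const.clm_comp hflip
    exact ((hD.add hflip).sub hrot).const_smul _
  have h3 : ContDiffOn ℝ ∞ (fun u => ContinuousLinearMap.compL ℝ F (F →L[ℝ] ℝ) F
      (ContinuousLinearMap.inverse (G u))) O :=
    (ContinuousLinearMap.compL ℝ F (F →L[ℝ] ℝ) F).contDiff.comp_contDiffOn h1
  exact h3.clm_comp h2

lemma differentiableAt_christoffel (h : IsMetricOn G O) (hu : u ∈ O) :
    DifferentiableAt ℝ (christoffel G) u :=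
  (h.contDiffOn_christoffel.contDiffAt (h.isOpen.mem_nhds hu)).differentiableAt (by simp)

lemma hasDerivAt_christoffel_line (h : IsMetricOn G O) (hu : u ∈ O) (x y z : F) :
    HasDerivAt (fun s : ℝ => christoffel G (u + s • x) y z)
      (fderiv ℝ (christoffel G) u x y z) 0 := by
  simpa using ((hasDerivAt_comp_line (h.differentiableAt_christoffel hu) x).clm_apply
    (hasDerivAt_const 0 y)).clm_apply (hasDerivAt_const 0 z)

lemma fderiv_christoffel_symm (h : IsMetricOn G O) (hu : u ∈ O) (x y z : F) :
    fderiv ℝ (christoffel G) u x y z = fderiv ℝ (christoffel G) u x z y := by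
  refine (h.hasDerivAt_christoffel_line hu x y z).unique
    ((h.hasDerivAt_christoffel_line hu x z y).congr_of_eventuallyEq ?_)
  filter_upwards [eventually_line_mem h.isOpen hu x] with s hs using h.christoffel_symm hs _ _

/-- The curvature operator is skew-symmetric; this is the symmetry of the second derivatives of
the metric, expressed by covariant derivatives. -/
lemma curvatureOp_self (h : IsMetricOn G O) (hu : u ∈ O) (x y z : F) :
    G u (curvatureOp G u x y z) z = 0 := by
  have key (x y : F) : fderiv ℝ (fderiv ℝ G) u x y z z =
      2 * (G u (christoffel G u x (christoffel G u y z)) z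
        + G u (christoffel G u y z) (christoffel G u x z)
        + G u (fderiv ℝ (christoffel G) u x y z) z) := by
    have hd : DifferentiableAt ℝ (fderiv ℝ G) u :=
      (h.contDiffOn_fderiv.contDiffAt (h.isOpen.mem_nhds hu)).differentiableAt (by simp)
    have e1 : HasDerivAt (fun s : ℝ => fderiv ℝ G (u + s • x) y z z)
        (fderiv ℝ (fderiv ℝ G) u x y z z) 0 := by
      simpa using (((hasDerivAt_comp_line hd x).clm_apply (hasDerivAt_const 0 y)).clm_apply
        (hasDerivAt_const 0 z)).clm_apply (hasDerivAt_const 0 z)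
    have e2 := (hasDerivAt_clm_apply_apply (hasDerivAt_comp_line (h.differentiableAt hu) x)
      (h.hasDerivAt_christoffel_line hu x y z) (hasDerivAt_const 0 z)).const_mul 2
    have e3 := e1.unique (e2.congr_of_eventuallyEq ?_)
    · rw [e3]
      simp only [zero_smul, add_zero, map_zero, h.fderiv_apply hu]
    · filter_upwards [eventually_line_mem h.isOpen hu x] with s hs
      rw [h.fderiv_apply hs, h.symm _ hs z]
      ring
  have k1 := key x y
  have k2 := key y x
  rw [h.snd_fderiv_symm hu] at k1
  simp only [curvatureOp, map_add, map_sub, add_apply, sub_apply]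
  linarith [h.symm u hu (christoffel G u y z) (christoffel G u x z)]

lemma isCurvatureLike (h : IsMetricOn G O) (hu : u ∈ O) :
    IsCurvatureLike fun X Y Z W => G u (curvatureOp G u X Y Z) W where
  add_left _ _ _ _ _ := by simp [curvatureOp]; ring
  smul_left _ _ _ _ _ := by simp [curvatureOp]; ring
  antisymm_left _ _ _ _ := by simp [curvatureOp]; ring
  antisymm_right x y z w := by
    have e := h.curvatureOp_self hu x y (z + w)
    have e1 := h.curvatureOp_self hu x y z
    have e2 := h.curvatureOp_self hu x y w
    have hadd : curvatureOp G u x y (z + w) = curvatureOp G u x y z + curvatureOp G u x y w := by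
      simp only [curvatureOp, map_add]; abel
    rw [hadd] at e
    simp only [map_add, add_apply] at e
    linarith
  bianchi x y z w := by
    simp only [← add_apply, ← map_add]
    suffices e : curvatureOp G u x y z + curvatureOp G u y z x + curvatureOp G u z x y = 0 by
      rw [e, map_zero, zero_apply]
    simp only [curvatureOp, h.christoffel_symm hu z, h.christoffel_symm hu y x,
      h.fderiv_christoffel_symm hu x z, h.fderiv_christoffel_symm hu y x,
      h.fderiv_christoffel_symm hu z y]
    abel

end IsMetricOn

end LeviCivita

/-! ### Geodesics of the Sasaki metric -/

section Sasaki

variable {F : Type*} [NormedAddCommGroup F] [NormedSpace ℝ F] [FiniteDimensional ℝ F]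
  {G : F → F →L[ℝ] F →L[ℝ] ℝ} {O : Set F}

namespace IsMetricOn

lemma hasDerivAt_apply (h : IsMetricOn G O) {c V W : ℝ → F} {t : ℝ} (ht : c t ∈ O)
    (hc : DifferentiableAt ℝ c t) (hV : DifferentiableAt ℝ V t) (hW : DifferentiableAt ℝ W t) :
    HasDerivAt (fun s => G (c s) (V s) (W s))
      (G (c t) (covDerivAlong G c V t) (W t) + G (c t) (V t) (covDerivAlong G c W t)) t := by
  have hG : HasDerivAt (fun s => G (c s)) (fderiv ℝ G (c t) (deriv c t)) t :=
    (h.differentiableAt ht).hasFDerivAt.comp_hasDerivAt t hc.hasDerivAt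
  convert hasDerivAt_clm_apply_apply hG hV.hasDerivAt hW.hasDerivAt using 1
  rw [h.fderiv_apply ht]
  simp only [covDerivAlong, map_add, add_apply]
  ring

lemma contDiffOn_sasaki (h : IsMetricOn G O) : ContDiffOn ℝ ∞ (sasaki G) (O ×ˢ univ) := by
  have hmaps : MapsTo (Prod.fst : F × F → F) (O ×ˢ univ) O := fun c hc => hc.1
  have hG : ContDiffOn ℝ ∞ (fun c : F × F => G c.1) (O ×ˢ univ) :=
    h.contDiffOn.comp contDiff_fst.contDiffOn hmaps
  have hΓ : ContDiffOn ℝ ∞ (fun c : F × F => christoffel G c.1) (O ×ˢ univ) :=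
    h.contDiffOn_christoffel.comp contDiff_fst.contDiffOn hmaps
  have hconn : ContDiffOn ℝ ∞ (connector G) (O ×ˢ univ) :=
    contDiffOn_const.add ((((ContinuousLinearMap.flipₗᵢ ℝ F F F).contDiff.comp_contDiffOn
      hΓ).clm_apply contDiff_snd.contDiffOn).clm_comp contDiffOn_const)
  have hbil {A : F × F → F × F →L[ℝ] F} (hA : ContDiffOn ℝ ∞ A (O ×ˢ univ)) :
      ContDiffOn ℝ ∞ (fun c => (G c.1).bilinearComp (A c) (A c)) (O ×ˢ univ) := by
    have h1 : ContDiffOn ℝ ∞ (fun c => (G c.1).comp (A c)) (O ×ˢ univ) := hG.clm_comp hA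
    have h2 := (ContinuousLinearMap.flipₗᵢ ℝ (F × F) F ℝ).contDiff.comp_contDiffOn h1
    have h3 := ContDiffOn.clm_comp h2 hA
    exact (ContinuousLinearMap.flipₗᵢ ℝ (F × F) (F × F) ℝ).contDiff.comp_contDiffOn h3
  exact (hbil contDiffOn_const).add (hbil hconn)

/-- The Sasaki metric is a Riemannian metric. -/
lemma sasaki (h : IsMetricOn G O) : IsMetricOn (sasaki G) (O ×ˢ univ) where
  isOpen := h.isOpen.prod isOpen_univ
  contDiffOn := h.contDiffOn_sasaki
  symm := by
    rintro ⟨u, ξ⟩ ⟨hu, -⟩ ⟨v, a⟩ ⟨w, b⟩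
    rw [sasaki_apply, sasaki_apply, h.symm u hu v, h.symm u hu (a + _)]
  pos := by
    rintro ⟨u, ξ⟩ ⟨hu, -⟩ ⟨v, a⟩ hva
    have hnn (x : F) : 0 ≤ G u x x := by
      rcases eq_or_ne x 0 with rfl | hx
      · simp
      · exact (h.pos u hu x hx).le
    rw [sasaki_apply]
    rcases eq_or_ne v 0 with rfl | hv
    · have ha : a ≠ 0 := fun ha => hva (by rw [ha]; rfl)
      simpa using h.pos u hu a ha
    · exact add_pos_of_pos_of_nonneg (h.pos u hu v hv) (hnn _)

lemma fderiv_sasaki (h : IsMetricOn G O) {u : F} (hu : u ∈ O) (ξ x y v a w b : F) :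
    fderiv ℝ (SpaceFormGeodesics.sasaki G) (u, ξ) (x, y) (v, a) (w, b) =
      fderiv ℝ G u x v w
      + (fderiv ℝ G u x (a + christoffel G u v ξ) (b + christoffel G u w ξ)
        + G u (fderiv ℝ (christoffel G) u x v ξ + christoffel G u v y) (b + christoffel G u w ξ)
        + G u (a + christoffel G u v ξ)
          (fderiv ℝ (christoffel G) u x w ξ + christoffel G u w y)) := by
  have hσ : HasDerivAt (fun s : ℝ => SpaceFormGeodesics.sasaki G ((u, ξ) + s • (x, y))
      (v, a) (w, b)) (fderiv ℝ (SpaceFormGeodesics.sasaki G) (u, ξ) (x, y) (v, a) (w, b)) 0 :=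
    hasDerivAt_apply_apply_line (h.sasaki.differentiableAt ⟨hu, mem_univ ξ⟩) (x, y) (v, a) (w, b)
  have hG := hasDerivAt_comp_line (h.differentiableAt hu) x
  have hΓ (v a : F) : HasDerivAt (fun s : ℝ => a + christoffel G (u + s • x) v (ξ + s • y))
      (fderiv ℝ (christoffel G) u x v ξ + christoffel G u v y) 0 := by
    simpa using (((hasDerivAt_comp_line (h.differentiableAt_christoffel hu) x).clm_apply
      (hasDerivAt_const 0 v)).clm_apply (hasDerivAt_line ξ y)).const_add a
  have e := (hasDerivAt_clm_apply_apply hG (hasDerivAt_const 0 v) (hasDerivAt_const 0 w)).add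
    (hasDerivAt_clm_apply_apply hG (hΓ v a) (hΓ w b))
  refine hσ.unique ?_
  convert e using 1
  · ext s
    simp [sasaki_apply]
  · simp

variable {u ξ : ℝ → F} {T : Set ℝ} {t : ℝ}

lemma contDiffOn_covDerivAlong (h : IsMetricOn G O) (hT : IsOpen T) (hu : ContDiffOn ℝ ∞ u T)
    (hmaps : MapsTo u T O) (hξ : ContDiffOn ℝ ∞ ξ T) :
    ContDiffOn ℝ ∞ (covDerivAlong G u ξ) T :=
  (hξ.deriv_of_isOpen hT (by simp)).add
    (((h.contDiffOn_christoffel.comp hu hmaps).clm_apply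
      (hu.deriv_of_isOpen hT (by simp))).clm_apply hξ)

/-- The acceleration of a curve in the tangent bundle, tested against the tangent vector with
horizontal part `w` and vertical part `b + Γ (w, ξ)`. -/
lemma sasaki_sasakiAcceleration (h : IsMetricOn G O) (hT : IsOpen T) (hu : ContDiffOn ℝ ∞ u T)
    (hmaps : MapsTo u T O) (hξ : ContDiffOn ℝ ∞ ξ T) (ht : t ∈ T) (w b : F) :
    SpaceFormGeodesics.sasaki G (u t, ξ t)
        (sasakiAcceleration G (fun s => (u s, ξ s)) t) (w, b) =
      G (u t) (covDerivAlong G u (deriv u) t) w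
      + G (u t) (curvatureOp G (u t) (deriv u t) w (ξ t)) (covDerivAlong G u ξ t)
      + G (u t) (covDerivAlong G u (covDerivAlong G u ξ) t) (b + christoffel G (u t) w (ξ t)) := by
  have hd {f : ℝ → F} (hf : ContDiffOn ℝ ∞ f T) {s : ℝ} (hs : s ∈ T) : HasDerivAt f (deriv f s) s :=
    ((hf.contDiffAt (hT.mem_nhds hs)).differentiableAt (by simp)).hasDerivAt
  have hut := hmaps ht
  have hu' := hu.deriv_of_isOpen (m := ∞) hT (by simp)
  have hξ' := hξ.deriv_of_isOpen (m := ∞) hT (by simp)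
  have hc1 : ∀ s ∈ T, deriv (fun s => (u s, ξ s)) s = (deriv u s, deriv ξ s) := fun s hs =>
    ((hd hu hs).prodMk (hd hξ hs)).deriv
  have hc2 : deriv (deriv fun s => (u s, ξ s)) t = (deriv (deriv u) t, deriv (deriv ξ) t) := by
    refine HasDerivAt.deriv (((hd hu' ht).prodMk (hd hξ' ht)).congr_of_eventuallyEq ?_)
    filter_upwards [hT.mem_nhds ht] with s hs using hc1 s hs
  have hη : deriv (covDerivAlong G u ξ) t = deriv (deriv ξ) t
      + (fderiv ℝ (christoffel G) (u t) (deriv u t) (deriv u t) (ξ t)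
        + christoffel G (u t) (deriv (deriv u) t) (ξ t)
        + christoffel G (u t) (deriv u t) (deriv ξ t)) := by
    have e := (((h.differentiableAt_christoffel hut).hasFDerivAt.comp_hasDerivAt t
      (hd hu ht)).clm_apply (hd hu' ht)).clm_apply (hd hξ ht)
    refine (((hd hξ' ht).add e).deriv).trans ?_
    simp
  have hσ := h.sasaki.apply_christoffel (u := (u t, ξ t)) ⟨hut, mem_univ _⟩
    (deriv u t, deriv ξ t) (deriv u t, deriv ξ t) (w, b)
  rw [sasakiAcceleration, covDerivAlong, hc2, hc1 t ht, map_add, add_apply, hσ,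
    christoffelFirst_apply, sasaki_apply,
    h.fderiv_sasaki hut, h.fderiv_sasaki hut]
  have hηt : deriv ξ t = covDerivAlong G u ξ t - christoffel G (u t) (deriv u t) (ξ t) := by
    simp [covDerivAlong]
  set η := covDerivAlong G u ξ t
  have hDη : covDerivAlong G u (covDerivAlong G u ξ) t = deriv (deriv ξ) t
      + (fderiv ℝ (christoffel G) (u t) (deriv u t) (deriv u t) (ξ t)
        + christoffel G (u t) (deriv (deriv u) t) (ξ t)
        + christoffel G (u t) (deriv u t) (deriv ξ t))
      + christoffel G (u t) (deriv u t) η := by rw [covDerivAlong, hη]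
  rw [hDη, covDerivAlong, curvatureOp]
  rw [hηt]
  generalize deriv u t = v, deriv (deriv u) t = a, deriv (deriv ξ) t = α, u t = p, ξ t = ξ at *
  have hs := h.symm p hut
  simp only [h.fderiv_apply hut, map_add, map_sub, add_apply, sub_apply, sub_add_cancel]
  rw [h.christoffel_symm hut w v]
  linarith [hs η (christoffel G p w η), hs η (fderiv ℝ (christoffel G) p w v ξ),
    hs η (christoffel G p v b), hs η (fderiv ℝ (christoffel G) p v w ξ),
    hs η (christoffel G p v (christoffel G p w ξ)), hs η (christoffel G p w (christoffel G p v ξ)),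
    hs v (christoffel G p v w)]

/-- If the acceleration of a curve in the tangent bundle is orthogonal to the horizontal vectors,
then its projection satisfies `∇_t u' = -R (ξ, ξ') u'`. -/
lemma covDerivAlong_deriv_eq (h : IsMetricOn G O) (hT : IsOpen T) (hu : ContDiffOn ℝ ∞ u T)
    (hmaps : MapsTo u T O) (hξ : ContDiffOn ℝ ∞ ξ T) (ht : t ∈ T)
    (hacc : ∀ w, SpaceFormGeodesics.sasaki G (u t, ξ t)
      (sasakiAcceleration G (fun s => (u s, ξ s)) t) (w, -christoffel G (u t) w (ξ t)) = 0) :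
    covDerivAlong G u (deriv u) t =
      -curvatureOp G (u t) (ξ t) (covDerivAlong G u ξ t) (deriv u t) := by
  refine h.eq_of_forall (hmaps ht) fun w => ?_
  have e := hacc w
  rw [h.sasaki_sasakiAcceleration hT hu hmaps hξ ht, neg_add_cancel, map_zero, add_zero] at e
  have e' := (h.isCurvatureLike (hmaps ht)).pair_symm (deriv u t) w (ξ t) (covDerivAlong G u ξ t)
  rw [map_neg, neg_apply]
  linarith

/-- Geodesics of the tangent bundle satisfy `∇_t u' = -R (ξ, ξ') u'` and `ξ'' = 0`. -/
lemma tangentGeodesic_equations (h : IsMetricOn G O) (hT : IsOpen T) (hu : ContDiffOn ℝ ∞ u T)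
    (hmaps : MapsTo u T O) (hξ : ContDiffOn ℝ ∞ ξ T) (ht : t ∈ T)
    (hacc : sasakiAcceleration G (fun s => (u s, ξ s)) t = 0) :
    covDerivAlong G u (deriv u) t =
        -curvatureOp G (u t) (ξ t) (covDerivAlong G u ξ t) (deriv u t) ∧
      covDerivAlong G u (covDerivAlong G u ξ) t = 0 := by
  refine ⟨h.covDerivAlong_deriv_eq hT hu hmaps hξ ht fun w => by rw [hacc, map_zero, zero_apply],
    h.eq_of_forall (hmaps ht) fun b => ?_⟩
  have e := h.sasaki_sasakiAcceleration hT hu hmaps hξ ht 0 b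
  rw [hacc] at e
  simpa [curvatureOp] using e.symm

lemma fderiv_normSq (h : IsMetricOn G O) {p : F} (hp : p ∈ O) (η w b : F) :
    fderiv ℝ (fun c : F × F => G c.1 c.2 c.2) (p, η) (w, b) =
      2 * G p η (b + christoffel G p w η) := by
  have hd : DifferentiableAt ℝ (fun c : F × F => G c.1 c.2 c.2) (p, η) :=
    ((((h.differentiableAt hp).comp (p, η) differentiableAt_fst).clm_apply
      differentiableAt_snd).clm_apply differentiableAt_snd)
  have e := hasDerivAt_clm_apply_apply (hasDerivAt_comp_line (h.differentiableAt hp) w)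
    (hasDerivAt_line η b) (hasDerivAt_line η b)
  have e' := (hasDerivAt_comp_line hd (w, b)).unique e
  rw [e']
  simp only [zero_smul, add_zero, h.fderiv_apply hp, map_add]
  linarith [h.symm p hp (christoffel G p w η) η, h.symm p hp b η]

/-- Geodesics of the tangent sphere bundle satisfy `∇_t u' = -R (ξ, ξ') u'`, and `ξ''` is
proportional to `ξ`. -/
lemma sphereGeodesic_equations (h : IsMetricOn G O) (hT : IsOpen T) (hu : ContDiffOn ℝ ∞ u T)
    (hmaps : MapsTo u T O) (hξ : ContDiffOn ℝ ∞ ξ T) (ht : t ∈ T)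
    (hunit : G (u t) (ξ t) (ξ t) = 1)
    (hacc : ∀ w : F × F, fderiv ℝ (fun c : F × F => G c.1 c.2 c.2) (u t, ξ t) w = 0 →
      SpaceFormGeodesics.sasaki G (u t, ξ t)
        (sasakiAcceleration G (fun s => (u s, ξ s)) t) w = 0) :
    covDerivAlong G u (deriv u) t =
        -curvatureOp G (u t) (ξ t) (covDerivAlong G u ξ t) (deriv u t) ∧
      ∃ l : ℝ, covDerivAlong G u (covDerivAlong G u ξ) t = l • ξ t := by
  refine ⟨h.covDerivAlong_deriv_eq hT hu hmaps hξ ht fun w => hacc _ ?_, ?_⟩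
  · rw [h.fderiv_normSq (hmaps ht), neg_add_cancel, map_zero, mul_zero]
  · set A := covDerivAlong G u (covDerivAlong G u ξ) t with hA
    refine ⟨G (u t) (ξ t) A, ?_⟩
    set b := A - G (u t) (ξ t) A • ξ t with hb
    have hξb : G (u t) (ξ t) b = 0 := by simp [hb, hunit]
    have e := hacc (0, b) (by rw [h.fderiv_normSq (hmaps ht)]; simp [hξb])
    rw [h.sasaki_sasakiAcceleration hT hu hmaps hξ ht, ← hA] at e
    have hAb : G (u t) A b = 0 := by simpa [curvatureOp] using e
    have hbb : G (u t) b b = 0 := by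
      nth_rewrite 1 [hb]
      simp [hAb, hξb]
    by_contra hne
    exact (h.pos _ (hmaps ht) b (sub_ne_zero.2 hne)).ne' hbb

end IsMetricOn

end Sasaki

/-! ### Curves driven by a parallel field of skew-symmetric operators -/

section Parallel

variable {F : Type*} [NormedAddCommGroup F] [NormedSpace ℝ F]
  {G : F → F →L[ℝ] F →L[ℝ] ℝ} {O : Set F}

/-- The vector field `V` along `c` is differentiable at `t`, with covariant derivative `V'`. -/
def HasCovDerivAt (G : F → F →L[ℝ] F →L[ℝ] ℝ) (c V : ℝ → F) (V' : F) (t : ℝ) : Prop :=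
  HasDerivAt V (V' - christoffel G (c t) (deriv c t) (V t)) t

namespace HasCovDerivAt

variable {c V W : ℝ → F} {V' W' : F} {t : ℝ}

lemma of_differentiableAt (hV : DifferentiableAt ℝ V t) :
    HasCovDerivAt G c V (covDerivAlong G c V t) t := by
  simpa [HasCovDerivAt, covDerivAlong] using hV.hasDerivAt

lemma covDerivAlong_eq (hV : HasCovDerivAt G c V V' t) : covDerivAlong G c V t = V' := by
  rw [covDerivAlong, HasDerivAt.deriv hV, sub_add_cancel]

protected lemma differentiableAt (hV : HasCovDerivAt G c V V' t) : DifferentiableAt ℝ V t :=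
  HasDerivAt.differentiableAt hV

lemma congr_of_eventuallyEq (hV : HasCovDerivAt G c V V' t) (h : W =ᶠ[𝓝 t] V) :
    HasCovDerivAt G c W V' t :=
  (HasDerivAt.congr_of_eventuallyEq hV h).congr_deriv (by rw [h.eq_of_nhds])

protected lemma add (hV : HasCovDerivAt G c V V' t) (hW : HasCovDerivAt G c W W' t) :
    HasCovDerivAt G c (fun s => V s + W s) (V' + W') t := by
  refine (HasDerivAt.add hV hW).congr_deriv ?_
  rw [map_add]; abel

protected lemma smul {f : ℝ → ℝ} {f' : ℝ} (hf : HasDerivAt f f' t)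
    (hV : HasCovDerivAt G c V V' t) :
    HasCovDerivAt G c (fun s => f s • V s) (f' • V t + f t • V') t := by
  refine (HasDerivAt.smul hf hV).congr_deriv ?_
  rw [map_smul, smul_sub]; abel

protected lemma const_smul (r : ℝ) (hV : HasCovDerivAt G c V V' t) :
    HasCovDerivAt G c (fun s => r • V s) (r • V') t := by
  simpa using HasCovDerivAt.smul (hasDerivAt_const t r) hV

protected lemma neg (hV : HasCovDerivAt G c V V' t) :
    HasCovDerivAt G c (fun s => -V s) (-V') t := by
  simpa using hV.const_smul (-1)

protected lemma sub (hV : HasCovDerivAt G c V V' t) (hW : HasCovDerivAt G c W W' t) :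
    HasCovDerivAt G c (fun s => V s - W s) (V' - W') t := by
  simpa [sub_eq_add_neg] using hV.add hW.neg

protected lemma sum {ι : Type*} {s : Finset ι} {V : ι → ℝ → F} {V' : ι → F}
    (hV : ∀ a ∈ s, HasCovDerivAt G c (V a) (V' a) t) :
    HasCovDerivAt G c (fun x => ∑ a ∈ s, V a x) (∑ a ∈ s, V' a) t := by
  refine (HasDerivAt.fun_sum hV).congr_deriv ?_
  rw [map_sum, Finset.sum_sub_distrib]

/-- Leibniz rule for a field of endomorphisms. -/
protected lemma clm_apply {A : F → F →L[ℝ] F} (hA : DifferentiableAt ℝ A (c t))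
    (hc : DifferentiableAt ℝ c t) (hV : HasCovDerivAt G c V V' t) :
    HasCovDerivAt G c (fun s => A (c s) (V s))
      (A (c t) V' + covDerivEnd G A (c t) (deriv c t) (V t)) t := by
  refine ((hA.hasFDerivAt.comp_hasDerivAt t hc.hasDerivAt).clm_apply hV).congr_deriv ?_
  simp only [covDerivEnd, map_sub, sub_apply, add_apply, ContinuousLinearMap.comp_apply]
  abel

end HasCovDerivAt

lemma sum_sum_smul_eq_zero {n : ℕ} {θ : Fin n → Fin n → ℝ} (hθ : ∀ a b, θ a b = -θ b a)
    {S : Fin n → Fin n → F} (hS : ∀ a b, S a b = S b a) : ∑ a, ∑ b, θ a b • S a b = 0 := by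
  have e : ∑ a, ∑ b, θ a b • S a b = -∑ a, ∑ b, θ a b • S a b := by
    conv_lhs => rw [Finset.sum_comm]
    simp only [← Finset.sum_neg_distrib]
    refine Finset.sum_congr rfl fun a _ => Finset.sum_congr rfl fun b _ => ?_
    rw [hθ b a, hS b a, neg_smul]
  have e2 : (2 : ℝ) • ∑ a, ∑ b, θ a b • S a b = 0 := by
    rw [two_smul]
    nth_rewrite 1 [e]
    exact neg_add_cancel _
  exact (smul_eq_zero.1 e2).resolve_left two_ne_zero

lemma modelCurvature_self {ι : Type*} [Fintype ι] {B : F →L[ℝ] F →L[ℝ] ℝ} {κ : ℝ}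
    {J : ι → F →L[ℝ] F} (hB : ∀ x y, B x y = B y x) (hJ : ∀ a x y, B x (J a y) = -B (J a x) y)
    (X Z : F) : modelCurvature B κ J X X Z = 0 := by
  have e (a : ι) : B X (J a X) = 0 := by linarith [hJ a X X, hB (J a X) X]
  simp [modelCurvature, e]

lemma modelCurvature_smul_snd {ι : Type*} [Fintype ι] {B : F →L[ℝ] F →L[ℝ] ℝ} {κ : ℝ}
    {J : ι → F →L[ℝ] F} (r : ℝ) (X Y Z : F) :
    modelCurvature B κ J X (r • Y) Z = r • modelCurvature B κ J X Y Z := by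
  simp only [modelCurvature, map_smul, smul_apply, smul_eq_mul]
  rw [smul_comm r κ]
  congr 1
  rw [smul_add, Finset.smul_sum]
  congr 1
  · module
  · exact Finset.sum_congr rfl fun a _ => by module

variable [FiniteDimensional ℝ F]

lemma IsMetricOn.hasDerivAt_of_hasCovDerivAt (h : IsMetricOn G O) {c V W : ℝ → F} {V' W' : F}
    {t : ℝ} (ht : c t ∈ O) (hc : DifferentiableAt ℝ c t) (hV : HasCovDerivAt G c V V' t)
    (hW : HasCovDerivAt G c W W' t) :
    HasDerivAt (fun s => G (c s) (V s) (W s)) (G (c t) V' (W t) + G (c t) (V t) W') t := by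
  have := h.hasDerivAt_apply ht hc hV.differentiableAt hW.differentiableAt
  rwa [hV.covDerivAlong_eq, hW.covDerivAlong_eq] at this

/-- The metric `G` on `O` carries a family of skew-symmetric, anticommuting almost complex
structures `Jₐ` whose span is a parallel algebra together with the identity, and its curvature is
the model curvature built from the `Jₐ`. With no, one and three `Jₐ`, these are the real, complex
and quaternionic space forms. -/
structure IsModelSpace {n : ℕ} (G : F → F →L[ℝ] F →L[ℝ] ℝ) (O : Set F) (κ : ℝ)
    (J : Fin n → F → F →L[ℝ] F) : Prop where
  metric : IsMetricOn G O
  differentiableAt : ∀ a, ∀ u ∈ O, DifferentiableAt ℝ (J a) u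
  skew : ∀ u ∈ O, ∀ a v w, G u v (J a u w) = -G u (J a u v) w
  clifford : ∀ u ∈ O, ∀ a b x,
    J a u (J b u x) + J b u (J a u x) = if a = b then (-2 : ℝ) • x else 0
  mul_mem : ∀ u ∈ O, ∀ a b x,
    J a u (J b u x) ∈ Submodule.span ℝ (insert x (range fun d => J d u x))
  parallel : ∀ u ∈ O, ∀ v, ∃ θ : Fin n → Fin n → ℝ, (∀ a b, θ a b = -θ b a) ∧
    ∀ a, covDerivEnd G (J a) u v = ∑ b, θ a b • J b u
  curvature : ∀ u ∈ O, ∀ X Y Z,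
    curvatureOp G u X Y Z = modelCurvature (G u) κ (fun a => J a u) X Y Z

namespace IsModelSpace

variable {n : ℕ} {κ : ℝ} {J : Fin n → F → F →L[ℝ] F}

/-- The model curvature is parallel: the terms in which a `Jₐ` is differentiated cancel, as the
connection matrix `θ` of the family is skew-symmetric. -/
lemma hasCovDerivAt_modelCurvature (h : IsModelSpace G O κ J) {c X Y Z : ℝ → F} {X' Y' Z' : F}
    {t : ℝ} (ht : c t ∈ O) (hc : DifferentiableAt ℝ c t) (hX : HasCovDerivAt G c X X' t)
    (hY : HasCovDerivAt G c Y Y' t) (hZ : HasCovDerivAt G c Z Z' t) :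
    HasCovDerivAt G c
      (fun s => modelCurvature (G (c s)) κ (fun a => J a (c s)) (X s) (Y s) (Z s))
      (modelCurvature (G (c t)) κ (fun a => J a (c t)) X' (Y t) (Z t)
        + modelCurvature (G (c t)) κ (fun a => J a (c t)) (X t) Y' (Z t)
        + modelCurvature (G (c t)) κ (fun a => J a (c t)) (X t) (Y t) Z') t := by
  obtain ⟨θ, hθ, hJ⟩ := h.parallel (c t) ht (deriv c t)
  have hJd (a : Fin n) {V : ℝ → F} {V' : F} (hV : HasCovDerivAt G c V V' t) :=
    hV.clm_apply (h.differentiableAt a _ ht) hc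
  have hG {V W : ℝ → F} {V' W' : F} (hV : HasCovDerivAt G c V V' t)
      (hW : HasCovDerivAt G c W W' t) := h.metric.hasDerivAt_of_hasCovDerivAt ht hc hV hW
  have key := (((hX.smul (hG hY hZ)).sub (hY.smul (hG hX hZ))).add
    (HasCovDerivAt.sum (s := Finset.univ) fun a _ =>
      (((hJd a hX).smul (hG (hJd a hY) hZ)).sub ((hJd a hY).smul (hG (hJd a hX) hZ))).add
        ((hJd a hZ).smul ((hG hX (hJd a hY)).const_mul 2)))).const_smul κ
  refine HasDerivAt.congr_deriv key ?_
  congr 1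
  simp only [modelCurvature, hJ]
  rw [← smul_add, ← smul_add]
  congr 1
  have hz := sum_sum_smul_eq_zero hθ (S := fun a b =>
    (G (c t) (J b (c t) (Y t)) (Z t)) • J a (c t) (X t)
      + (G (c t) (J a (c t) (Y t)) (Z t)) • J b (c t) (X t)
      - (G (c t) (J b (c t) (X t)) (Z t)) • J a (c t) (Y t)
      - (G (c t) (J a (c t) (X t)) (Z t)) • J b (c t) (Y t)
      + (2 * G (c t) (X t) (J b (c t) (Y t))) • J a (c t) (Z t)
      + (2 * G (c t) (X t) (J a (c t) (Y t))) • J b (c t) (Z t)) (fun a b => by abel)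
  have hz' : ∑ a, ((G (c t) ((∑ b, θ a b • J b (c t)) (Y t)) (Z t)) • J a (c t) (X t)
      + (G (c t) (J a (c t) (Y t)) (Z t)) • (∑ b, θ a b • J b (c t)) (X t)
      - (G (c t) ((∑ b, θ a b • J b (c t)) (X t)) (Z t)) • J a (c t) (Y t)
      - (G (c t) (J a (c t) (X t)) (Z t)) • (∑ b, θ a b • J b (c t)) (Y t)
      + (2 * G (c t) (X t) ((∑ b, θ a b • J b (c t)) (Y t))) • J a (c t) (Z t)
      + (2 * G (c t) (X t) (J a (c t) (Y t))) • (∑ b, θ a b • J b (c t)) (Z t)) = 0 := by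
    rw [← hz]
    refine Finset.sum_congr rfl fun a _ => ?_
    simp only [sum_apply, smul_apply, map_sum, map_smul, Finset.smul_sum, Finset.sum_smul,
      smul_eq_mul, Finset.mul_sum, ← Finset.sum_add_distrib, ← Finset.sum_sub_distrib]
    exact Finset.sum_congr rfl fun b _ => by module
  have comb : ∀ (p b c d : F) (K B C D E : Fin n → F), p = b + c + d →
      (∀ a, K a = B a + C a + D a + E a) → ∑ a, E a = 0 →
      p + ∑ a, K a = (b + ∑ a, B a) + (c + ∑ a, C a) + (d + ∑ a, D a) := by
    intro p b c d K B C D E hp hK hE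
    simp only [hK, Finset.sum_add_distrib, hE, hp]
    abel
  refine comb _ _ _ _ _ _ _ _ _ ?_ (fun a => ?_) hz'
  · module
  · simp only [map_add, add_apply]
    module

end IsModelSpace

/-- The iterated covariant derivatives `u', ∇_t u', ∇_t ∇_t u', …` of the velocity of `u`. -/
def iterCovDerivAlong (G : F → F →L[ℝ] F →L[ℝ] ℝ) (u : ℝ → F) : ℕ → ℝ → F
  | 0 => deriv u
  | m + 1 => covDerivAlong G u (iterCovDerivAlong G u m)

lemma IsMetricOn.contDiffOn_iterCovDerivAlong (h : IsMetricOn G O) {u : ℝ → F} {T : Set ℝ}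
    (hT : IsOpen T) (hu : ContDiffOn ℝ ∞ u T) (hmaps : MapsTo u T O) (m : ℕ) :
    ContDiffOn ℝ ∞ (iterCovDerivAlong G u m) T := by
  induction m with
  | zero => exact hu.deriv_of_isOpen hT (by simp)
  | succ m ih => exact h.contDiffOn_covDerivAlong hT hu hmaps ih

namespace IsModelSpace

variable {n : ℕ} {κ : ℝ} {J : Fin n → F → F →L[ℝ] F} {u ξ : ℝ → F} {T : Set ℝ} {t : ℝ}

/-- The operator `R (ξ, ξ')` is parallel along `u`, and `∇_t u' = -R (ξ, ξ') u'`; so `-R (ξ, ξ')`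
maps each iterated covariant derivative of `u'` to the next one. -/
lemma iterCovDerivAlong_succ (h : IsModelSpace G O κ J) (hT : IsOpen T)
    (hu : ContDiffOn ℝ ∞ u T) (hmaps : MapsTo u T O) (hξ : ContDiffOn ℝ ∞ ξ T)
    (hgeo : ∀ s ∈ T, covDerivAlong G u (deriv u) s =
      -curvatureOp G (u s) (ξ s) (covDerivAlong G u ξ s) (deriv u s))
    (hξ' : ∀ s ∈ T, ∃ l : ℝ, covDerivAlong G u (covDerivAlong G u ξ) s = l • ξ s) (m : ℕ) :
    ∀ s ∈ T, iterCovDerivAlong G u (m + 1) s = -modelCurvature (G (u s)) κ (fun a => J a (u s))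
      (ξ s) (covDerivAlong G u ξ s) (iterCovDerivAlong G u m s) := by
  have hd {f : ℝ → F} (hf : ContDiffOn ℝ ∞ f T) {s : ℝ} (hs : s ∈ T) : DifferentiableAt ℝ f s :=
    (hf.contDiffAt (hT.mem_nhds hs)).differentiableAt (by simp)
  induction m with
  | zero =>
    intro s hs
    rw [← h.curvature _ (hmaps hs)]
    exact hgeo s hs
  | succ m ih =>
    intro s hs
    have hη := h.metric.contDiffOn_covDerivAlong hT hu hmaps hξ
    have hV := h.metric.contDiffOn_iterCovDerivAlong hT hu hmaps m
    have e := (h.hasCovDerivAt_modelCurvature (hmaps hs) (hd hu hs)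
      (HasCovDerivAt.of_differentiableAt (hd hξ hs)) (HasCovDerivAt.of_differentiableAt (hd hη hs))
      (HasCovDerivAt.of_differentiableAt (hd hV hs))).neg
    have e' : iterCovDerivAlong G u (m + 1) =ᶠ[𝓝 s] fun s => -modelCurvature (G (u s)) κ
        (fun a => J a (u s)) (ξ s) (covDerivAlong G u ξ s) (iterCovDerivAlong G u m s) := by
      filter_upwards [hT.mem_nhds hs] with r hr using ih r hr
    obtain ⟨l, hl⟩ := hξ' s hs
    have hB := h.metric.symm _ (hmaps hs)
    have hJ := h.skew _ (hmaps hs)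
    rw [iterCovDerivAlong, (e.congr_of_eventuallyEq e').covDerivAlong_eq, hl,
      modelCurvature_smul_snd,
      modelCurvature_self hB hJ, modelCurvature_self hB hJ, smul_zero, zero_add, zero_add]
    rfl

/-- The operator `-R (ξ, ξ')`, hence the covariant derivative on the span of the iterated
covariant derivatives of `u'`, is skew-symmetric. -/
lemma inner_iterCovDerivAlong_succ (h : IsModelSpace G O κ J) (hT : IsOpen T)
    (hu : ContDiffOn ℝ ∞ u T) (hmaps : MapsTo u T O) (hξ : ContDiffOn ℝ ∞ ξ T)
    (hgeo : ∀ s ∈ T, covDerivAlong G u (deriv u) s =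
      -curvatureOp G (u s) (ξ s) (covDerivAlong G u ξ s) (deriv u s))
    (hξ' : ∀ s ∈ T, ∃ l : ℝ, covDerivAlong G u (covDerivAlong G u ξ) s = l • ξ s)
    (ht : t ∈ T) (i j : ℕ) :
    G (u t) (iterCovDerivAlong G u (i + 1) t) (iterCovDerivAlong G u j t) =
      -G (u t) (iterCovDerivAlong G u i t) (iterCovDerivAlong G u (j + 1) t) := by
  have e (m : ℕ) := h.iterCovDerivAlong_succ hT hu hmaps hξ hgeo hξ' m t ht
  have hK := isCurvatureLike_modelCurvature (h.metric.symm _ (hmaps ht)) κ (h.skew _ (hmaps ht))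
  have hs := hK.antisymm_right (ξ t) (covDerivAlong G u ξ t) (iterCovDerivAlong G u i t)
    (iterCovDerivAlong G u j t)
  rw [e, e, map_neg, map_neg, neg_apply, h.metric.symm _ (hmaps ht) (iterCovDerivAlong G u i t)]
  linarith

/-- The orbit of a vector `v` under `R (x, y)` spans a space of bounded dimension: the sum of the
span of `v` and `S v`, where `S = ∑ₐ ⟨x, Jₐ y⟩ Jₐ`, and the span of `x`, `y`, `Jₐ x`, `Jₐ y` is
invariant under `R (x, y)`. -/
lemma exists_invariant_submodule (h : IsModelSpace G O κ J) {p : F} (hp : p ∈ O) (x y v : F) :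
    ∃ W : Submodule ℝ F, v ∈ W ∧
      (∀ z ∈ W, modelCurvature (G p) κ (fun a => J a p) x y z ∈ W) ∧
      Module.finrank ℝ W ≤ (if n = 0 then 1 else 2) + 2 * (n + 1) := by
  classical
  set S : F →L[ℝ] F := ∑ a, G p x (J a p y) • J a p with hS
  have hSS (z : F) : S (S z) = -(∑ a, G p x (J a p y) ^ 2) • z := by
    have e : (2 : ℝ) • S (S z) = (2 : ℝ) • (-(∑ a, G p x (J a p y) ^ 2) • z) := by
      have e1 : S (S z) = ∑ a, ∑ b, (G p x (J a p y) * G p x (J b p y)) • J a p (J b p z) := by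
        simp only [hS, sum_apply, smul_apply, map_sum, map_smul, Finset.smul_sum, smul_smul]
        rw [Finset.sum_comm]
        refine Finset.sum_congr rfl fun a _ => Finset.sum_congr rfl fun b _ => ?_
        rw [mul_comm]
      have e2 : S (S z) = ∑ a, ∑ b, (G p x (J a p y) * G p x (J b p y)) • J b p (J a p z) := by
        rw [e1, Finset.sum_comm]
        refine Finset.sum_congr rfl fun a _ => Finset.sum_congr rfl fun b _ => ?_
        rw [mul_comm]
      rw [two_smul]
      nth_rewrite 1 [e1]
      rw [e2]
      simp only [← Finset.sum_add_distrib, ← smul_add, h.clifford p hp, smul_ite, smul_zero,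
        Finset.sum_ite_eq, Finset.mem_univ, if_true, ← Finset.sum_smul, smul_smul]
      congr 1
      rw [← Finset.sum_mul, mul_comm, neg_mul, mul_neg]
      simp only [sq]
    exact smul_right_injective F (two_ne_zero' ℝ) e
  let f : Fin 2 × Option (Fin n) → F := fun i =>
    i.2.elim (![x, y] i.1) fun a => J a p (![x, y] i.1)
  set W₁ := Submodule.span ℝ ({v, S v} : Set F) with hW₁
  set W₂ := Submodule.span ℝ (range f) with hW₂
  have hx : x ∈ W₂ := Submodule.subset_span ⟨(0, none), rfl⟩
  have hy : y ∈ W₂ := Submodule.subset_span ⟨(1, none), rfl⟩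
  have hJx (a : Fin n) : J a p x ∈ W₂ := Submodule.subset_span ⟨(0, some a), rfl⟩
  have hJy (a : Fin n) : J a p y ∈ W₂ := Submodule.subset_span ⟨(1, some a), rfl⟩
  have hJW (a : Fin n) : ∀ z ∈ W₂, J a p z ∈ W₂ := by
    intro z hz
    induction hz using Submodule.span_induction with
    | mem z hz =>
      obtain ⟨⟨i, o⟩, rfl⟩ := hz
      have hi (w : F) (hw : w ∈ W₂) (hw' : ∀ b, J b p w ∈ W₂) : ∀ b, J a p (J b p w) ∈ W₂ :=
        fun b => Submodule.span_le.2 (by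
          rintro _ (rfl | ⟨d, rfl⟩)
          exacts [hw, hw' d]) (h.mul_mem p hp a b w)
      fin_cases i
      · cases o
        exacts [hJx a, hi x hx hJx _]
      · cases o
        exacts [hJy a, hi y hy hJy _]
    | zero => simp
    | add z z' _ _ hz hz' => rw [map_add]; exact W₂.add_mem hz hz'
    | smul r z _ hz => rw [map_smul]; exact W₂.smul_mem r hz
  have hSW₁ : ∀ z ∈ W₁, S z ∈ W₁ := by
    intro z hz
    obtain ⟨r, r', rfl⟩ := Submodule.mem_span_pair.1 hz
    rw [map_add, map_smul, map_smul, hSS]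
    exact W₁.add_mem (W₁.smul_mem _ (Submodule.subset_span (by simp)))
      (W₁.smul_mem _ (W₁.smul_mem _ (Submodule.subset_span (by simp))))
  have hSW₂ : ∀ z ∈ W₂, S z ∈ W₂ := by
    intro z hz
    rw [hS, sum_apply]
    exact W₂.sum_mem fun a _ => W₂.smul_mem _ (hJW a z hz)
  refine ⟨W₁ ⊔ W₂, Submodule.mem_sup_left (Submodule.subset_span (by simp)), fun z hz => ?_, ?_⟩
  · have hSz : S z ∈ W₁ ⊔ W₂ := by
      obtain ⟨z₁, h₁, z₂, h₂, rfl⟩ := Submodule.mem_sup.1 hz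
      rw [map_add]
      exact Submodule.add_mem_sup (hSW₁ _ h₁) (hSW₂ _ h₂)
    have e : modelCurvature (G p) κ (fun a => J a p) x y z =
        κ • ((G p y z • x - G p x z • y
          + ∑ a, (G p (J a p y) z • J a p x - G p (J a p x) z • J a p y)) + (2 : ℝ) • S z) := by
      simp only [modelCurvature, hS, sum_apply, Finset.smul_sum, Finset.sum_add_distrib, smul_apply,
        smul_smul, add_assoc]
    rw [e]
    refine Submodule.smul_mem _ _ (Submodule.add_mem _ (Submodule.mem_sup_right ?_)
      (Submodule.smul_mem _ _ hSz))
    exact W₂.add_mem (W₂.sub_mem (W₂.smul_mem _ hx) (W₂.smul_mem _ hy))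
      (W₂.sum_mem fun a _ => W₂.sub_mem (W₂.smul_mem _ (hJx a)) (W₂.smul_mem _ (hJy a)))
  · refine (Submodule.finrank_add_le_finrank_add_finrank W₁ W₂).trans (add_le_add ?_ ?_)
    · split_ifs with hn
      · subst hn
        have hS0 : S v = 0 := by simp [hS]
        rw [hW₁, hS0, Set.pair_comm, Submodule.span_insert_zero]
        exact (finrank_span_le_card {v}).trans (by simp)
      · rw [hW₁]
        refine (finrank_span_le_card ({v, S v} : Set F)).trans ?_
        rw [Set.toFinset_insert, Set.toFinset_singleton]
        exact Finset.card_le_two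
    · refine (finrank_range_le_card f).trans ?_
      simp

lemma exists_submodule_iterCovDerivAlong_mem (h : IsModelSpace G O κ J) (hT : IsOpen T)
    (hu : ContDiffOn ℝ ∞ u T) (hmaps : MapsTo u T O) (hξ : ContDiffOn ℝ ∞ ξ T)
    (hgeo : ∀ s ∈ T, covDerivAlong G u (deriv u) s =
      -curvatureOp G (u s) (ξ s) (covDerivAlong G u ξ s) (deriv u s))
    (hξ' : ∀ s ∈ T, ∃ l : ℝ, covDerivAlong G u (covDerivAlong G u ξ) s = l • ξ s) (ht : t ∈ T) :
    ∃ W : Submodule ℝ F, (∀ m, iterCovDerivAlong G u m t ∈ W) ∧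
      Module.finrank ℝ W ≤ (if n = 0 then 1 else 2) + 2 * (n + 1) := by
  obtain ⟨W, hv, hW, hfin⟩ := h.exists_invariant_submodule (hmaps ht) (ξ t)
    (covDerivAlong G u ξ t) (deriv u t)
  refine ⟨W, fun m => ?_, hfin⟩
  induction m with
  | zero => exact hv
  | succ m ih =>
    rw [h.iterCovDerivAlong_succ hT hu hmaps hξ hgeo hξ' m t ht]
    exact W.neg_mem (hW _ ih)

end IsModelSpace

end Parallel

/-! ### Changes of coordinates -/

section CoordinateChange

variable {F : Type*} [NormedAddCommGroup F] [NormedSpace ℝ F]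
  {G G' : F → F →L[ℝ] F →L[ℝ] ℝ} {O O' : Set F} {φ : F → F} {u : F}

lemma covDerivAlong_congr {c c' V V' : ℝ → F} {t : ℝ} (hc : c =ᶠ[𝓝 t] c') (hV : V =ᶠ[𝓝 t] V') :
    covDerivAlong G c V t = covDerivAlong G c' V' t := by
  rw [covDerivAlong, covDerivAlong, hc.deriv_eq, hV.deriv_eq, hc.eq_of_nhds, hV.eq_of_nhds]

variable [FiniteDimensional ℝ F]

/-- The transformation law of the Christoffel symbols under a local isometry `φ`. -/
lemma IsMetricOn.fderiv_christoffel_eq (h : IsMetricOn G O) (h' : IsMetricOn G' O') (hu : u ∈ O)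
    (hφu : φ u ∈ O') (hφ : ContDiffAt ℝ ∞ φ u) (hsurj : Function.Surjective (fderiv ℝ φ u))
    (hiso : ∀ᶠ x in 𝓝 u, ∀ v w, G x v w = G' (φ x) (fderiv ℝ φ x v) (fderiv ℝ φ x w)) (v w : F) :
    fderiv ℝ φ u (christoffel G u v w) =
      fderiv ℝ (fderiv ℝ φ) u v w
        + christoffel G' (φ u) (fderiv ℝ φ u v) (fderiv ℝ φ u w) := by
  have hφd : DifferentiableAt ℝ φ u := hφ.differentiableAt (by simp)
  have hφd2 : DifferentiableAt ℝ (fderiv ℝ φ) u :=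
    (hφ.fderiv_right (m := ∞) (by simp)).differentiableAt (by simp)
  have hsymm (x y : F) : fderiv ℝ (fderiv ℝ φ) u x y = fderiv ℝ (fderiv ℝ φ) u y x :=
    (hφ.isSymmSndFDerivAt (by rw [minSmoothness_of_isRCLikeNormedField]
                              exact WithTop.coe_le_coe.2 (le_top : (2 : ℕ∞) ≤ ⊤))).eq x y
  have hD (x v w : F) : fderiv ℝ G u x v w =
      fderiv ℝ G' (φ u) (fderiv ℝ φ u x) (fderiv ℝ φ u v) (fderiv ℝ φ u w)
      + G' (φ u) (fderiv ℝ (fderiv ℝ φ) u x v) (fderiv ℝ φ u w)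
      + G' (φ u) (fderiv ℝ φ u v) (fderiv ℝ (fderiv ℝ φ) u x w) := by
    have hv (v : F) : HasDerivAt (fun s : ℝ => fderiv ℝ φ (u + s • x) v)
        (fderiv ℝ (fderiv ℝ φ) u x v) 0 := by
      simpa using (hasDerivAt_comp_line hφd2 x).clm_apply (hasDerivAt_const 0 v)
    have hG' : HasDerivAt (fun s : ℝ => G' (φ (u + s • x)))
        (fderiv ℝ G' (φ u) (fderiv ℝ φ u x)) 0 := by
      have e := hasDerivAt_comp_line ((h'.differentiableAt hφu).comp u hφd) x
      rwa [fderiv_comp u (h'.differentiableAt hφu) hφd] at e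
    have e := hasDerivAt_clm_apply_apply hG' (hv v) (hv w)
    simp only [zero_smul, add_zero] at e
    refine (hasDerivAt_apply_apply_line (h.differentiableAt hu) x v w).unique
      (e.congr_of_eventuallyEq ?_)
    have hcont : Tendsto (fun s : ℝ => u + s • x) (𝓝 0) (𝓝 u) := by
      simpa using (hasDerivAt_line u x).continuousAt.tendsto
    filter_upwards [hcont.eventually hiso] with s hs using hs v w
  refine h'.eq_of_forall hφu fun z' => ?_
  obtain ⟨z, rfl⟩ := hsurj z'
  have e := h.apply_christoffel hu v w z
  have e' := h'.apply_christoffel hφu (fderiv ℝ φ u v) (fderiv ℝ φ u w) (fderiv ℝ φ u z)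
  rw [hiso.self_of_nhds, christoffelFirst_apply, hD, hD, hD] at e
  rw [christoffelFirst_apply] at e'
  rw [e, map_add, add_apply, e', hsymm z v, hsymm z w, hsymm w v]
  have hs := h'.symm (φ u) hφu
  linarith [hs (fderiv ℝ φ u v) (fderiv ℝ (fderiv ℝ φ) u w z),
    hs (fderiv ℝ φ u w) (fderiv ℝ (fderiv ℝ φ) u v z)]

/-- The covariant derivative along a curve is invariant under local isometries. -/
lemma IsMetricOn.covDerivAlong_comp (h : IsMetricOn G O) (h' : IsMetricOn G' O') {c V : ℝ → F}
    {t : ℝ} (hu : c t ∈ O) (hφu : φ (c t) ∈ O') (hφ : ContDiffAt ℝ ∞ φ (c t))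
    (hsurj : Function.Surjective (fderiv ℝ φ (c t)))
    (hiso : ∀ᶠ x in 𝓝 (c t), ∀ v w, G x v w = G' (φ x) (fderiv ℝ φ x v) (fderiv ℝ φ x w))
    (hc : DifferentiableAt ℝ c t) (hV : DifferentiableAt ℝ V t) :
    covDerivAlong G' (fun s => φ (c s)) (fun s => fderiv ℝ φ (c s) (V s)) t =
      fderiv ℝ φ (c t) (covDerivAlong G c V t) := by
  have hφd : DifferentiableAt ℝ φ (c t) := hφ.differentiableAt (by simp)
  have hφd2 : DifferentiableAt ℝ (fderiv ℝ φ) (c t) :=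
    (hφ.fderiv_right (m := ∞) (by simp)).differentiableAt (by simp)
  have e1 : deriv (fun s => φ (c s)) t = fderiv ℝ φ (c t) (deriv c t) :=
    (hφd.hasFDerivAt.comp_hasDerivAt t hc.hasDerivAt).deriv
  have e2 : deriv (fun s => fderiv ℝ φ (c s) (V s)) t =
      fderiv ℝ (fderiv ℝ φ) (c t) (deriv c t) (V t) + fderiv ℝ φ (c t) (deriv V t) :=
    ((hφd2.hasFDerivAt.comp_hasDerivAt t hc.hasDerivAt).clm_apply hV.hasDerivAt).deriv
  rw [covDerivAlong, covDerivAlong, e1, e2, map_add,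
    h.fderiv_christoffel_eq h' hu hφu hφ hsurj hiso]
  abel

end CoordinateChange

/-! ### Tangent vectors and metric in charts -/

section Charts

variable {E : Type*} [NormedAddCommGroup E] [NormedSpace ℝ E]
  {M : Type*} [TopologicalSpace M] [ChartedSpace E M]

lemma ofCoord_eq_mfderivWithin (p : M) (u : E) :
    ofCoord p u = mfderivWithin 𝓘(ℝ, E) 𝓘(ℝ, E) (extChartAt 𝓘(ℝ, E) p).symm
      (range 𝓘(ℝ, E)) u := by
  rw [ModelWithCorners.range_eq_univ, mfderivWithin_univ]
  rfl

variable [IsManifold 𝓘(ℝ, E) ∞ M]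

lemma isManifold_one : IsManifold 𝓘(ℝ, E) 1 M :=
  IsManifold.of_le (n := ∞) (WithTop.coe_le_coe.2 le_top)

lemma toCoord_ofCoord {p : M} {u : E} (hu : u ∈ (extChartAt 𝓘(ℝ, E) p).target) (v : E) :
    toCoord p ((extChartAt 𝓘(ℝ, E) p).symm u) (ofCoord p u v) = v := by
  have := isManifold_one (E := E) (M := M)
  have e := mfderiv_extChartAt_comp_mfderivWithin_extChartAt_symm (I := 𝓘(ℝ, E)) hu
  rw [← ofCoord_eq_mfderivWithin] at e
  exact DFunLike.congr_fun e v

lemma ofCoord_toCoord {p : M} {u : E} (hu : u ∈ (extChartAt 𝓘(ℝ, E) p).target)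
    (V : TangentSpace 𝓘(ℝ, E) ((extChartAt 𝓘(ℝ, E) p).symm u)) :
    ofCoord p u (toCoord p ((extChartAt 𝓘(ℝ, E) p).symm u) V) = V := by
  have := isManifold_one (E := E) (M := M)
  have e := mfderivWithin_extChartAt_symm_comp_mfderiv_extChartAt (I := 𝓘(ℝ, E)) hu
  rw [← ofCoord_eq_mfderivWithin] at e
  exact DFunLike.congr_fun e V

lemma isInvertible_toCoord {p x : M} (hx : x ∈ (extChartAt 𝓘(ℝ, E) p).source) :
    (toCoord (E := E) p x).IsInvertible := by
  have := isManifold_one (E := E) (M := M)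
  exact isInvertible_mfderiv_extChartAt hx

lemma inner_eq_localMetric (g : RMetric E M) {p x : M} (hx : x ∈ (extChartAt 𝓘(ℝ, E) p).source)
    (V W : TangentSpace 𝓘(ℝ, E) x) :
    g.inner x V W = localMetric g p (extChartAt 𝓘(ℝ, E) p x) (toCoord p x V) (toCoord p x W) := by
  obtain ⟨u, hu, rfl⟩ : ∃ u ∈ (extChartAt 𝓘(ℝ, E) p).target, (extChartAt 𝓘(ℝ, E) p).symm u = x :=
    ⟨_, (extChartAt 𝓘(ℝ, E) p).map_source hx, (extChartAt 𝓘(ℝ, E) p).left_inv hx⟩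
  rw [(extChartAt 𝓘(ℝ, E) p).right_inv hu, localMetric_apply, ofCoord_toCoord hu,
    ofCoord_toCoord hu]

/-- A map into the tangent bundle is smooth if its projection and its coordinates in some chart
are. -/
lemma contMDiffAt_tangentBundle_iff {E' : Type*} [NormedAddCommGroup E'] [NormedSpace ℝ E']
    {f : E' → TangentBundle 𝓘(ℝ, E) M} {z : E'} {p : M}
    (hz : (f z).proj ∈ (extChartAt 𝓘(ℝ, E) p).source) :
    ContMDiffAt 𝓘(ℝ, E') 𝓘(ℝ, E).tangent ∞ f z ↔
      ContMDiffAt 𝓘(ℝ, E') 𝓘(ℝ, E) ∞ (fun y => (f y).proj) z ∧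
        ContDiffAt ℝ ∞ (fun y => toCoord p (f y).proj (f y).snd) z := by
  have := isManifold_one (E := E) (M := M)
  have : IsManifold 𝓘(ℝ, E) (∞ + 1) M := ‹IsManifold 𝓘(ℝ, E) ∞ M›
  have : ContMDiffVectorBundle ∞ E (TangentSpace 𝓘(ℝ, E) : M → Type _) 𝓘(ℝ, E) :=
    TangentBundle.contMDiffVectorBundle
  rw [extChartAt_source] at hz
  rw [(trivializationAt E (TangentSpace 𝓘(ℝ, E)) p).contMDiffAt_iff
    ((trivializationAt E (TangentSpace 𝓘(ℝ, E)) p).mem_source.2 hz), ← contMDiffAt_iff_contDiffAt]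
  refine and_congr_right fun hproj => Filter.EventuallyEq.contMDiffAt_iff ?_
  filter_upwards [hproj.continuousAt.preimage_mem_nhds
    ((chartAt E p).open_source.mem_nhds hz)] with y hy
  have e := TangentBundle.continuousLinearMapAt_trivializationAt (I := 𝓘(ℝ, E)) hy
  rw [toCoord, ← e, Bundle.Trivialization.continuousLinearMapAt_apply,
    Bundle.Trivialization.coe_linearMapAt_of_mem _ hy]

variable [FiniteDimensional ℝ E]

lemma contDiffOn_localMetric (g : RMetric E M) (p : M) :
    ContDiffOn ℝ ∞ (localMetric g p) (extChartAt 𝓘(ℝ, E) p).target := by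
  refine contDiffOn_clm_apply.2 fun v => contDiffOn_clm_apply.2 fun w u hu => ?_
  have hsymm : ContMDiffAt 𝓘(ℝ, E) 𝓘(ℝ, E) ∞ (extChartAt 𝓘(ℝ, E) p).symm u :=
    (contMDiffOn_extChartAt_symm p).contMDiffAt ((isOpen_extChartAt_target p).mem_nhds hu)
  have hs (v : E) : ContMDiffAt 𝓘(ℝ, E) 𝓘(ℝ, E).tangent ∞ (fun y : E =>
      (⟨(extChartAt 𝓘(ℝ, E) p).symm y, ofCoord p y v⟩ : TangentBundle 𝓘(ℝ, E) M)) u := by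
    refine (contMDiffAt_tangentBundle_iff (p := p)
      ((extChartAt 𝓘(ℝ, E) p).map_target hu)).2 ⟨hsymm, ?_⟩
    refine contDiffAt_const (c := v) |>.congr_of_eventuallyEq ?_
    filter_upwards [(isOpen_extChartAt_target p).mem_nhds hu] with y hy using toCoord_ofCoord hy v
  have key := ContMDiffAt.clm_bundle_apply₂ (F₁ := E) (F₂ := E)
    (E₃ := Bundle.Trivial M ℝ) ((g.contMDiff _).comp u hsymm) (hs v) (hs w)
  simp only [Bundle.contMDiffAt_totalSpace] at key
  exact key.2.contDiffAt.contDiffWithinAt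

/-- The coordinate representation of a Riemannian metric is a Riemannian metric. -/
lemma isMetricOn_localMetric (g : RMetric E M) (p : M) :
    IsMetricOn (localMetric g p) (extChartAt 𝓘(ℝ, E) p).target where
  isOpen := isOpen_extChartAt_target p
  contDiffOn := contDiffOn_localMetric g p
  symm _ _ _ _ := g.symm _ _ _
  pos _ hu v hv := g.pos _ _ fun h0 =>
    hv ((toCoord_ofCoord hu v).symm.trans ((congrArg _ h0).trans (map_zero _)))

end Charts

/-! ### Covariant derivatives along curves in a manifold -/

section Curves

variable {E : Type*} [NormedAddCommGroup E] [NormedSpace ℝ E]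
  {M : Type*} [TopologicalSpace M] [ChartedSpace E M]

lemma isOpen_inter_preimage_source {γ : ℝ → M} {I : Set ℝ} (hI : IsOpen I)
    (hγ : ContMDiffOn 𝓘(ℝ, ℝ) 𝓘(ℝ, E) ∞ γ I)
    (p : M) : IsOpen (I ∩ γ ⁻¹' (extChartAt 𝓘(ℝ, E) p).source) :=
  hγ.continuousOn.isOpen_inter_preimage hI (isOpen_extChartAt_source p)

variable [IsManifold 𝓘(ℝ, E) ∞ M]

lemma contDiffAt_transition {p q x : M} (hp : x ∈ (extChartAt 𝓘(ℝ, E) p).source)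
    (hq : x ∈ (extChartAt 𝓘(ℝ, E) q).source) :
    ContDiffAt ℝ ∞ (fun u => extChartAt 𝓘(ℝ, E) q ((extChartAt 𝓘(ℝ, E) p).symm u))
      (extChartAt 𝓘(ℝ, E) p x) := by
  have h1 : ContMDiffAt 𝓘(ℝ, E) 𝓘(ℝ, E) ∞ (extChartAt 𝓘(ℝ, E) p).symm (extChartAt 𝓘(ℝ, E) p x) :=
    (contMDiffOn_extChartAt_symm p).contMDiffAt
      ((isOpen_extChartAt_target p).mem_nhds ((extChartAt 𝓘(ℝ, E) p).map_source hp))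
  have h2 : ContMDiffAt 𝓘(ℝ, E) 𝓘(ℝ, E) ∞ (extChartAt 𝓘(ℝ, E) q)
      ((extChartAt 𝓘(ℝ, E) p).symm (extChartAt 𝓘(ℝ, E) p x)) := by
    rw [(extChartAt 𝓘(ℝ, E) p).left_inv hp]
    exact contMDiffAt_extChartAt' (by rwa [extChartAt_source] at hq)
  exact (h2.comp _ h1).contDiffAt

lemma toCoord_eq_fderiv_transition {p q x : M} (hp : x ∈ (extChartAt 𝓘(ℝ, E) p).source)
    (hq : x ∈ (extChartAt 𝓘(ℝ, E) q).source) (V : TangentSpace 𝓘(ℝ, E) x) :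
    toCoord q x V = fderiv ℝ (fun u => extChartAt 𝓘(ℝ, E) q ((extChartAt 𝓘(ℝ, E) p).symm u))
      (extChartAt 𝓘(ℝ, E) p x) (toCoord p x V) := by
  have := isManifold_one (E := E) (M := M)
  have hev : (extChartAt 𝓘(ℝ, E) q : M → E) =ᶠ[𝓝 x]
      (fun u => extChartAt 𝓘(ℝ, E) q ((extChartAt 𝓘(ℝ, E) p).symm u)) ∘ extChartAt 𝓘(ℝ, E) p := by
    filter_upwards [(isOpen_extChartAt_source p).mem_nhds hp] with y hy
    rw [Function.comp_apply, (extChartAt 𝓘(ℝ, E) p).left_inv hy]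
  have hφ := (contDiffAt_transition hp hq).differentiableAt (by simp)
  have hp' : MDifferentiableAt 𝓘(ℝ, E) 𝓘(ℝ, E) (extChartAt 𝓘(ℝ, E) p) x :=
    mdifferentiableAt_extChartAt (by rwa [extChartAt_source] at hp)
  rw [toCoord, hev.mfderiv_eq, mfderiv_comp x hφ.mdifferentiableAt hp', mfderiv_eq_fderiv]
  rfl

lemma toCoord_surjective {p x : M} (hp : x ∈ (extChartAt 𝓘(ℝ, E) p).source) :
    Function.Surjective (toCoord (E := E) p x) := by
  obtain ⟨e, he⟩ := isInvertible_toCoord hp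
  rw [← he]
  exact e.surjective

lemma toCoord_injective {p x : M} (hp : x ∈ (extChartAt 𝓘(ℝ, E) p).source) :
    Function.Injective (toCoord (E := E) p x) := by
  obtain ⟨e, he⟩ := isInvertible_toCoord hp
  rw [← he]
  exact e.injective

lemma surjective_fderiv_transition {p q x : M} (hp : x ∈ (extChartAt 𝓘(ℝ, E) p).source)
    (hq : x ∈ (extChartAt 𝓘(ℝ, E) q).source) : Function.Surjective
      (fderiv ℝ (fun u => extChartAt 𝓘(ℝ, E) q ((extChartAt 𝓘(ℝ, E) p).symm u))
        (extChartAt 𝓘(ℝ, E) p x)) := fun w => by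
  obtain ⟨V, rfl⟩ := toCoord_surjective hq w
  exact ⟨_, (toCoord_eq_fderiv_transition hp hq V).symm⟩

/-- Transition maps are isometries of the coordinate representations of a metric. -/
lemma localMetric_transition (g : RMetric E M) {p q : M} {u : E}
    (hu : u ∈ (extChartAt 𝓘(ℝ, E) p).target)
    (hq : (extChartAt 𝓘(ℝ, E) p).symm u ∈ (extChartAt 𝓘(ℝ, E) q).source) (v w : E) :
    localMetric g p u v w =
      localMetric g q (extChartAt 𝓘(ℝ, E) q ((extChartAt 𝓘(ℝ, E) p).symm u))
        (fderiv ℝ (fun u => extChartAt 𝓘(ℝ, E) q ((extChartAt 𝓘(ℝ, E) p).symm u)) u v)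
        (fderiv ℝ (fun u => extChartAt 𝓘(ℝ, E) q ((extChartAt 𝓘(ℝ, E) p).symm u)) u w) := by
  have hp := (extChartAt 𝓘(ℝ, E) p).map_target hu
  have e := inner_eq_localMetric g hq (ofCoord p u v) (ofCoord p u w)
  rw [toCoord_eq_fderiv_transition hp hq, toCoord_eq_fderiv_transition hp hq, toCoord_ofCoord hu,
    toCoord_ofCoord hu, (extChartAt 𝓘(ℝ, E) p).right_inv hu] at e
  exact e

lemma toCoord_velocity {γ : ℝ → M} {t : ℝ} {p : M} (hp : γ t ∈ (extChartAt 𝓘(ℝ, E) p).source)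
    (hγ : MDifferentiableAt 𝓘(ℝ, ℝ) 𝓘(ℝ, E) γ t) :
    toCoord p (γ t) (velocity γ t) = deriv (fun s => extChartAt 𝓘(ℝ, E) p (γ s)) t := by
  have := isManifold_one (E := E) (M := M)
  have hp' : MDifferentiableAt 𝓘(ℝ, E) 𝓘(ℝ, E) (extChartAt 𝓘(ℝ, E) p) (γ t) :=
    mdifferentiableAt_extChartAt (by rwa [extChartAt_source] at hp)
  have e := mfderiv_comp t hp' hγ
  rw [mfderiv_eq_fderiv] at e
  rw [← fderiv_apply_one_eq_deriv]
  exact (DFunLike.congr_fun e (1 : ℝ)).symm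

lemma contDiffOn_coord {γ : ℝ → M} {I : Set ℝ}
    (hγ : ContMDiffOn 𝓘(ℝ, ℝ) 𝓘(ℝ, E) ∞ γ I) (p : M) :
    ContDiffOn ℝ ∞ (fun s => extChartAt 𝓘(ℝ, E) p (γ s))
      (I ∩ γ ⁻¹' (extChartAt 𝓘(ℝ, E) p).source) := by
  rw [← contMDiffOn_iff_contDiffOn, extChartAt_source]
  exact (contMDiffOn_extChartAt (x := p)).comp (hγ.mono inter_subset_left) fun s hs => hs.2

variable [FiniteDimensional ℝ E]

/-- The covariant derivative along a curve may be computed in any chart. -/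
lemma toCoord_covDeriv (g : RMetric E M) {γ : ℝ → M} {V : ∀ t, TangentSpace 𝓘(ℝ, E) (γ t)}
    {t : ℝ} {p : M} (hp : γ t ∈ (extChartAt 𝓘(ℝ, E) p).source) (hγ : ContinuousAt γ t)
    (hc : DifferentiableAt ℝ (fun s => extChartAt 𝓘(ℝ, E) p (γ s)) t)
    (hV : DifferentiableAt ℝ (fun s => toCoord p (γ s) (V s)) t) :
    toCoord p (γ t) (covDeriv g γ V t) =
      covDerivAlong (localMetric g p) (fun s => extChartAt 𝓘(ℝ, E) p (γ s))
        (fun s => toCoord p (γ s) (V s)) t := by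
  set q := γ t with hqdef
  have hq : γ t ∈ (extChartAt 𝓘(ℝ, E) q).source := mem_extChartAt_source _
  have hsrc : ∀ᶠ s in 𝓝 t, γ s ∈ (extChartAt 𝓘(ℝ, E) p).source ∧
      γ s ∈ (extChartAt 𝓘(ℝ, E) q).source :=
    (hγ.eventually_mem ((isOpen_extChartAt_source p).mem_nhds hp)).and
      (hγ.eventually_mem ((isOpen_extChartAt_source q).mem_nhds hq))
  set φ : E → E := fun u => extChartAt 𝓘(ℝ, E) q ((extChartAt 𝓘(ℝ, E) p).symm u)
  obtain ⟨Z, hZ⟩ := toCoord_surjective hp (covDerivAlong (localMetric g p)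
    (fun s => extChartAt 𝓘(ℝ, E) p (γ s)) (fun s => toCoord p (γ s) (V s)) t)
  have hiso : ∀ᶠ u in 𝓝 (extChartAt 𝓘(ℝ, E) p (γ t)), ∀ v w, localMetric g p u v w =
      localMetric g q (φ u) (fderiv ℝ φ u v) (fderiv ℝ φ u w) := by
    have hcont : ContinuousAt (extChartAt 𝓘(ℝ, E) p).symm (extChartAt 𝓘(ℝ, E) p (γ t)) :=
      continuousAt_extChartAt_symm' hp
    filter_upwards [(isOpen_extChartAt_target p).mem_nhds ((extChartAt 𝓘(ℝ, E) p).map_source hp),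
      hcont.eventually_mem ((isOpen_extChartAt_source q).mem_nhds
        (by rwa [(extChartAt 𝓘(ℝ, E) p).left_inv hp]))] with u hu hu'
    exact localMetric_transition g hu hu'
  have e := (isMetricOn_localMetric g p).covDerivAlong_comp (isMetricOn_localMetric g q)
    (φ := φ) (c := fun s => extChartAt 𝓘(ℝ, E) p (γ s)) ((extChartAt 𝓘(ℝ, E) p).map_source hp)
    (by
      simp only [φ]
      rw [(extChartAt 𝓘(ℝ, E) p).left_inv hp]
      exact (extChartAt 𝓘(ℝ, E) q).map_source hq)
    (contDiffAt_transition hp hq) (surjective_fderiv_transition hp hq) hiso hc hV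
  rw [← hZ, ← toCoord_eq_fderiv_transition hp hq] at e
  have e2 : covDerivAlong (localMetric g q) (fun s => extChartAt 𝓘(ℝ, E) q (γ s))
      (fun s => toCoord q (γ s) (V s)) t = toCoord q (γ t) Z := by
    rw [← e]
    refine covDerivAlong_congr ?_ ?_
    · filter_upwards [hsrc] with s hs
      simp only [φ]
      rw [(extChartAt 𝓘(ℝ, E) p).left_inv hs.1]
    · filter_upwards [hsrc] with s hs using toCoord_eq_fderiv_transition hs.1 hs.2 _
  rw [← hZ]
  congr 1
  obtain ⟨L, hL⟩ := isInvertible_toCoord (E := E) hq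
  rw [covDeriv]
  change (toCoord q (γ t)).inverse (covDerivAlong (localMetric g q)
    (fun s => extChartAt 𝓘(ℝ, E) q (γ s)) (fun s => toCoord q (γ s) (V s)) t) = Z
  rw [e2, ← hL, ContinuousLinearMap.inverse_equiv]
  exact L.symm_apply_apply Z

/-- The iterated covariant derivatives `γ', ∇_t γ', ∇_t ∇_t γ', …` of the velocity of `γ`. -/
def iterCovDeriv (g : RMetric E M) (γ : ℝ → M) : ℕ → ∀ t, TangentSpace 𝓘(ℝ, E) (γ t)
  | 0 => velocity γ
  | m + 1 => covDeriv g γ (iterCovDeriv g γ m)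

variable {γ : ℝ → M} {I : Set ℝ}

lemma toCoord_iterCovDeriv (g : RMetric E M) (hI : IsOpen I)
    (hγ : ContMDiffOn 𝓘(ℝ, ℝ) 𝓘(ℝ, E) ∞ γ I) (p : M) (m : ℕ) :
    ∀ t ∈ I ∩ γ ⁻¹' (extChartAt 𝓘(ℝ, E) p).source, toCoord p (γ t) (iterCovDeriv g γ m t) =
      iterCovDerivAlong (localMetric g p) (fun s => extChartAt 𝓘(ℝ, E) p (γ s)) m t := by
  have hT := isOpen_inter_preimage_source hI hγ p
  have hc := contDiffOn_coord hγ p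
  induction m with
  | zero =>
    intro t ht
    exact toCoord_velocity ht.2
      ((hγ.contMDiffAt (hI.mem_nhds ht.1)).mdifferentiableAt (by simp))
  | succ m ih =>
    intro t ht
    have hV := (isMetricOn_localMetric g p).contDiffOn_iterCovDerivAlong hT hc
      (fun s hs => (extChartAt 𝓘(ℝ, E) p).map_source hs.2) m
    have hev : (fun s => toCoord p (γ s) (iterCovDeriv g γ m s)) =ᶠ[𝓝 t]
        iterCovDerivAlong (localMetric g p) (fun s => extChartAt 𝓘(ℝ, E) p (γ s)) m := by
      filter_upwards [hT.mem_nhds ht] with s hs using ih s hs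
    have hVd := ((hV.contDiffAt (hT.mem_nhds ht)).differentiableAt (by simp)).congr_of_eventuallyEq
      hev
    refine (toCoord_covDeriv g ht.2 (hγ.continuousOn.continuousAt (hI.mem_nhds ht.1))
      ((hc.contDiffAt (hT.mem_nhds ht)).differentiableAt (by simp)) hVd).trans ?_
    exact covDerivAlong_congr EventuallyEq.rfl hev

lemma contDiffAt_toCoord_iterCovDeriv (g : RMetric E M) (hI : IsOpen I)
    (hγ : ContMDiffOn 𝓘(ℝ, ℝ) 𝓘(ℝ, E) ∞ γ I) {p : M} {t : ℝ}
    (ht : t ∈ I ∩ γ ⁻¹' (extChartAt 𝓘(ℝ, E) p).source) (m : ℕ) :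
    ContDiffAt ℝ ∞ (fun s => toCoord p (γ s) (iterCovDeriv g γ m s)) t := by
  have hT := isOpen_inter_preimage_source hI hγ p
  have hV := (isMetricOn_localMetric g p).contDiffOn_iterCovDerivAlong hT (contDiffOn_coord hγ p)
    (fun s hs => (extChartAt 𝓘(ℝ, E) p).map_source hs.2) m
  refine (hV.contDiffAt (hT.mem_nhds ht)).congr_of_eventuallyEq ?_
  filter_upwards [hT.mem_nhds ht] with s hs using toCoord_iterCovDeriv g hI hγ p m s hs

end Curves

/-! ### Parallel endomorphisms and curvature -/

section Endomorphisms

variable {F : Type*} [NormedAddCommGroup F] [NormedSpace ℝ F]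
  {G : F → F →L[ℝ] F →L[ℝ] ℝ} {O : Set F} {u : F}

lemma covDerivEnd_congr {A B : F → F →L[ℝ] F} (h : A =ᶠ[𝓝 u] B) (v : F) :
    covDerivEnd G A u v = covDerivEnd G B u v := by
  rw [covDerivEnd, covDerivEnd, h.fderiv_eq, h.eq_of_nhds]

lemma covDerivEnd_comp {A B : F → F →L[ℝ] F} (hA : DifferentiableAt ℝ A u)
    (hB : DifferentiableAt ℝ B u) (v : F) :
    covDerivEnd G (fun x => (A x).comp (B x)) u v =
      (covDerivEnd G A u v).comp (B u) + (A u).comp (covDerivEnd G B u v) := by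
  have e := (hA.hasFDerivAt.clm_comp hB.hasFDerivAt).fderiv
  ext z
  simp only [covDerivEnd, e]
  simp
  abel

lemma covDerivEnd_add {A B : F → F →L[ℝ] F} (hA : DifferentiableAt ℝ A u)
    (hB : DifferentiableAt ℝ B u) (v : F) :
    covDerivEnd G (fun x => A x + B x) u v = covDerivEnd G A u v + covDerivEnd G B u v := by
  have e := (hA.hasFDerivAt.fun_add hB.hasFDerivAt).fderiv
  ext z
  simp only [covDerivEnd, e]
  simp
  abel

lemma covDerivEnd_const_smul_id (r : ℝ) (v : F) :
    covDerivEnd G (fun _ => r • ContinuousLinearMap.id ℝ F) u v = 0 := by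
  ext z
  simp [covDerivEnd]

lemma covDerivEnd_sum_smul {ι : Type*} [Fintype ι] {f : ι → F → ℝ} {A : ι → F → F →L[ℝ] F}
    (hf : ∀ b, DifferentiableAt ℝ (f b) u) (hA : ∀ b, DifferentiableAt ℝ (A b) u) (v : F) :
    covDerivEnd G (fun x => ∑ b, f b x • A b x) u v =
      ∑ b, (fderiv ℝ (f b) u v • A b u + f b u • covDerivEnd G (A b) u v) := by
  have e := (HasFDerivAt.fun_sum (u := Finset.univ)
    fun b _ => (hf b).hasFDerivAt.fun_smul (hA b).hasFDerivAt).fderiv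
  ext z
  simp only [covDerivEnd, e, sum_apply, add_apply, sub_apply, smul_apply,
    ContinuousLinearMap.comp_apply,
    ContinuousLinearMap.smulRight_apply, map_sum, map_smul, smul_add, smul_sub,
    ← Finset.sum_add_distrib, ← Finset.sum_sub_distrib]
  exact Finset.sum_congr rfl fun b _ => by abel

/-- The connection matrix of a local basis of a quaternionic Kähler structure is skew-symmetric. -/
lemma exists_skew_connection (hG : IsMetricOn G O) {J : Fin 3 → F → F →L[ℝ] F}
    (hcliff : ∀ u ∈ O, ∀ a b x,
      J a u (J b u x) + J b u (J a u x) = if a = b then (-2 : ℝ) • x else 0)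
    (hdiff : ∀ a, ∀ u ∈ O, DifferentiableAt ℝ (J a) u) (hu : u ∈ O) (v : F)
    (hpar : ∀ a, covDerivEnd G (J a) u v ∈ Submodule.span ℝ (range fun b => J b u)) :
    ∃ θ : Fin 3 → Fin 3 → ℝ, (∀ a b, θ a b = -θ b a) ∧
      ∀ a, covDerivEnd G (J a) u v = ∑ b, θ a b • J b u := by
  rcases subsingleton_or_nontrivial F with hE | hE
  · exact ⟨0, by simp, fun a => by ext x; exact Subsingleton.elim _ _⟩
  obtain ⟨x, hx⟩ := exists_ne (0 : F)
  choose θ hθ using fun a => (Submodule.mem_span_range_iff_exists_fun ℝ).1 (hpar a)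
  refine ⟨θ, fun a b => ?_, fun a => (hθ a).symm⟩
  -- the covariant derivative of the anticommutator of `J a` and `J b`, which is constant
  have hev : (fun z => (J a z).comp (J b z) + (J b z).comp (J a z)) =ᶠ[𝓝 u]
      fun _ => (if a = b then (-2 : ℝ) else 0) • ContinuousLinearMap.id ℝ F := by
    filter_upwards [hG.isOpen.mem_nhds hu] with z hz
    ext y
    have e := hcliff z hz a b y
    split_ifs at e ⊢ with hab
    · simpa using e
    · simpa using e
  have ha := hdiff a u hu
  have hb := hdiff b u hu
  have e := covDerivEnd_congr (G := G) hev v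
  rw [covDerivEnd_const_smul_id, covDerivEnd_add (ha.clm_comp hb) (hb.clm_comp ha),
    covDerivEnd_comp ha hb, covDerivEnd_comp hb ha, ← hθ a, ← hθ b] at e
  have e' := DFunLike.congr_fun e x
  simp only [add_apply, ContinuousLinearMap.comp_apply, sum_apply, smul_apply, zero_apply, map_sum,
    map_smul] at e'
  have hsum (c d : Fin 3) : ∑ i, θ c i • J i u (J d u x) + ∑ i, θ c i • J d u (J i u x) =
      (-2 * θ c d) • x := by
    simp only [← Finset.sum_add_distrib, ← smul_add, hcliff u hu, smul_ite, smul_zero,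
      Finset.sum_ite_eq', Finset.mem_univ, if_true, smul_smul]
    rw [mul_comm]
  have e2 : (-2 * θ a b + -2 * θ b a) • x = 0 := by
    rw [add_smul, ← hsum a b, ← hsum b a, ← e']
    abel
  have := (smul_eq_zero.1 e2).resolve_right hx
  linarith

variable [FiniteDimensional ℝ F]

lemma IsMetricOn.contDiffAt_covDerivEnd (h : IsMetricOn G O) (hu : u ∈ O) {A : F → F →L[ℝ] F}
    (hA : ContDiffAt ℝ ∞ A u) (v : F) : ContDiffAt ℝ ∞ (fun x => covDerivEnd G A x v) u := by
  have hΓ : ContDiffAt ℝ ∞ (fun x => christoffel G x v) u :=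
    (h.contDiffOn_christoffel.contDiffAt (h.isOpen.mem_nhds hu)).clm_apply contDiffAt_const
  exact (((hA.fderiv_right (m := ∞) (by simp)).clm_apply contDiffAt_const).add
    (hΓ.clm_comp hA)).sub (hA.clm_comp hΓ)

/-- Ricci identity: the commutator of the curvature operator with a field of endomorphisms is the
alternation of its second covariant derivative. -/
lemma IsMetricOn.curvatureOp_apply_sub (h : IsMetricOn G O) (hu : u ∈ O) {A : F → F →L[ℝ] F}
    (hA : ContDiffAt ℝ ∞ A u) (X Y Z : F) :
    curvatureOp G u X Y (A u Z) - A u (curvatureOp G u X Y Z) =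
      covDerivEnd G (fun x => covDerivEnd G A x Y) u X Z
        - covDerivEnd G (fun x => covDerivEnd G A x X) u Y Z := by
  have hAd : DifferentiableAt ℝ A u := hA.differentiableAt (by simp)
  have hAd2 : DifferentiableAt ℝ (fderiv ℝ A) u :=
    (hA.fderiv_right (m := ∞) (by simp)).differentiableAt (by simp)
  have hsymm : fderiv ℝ (fderiv ℝ A) u X Y = fderiv ℝ (fderiv ℝ A) u Y X :=
    (hA.isSymmSndFDerivAt (by rw [minSmoothness_of_isRCLikeNormedField]
                              exact WithTop.coe_le_coe.2 (le_top : (2 : ℕ∞) ≤ ⊤))).eq X Y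
  have key (X Y : F) : fderiv ℝ (fun x => covDerivEnd G A x Y) u X Z =
      fderiv ℝ (fderiv ℝ A) u X Y Z
      + (fderiv ℝ (christoffel G) u X Y (A u Z) + christoffel G u Y (fderiv ℝ A u X Z))
      - (fderiv ℝ A u X (christoffel G u Y Z) + A u (fderiv ℝ (christoffel G) u X Y Z)) := by
    have hAl := hasDerivAt_comp_line hAd X
    have hAZ : HasDerivAt (fun s : ℝ => A (u + s • X) Z) (fderiv ℝ A u X Z) 0 := by
      simpa using hAl.clm_apply (hasDerivAt_const 0 Z)
    have e1 : HasDerivAt (fun s : ℝ => fderiv ℝ A (u + s • X) Y Z)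
        (fderiv ℝ (fderiv ℝ A) u X Y Z) 0 := by
      simpa using ((hasDerivAt_comp_line hAd2 X).clm_apply (hasDerivAt_const 0 Y)).clm_apply
        (hasDerivAt_const 0 Z)
    have e2 : HasDerivAt (fun s : ℝ => christoffel G (u + s • X) Y (A (u + s • X) Z))
        (fderiv ℝ (christoffel G) u X Y (A u Z) + christoffel G u Y (fderiv ℝ A u X Z)) 0 := by
      simpa using ((hasDerivAt_comp_line (h.differentiableAt_christoffel hu) X).clm_apply
        (hasDerivAt_const 0 Y)).clm_apply hAZ
    have e3 : HasDerivAt (fun s : ℝ => A (u + s • X) (christoffel G (u + s • X) Y Z))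
        (fderiv ℝ A u X (christoffel G u Y Z) + A u (fderiv ℝ (christoffel G) u X Y Z)) 0 := by
      simpa using hAl.clm_apply (h.hasDerivAt_christoffel_line hu X Y Z)
    have e4 : HasDerivAt (fun s : ℝ => covDerivEnd G A (u + s • X) Y Z)
        (fderiv ℝ (fun x => covDerivEnd G A x Y) u X Z) 0 := by
      simpa using (hasDerivAt_comp_line ((h.contDiffAt_covDerivEnd hu hA Y).differentiableAt
        (by simp)) X).clm_apply (hasDerivAt_const 0 Z)
    exact e4.unique ((e1.add e2).sub e3)
  have unfold_cov (B : F → F →L[ℝ] F) (v : F) : covDerivEnd G B u v Z =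
      fderiv ℝ B u v Z + christoffel G u v (B u Z) - B u (christoffel G u v Z) := rfl
  rw [unfold_cov (fun x => covDerivEnd G A x Y) X, unfold_cov (fun x => covDerivEnd G A x X) Y, key,
    key, hsymm]
  simp only [curvatureOp, covDerivEnd, add_apply, sub_apply, ContinuousLinearMap.comp_apply,
    map_add, map_sub]
  abel

end Endomorphisms

/-! ### Space forms in charts -/

section SpaceFormCharts

variable {E : Type*} [NormedAddCommGroup E] [NormedSpace ℝ E]
  {M : Type*} [TopologicalSpace M] [ChartedSpace E M] [IsManifold 𝓘(ℝ, E) ∞ M]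

lemma IsMetricOn.mono {G : E → E →L[ℝ] E →L[ℝ] ℝ} {O O' : Set E} (h : IsMetricOn G O)
    (hO' : IsOpen O') (hsub : O' ⊆ O) : IsMetricOn G O' where
  isOpen := hO'
  contDiffOn := h.contDiffOn.mono hsub
  symm u hu := h.symm u (hsub hu)
  pos u hu := h.pos u (hsub hu)

lemma localEnd_localEnd (J J' : EndField E M) {p : M} {u : E}
    (hu : u ∈ (extChartAt 𝓘(ℝ, E) p).target) (v : E) :
    localEnd J p u (localEnd J' p u v) =
      toCoord p _ (J _ (J' ((extChartAt 𝓘(ℝ, E) p).symm u) (ofCoord p u v))) := by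
  simp only [localEnd, ContinuousLinearMap.comp_apply]
  rw [ofCoord_toCoord hu]

lemma localMetric_localEnd (g : RMetric E M) (J : EndField E M) {p : M} {u : E}
    (hu : u ∈ (extChartAt 𝓘(ℝ, E) p).target) (v w : E) :
    localMetric g p u v (localEnd J p u w) =
      g.inner _ (ofCoord p u v) (J ((extChartAt 𝓘(ℝ, E) p).symm u) (ofCoord p u w)) := by
  simp only [localEnd, ContinuousLinearMap.comp_apply, localMetric_apply]
  rw [ofCoord_toCoord hu]

lemma localEnd_sq (J : EndField E M) {p : M} {u : E} (hu : u ∈ (extChartAt 𝓘(ℝ, E) p).target)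
    (hJ : ∀ v, J ((extChartAt 𝓘(ℝ, E) p).symm u) (J _ v) = -v) (v : E) :
    localEnd J p u (localEnd J p u v) = -v := by
  rw [localEnd_localEnd J J hu, hJ]
  exact (map_neg _ _).trans (congrArg _ (toCoord_ofCoord hu v))

/-- Every chart carries near its centre a family of `n` endomorphism fields as in
`IsModelSpace`. -/
def IsLocallyModelSpace (g : RMetric E M) (n : ℕ) : Prop :=
  ∀ p : M, ∃ (O : Set E) (κ : ℝ) (J : Fin n → E → E →L[ℝ] E), extChartAt 𝓘(ℝ, E) p p ∈ O ∧
    O ⊆ (extChartAt 𝓘(ℝ, E) p).target ∧ IsModelSpace (localMetric g p) O κ J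

variable [FiniteDimensional ℝ E]

lemma IsRealSpaceForm.isLocallyModelSpace {g : RMetric E M} {c : ℝ} (h : IsRealSpaceForm g c) :
    IsLocallyModelSpace g 0 := by
  intro p
  have hG := isMetricOn_localMetric g p
  refine ⟨(extChartAt 𝓘(ℝ, E) p).target, c, fun a => a.elim0, mem_extChartAt_target p,
    Subset.rfl, hG, fun a => a.elim0, fun _ _ a => a.elim0, fun _ _ a => a.elim0,
    fun _ _ a => a.elim0, fun _ _ _ => ⟨fun a => a.elim0, fun a => a.elim0, fun a => a.elim0⟩,
    fun u hu => ?_⟩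
  exact eq_modelCurvature_of_real (hG.symm u hu) (hG.pos u hu) (hG.isCurvatureLike hu) _ (h p u hu)

lemma IsComplexSpaceForm.isLocallyModelSpace {g : RMetric E M} {J : EndField E M} {c : ℝ}
    (h : IsComplexSpaceForm g J c) : IsLocallyModelSpace g 1 := by
  intro p
  have hG := isMetricOn_localMetric g p
  have hsq (u) (hu : u ∈ (extChartAt 𝓘(ℝ, E) p).target) (v : E) :
      localEnd J p u (localEnd J p u v) = -v := localEnd_sq J hu (h.kahler.sq _) v
  have hskew (u) (hu : u ∈ (extChartAt 𝓘(ℝ, E) p).target) (v w : E) :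
      localMetric g p u v (localEnd J p u w) = -localMetric g p u (localEnd J p u v) w := by
    rw [hG.symm u hu _ w, localMetric_localEnd g J hu, localMetric_localEnd g J hu,
      ← h.kahler.orthogonal, h.kahler.sq, map_neg, g.symm]
  have hsmooth (u) (hu : u ∈ (extChartAt 𝓘(ℝ, E) p).target) : ContDiffAt ℝ ∞ (localEnd J p) u :=
    (h.kahler.smooth p).contDiffAt (hG.isOpen.mem_nhds hu)
  have hcomm (u) (hu : u ∈ (extChartAt 𝓘(ℝ, E) p).target) (X Y Z : E) :
      curvatureOp (localMetric g p) u X Y (localEnd J p u Z) =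
        localEnd J p u (curvatureOp (localMetric g p) u X Y Z) := by
    refine sub_eq_zero.1 ((hG.curvatureOp_apply_sub hu (hsmooth u hu) X Y Z).trans ?_)
    have hev (v : E) : (fun x => covDerivEnd (localMetric g p) (localEnd J p) x v) =ᶠ[𝓝 u]
        fun _ => (0 : ℝ) • ContinuousLinearMap.id ℝ E := by
      filter_upwards [hG.isOpen.mem_nhds hu] with x hx
      rw [h.kahler.parallel p x hx, zero_smul]
    rw [covDerivEnd_congr (hev Y), covDerivEnd_congr (hev X), covDerivEnd_const_smul_id,
      covDerivEnd_const_smul_id, sub_self]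
  refine ⟨(extChartAt 𝓘(ℝ, E) p).target, c / 4, fun _ => localEnd J p, mem_extChartAt_target p,
    Subset.rfl, hG, fun _ u hu => (hsmooth u hu).differentiableAt (by simp),
    fun u hu _ => hskew u hu, fun u hu a b x => ?_, fun u hu _ _ x => ?_,
    fun u hu v => ⟨0, by simp, fun _ => ?_⟩, fun u hu => ?_⟩
  · rw [if_pos (Subsingleton.elim a b), hsq u hu]
    module
  · rw [hsq u hu]
    exact Submodule.neg_mem _ (Submodule.subset_span (mem_insert x _))
  · rw [h.kahler.parallel p u hu]
    simp
  · exact eq_modelCurvature_of_complex (hG.symm u hu) (hG.pos u hu) (hG.isCurvatureLike hu)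
      (hsq u hu) (hskew u hu) (hcomm u hu) (h.curvature p u hu)

/-- The commutators `[R (X, Y), Jₐ]` lie in the bundle spanned by the `Jₐ` if it is parallel. -/
lemma curvatureOp_commutator_mem {G : E → E →L[ℝ] E →L[ℝ] ℝ} {O : Set E}
    (hG : IsMetricOn G O) {J : Fin 3 → E → E →L[ℝ] E}
    (hJ : ∀ u ∈ O, IsQuaternionTriple (G u) fun a => J a u)
    (hsmooth : ∀ a, ∀ u ∈ O, ContDiffAt ℝ ∞ (J a) u)
    (hpar : ∀ a, ∀ u ∈ O, ∀ v,
      covDerivEnd G (J a) u v ∈ Submodule.span ℝ (range fun b => J b u))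
    {u : E} (hu : u ∈ O) (a : Fin 3) (X Y : E) :
    ∃ β : Fin 3 → ℝ, ∀ Z, curvatureOp G u X Y (J a u Z) - J a u (curvatureOp G u X Y Z) =
      ∑ b, β b • J b u Z := by
  rcases subsingleton_or_nontrivial E with hE | hE
  · exact ⟨0, fun Z => Subsingleton.elim _ _⟩
  obtain ⟨x, hx⟩ := exists_ne (0 : E)
  have hmem (X Y : E) : covDerivEnd G (fun z => covDerivEnd G (J a) z Y) u X ∈
      Submodule.span ℝ (range fun b => J b u) := by
    have hP : ContDiffAt ℝ ∞ (fun z => covDerivEnd G (J a) z Y) u :=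
      hG.contDiffAt_covDerivEnd hu (hsmooth a u hu) Y
    have hGd := hG.contDiffAt hu
    have hf (b : Fin 3) : DifferentiableAt ℝ
        (fun z => G z (covDerivEnd G (J a) z Y x) (J b z x) / G z x x) u :=
      ContDiffAt.differentiableAt (n := ∞)
        (((hGd.clm_apply (hP.clm_apply contDiffAt_const)).clm_apply
          ((hsmooth b u hu).clm_apply contDiffAt_const)).div
          ((hGd.clm_apply contDiffAt_const).clm_apply contDiffAt_const) (hG.pos u hu x hx).ne')
        (by simp)
    have hev : (fun z => covDerivEnd G (J a) z Y) =ᶠ[𝓝 u] fun z =>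
        ∑ b, (G z (covDerivEnd G (J a) z Y x) (J b z x) / G z x x) • J b z := by
      filter_upwards [hG.isOpen.mem_nhds hu] with z hz
      exact (hJ z hz).coeff_eq (hG.symm z hz) (hG.pos z hz x hx).ne' (hpar a z hz Y)
    rw [covDerivEnd_congr hev,
      covDerivEnd_sum_smul hf fun b => (hsmooth b u hu).differentiableAt (by simp)]
    exact Submodule.sum_mem _ fun b _ => Submodule.add_mem _
      (Submodule.smul_mem _ _ (Submodule.subset_span ⟨b, rfl⟩))
      (Submodule.smul_mem _ _ (hpar b u hu X))
  obtain ⟨β, hβ⟩ := (Submodule.mem_span_range_iff_exists_fun ℝ).1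
    (Submodule.sub_mem _ (hmem X Y) (hmem Y X))
  refine ⟨β, fun Z => ?_⟩
  rw [hG.curvatureOp_apply_sub hu (hsmooth a u hu), ← sub_apply, ← hβ]
  simp

lemma IsQuaternionicSpaceForm.isLocallyModelSpace {g : RMetric E M} {Q : EndSubspaceField E M}
    {c : ℝ} (h : IsQuaternionicSpaceForm g Q c) : IsLocallyModelSpace g 3 := by
  intro p
  obtain ⟨U, hU, hpU, J, hJ⟩ := h.kahler p
  set O := (extChartAt 𝓘(ℝ, E) p).target ∩ (extChartAt 𝓘(ℝ, E) p).symm ⁻¹' U with hO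
  have hOo : IsOpen O :=
    (continuousOn_extChartAt_symm p).isOpen_inter_preimage (isOpen_extChartAt_target p) hU
  have hG := (isMetricOn_localMetric g p).mono hOo inter_subset_left
  have hmul {a b d : Fin 3} {u : E} (hu : u ∈ O)
      (hab : ∀ v, J a ((extChartAt 𝓘(ℝ, E) p).symm u) (J b _ v) = J d _ v) (v : E) :
      localEnd (J a) p u (localEnd (J b) p u v) = localEnd (J d) p u v := by
    rw [localEnd_localEnd _ _ hu.1, hab]
    rfl
  have hT (u) (hu : u ∈ O) : IsQuaternionTriple (localMetric g p u) fun a => localEnd (J a) p u :=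
    { sq := fun a v => localEnd_sq (J a) hu.1 (hJ.sq a _ hu.2) v
      mul01 := hmul hu (hJ.mul01 _ hu.2)
      mul12 := hmul hu (hJ.mul12 _ hu.2)
      mul20 := hmul hu (hJ.mul20 _ hu.2)
      skew := fun a v w => by
        rw [hG.symm u hu _ w, localMetric_localEnd g _ hu.1, localMetric_localEnd g _ hu.1,
          hJ.skew a _ hu.2, g.symm] }
  have hsmooth (a : Fin 3) (u) (hu : u ∈ O) : ContDiffAt ℝ ∞ (localEnd (J a) p) u :=
    (hJ.smooth a p).contDiffAt (hOo.mem_nhds hu)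
  have hdiff (a : Fin 3) (u) (hu : u ∈ O) : DifferentiableAt ℝ (localEnd (J a) p) u :=
    (hsmooth a u hu).differentiableAt (by simp)
  have hpar (a : Fin 3) (u) (hu : u ∈ O) := hJ.parallel a p u hu.1 hu.2
  have hcliff (u) (hu : u ∈ O) := (hT u hu).clifford
  refine ⟨O, c / 4, fun a => localEnd (J a) p, ⟨mem_extChartAt_target p, ?_⟩, inter_subset_left,
    hG, hdiff, fun u hu => (hT u hu).skew, hcliff, fun u hu => (hT u hu).mul_mem,
    fun u hu v => exists_skew_connection hG hcliff hdiff hu v fun a => hpar a u hu v,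
    fun u hu => ?_⟩
  · rwa [mem_preimage, extChartAt_to_inv]
  · refine (hT u hu).eq_modelCurvature (hG.symm u hu) (hG.pos u hu) (hG.isCurvatureLike hu)
      (curvatureOp_commutator_mem hG hT hsmooth hpar hu 0) fun X Y hY Z hZ => ?_
    have hle : Submodule.span ℝ {X, localEnd (J 0) p u X, localEnd (J 1) p u X,
        localEnd (J 2) p u X} ≤ quaternionicSection Q p u X := by
      refine Submodule.span_mono ?_
      have hmem (a : Fin 3) : localEnd (J a) p u X ∈ insert X
          {Y : E | ∃ A ∈ Q ((extChartAt 𝓘(ℝ, E) p).symm u), Y = toCoord p _ (A (ofCoord p u X))} :=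
        mem_insert_of_mem _ ⟨J a _, by
          rw [hJ.span_eq _ hu.2]
          exact Submodule.subset_span ⟨a, rfl⟩, rfl⟩
      rintro _ (rfl | rfl | rfl | rfl)
      exacts [mem_insert _ _, hmem 0, hmem 1, hmem 2]
    exact h.curvature p u hu.1 X Y (hle hY) Z (hle hZ)

end SpaceFormCharts

/-! ### Frenet curvatures -/

section FrenetAlgebra

variable {F : Type*} [AddCommGroup F] [Module ℝ F]

open LinearMap (BilinForm) in
/-- Vectors `e₁, e₂, …` that satisfy Frenet formulas with respect to a skew-symmetric derivation
`e ↦ e'` are orthogonal; so a curvature `kᵢ ≠ 0` leads to `i + 1` linearly independent vectors. -/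
lemma frenet_curvature_eq_zero {B : BilinForm ℝ F} (hB : ∀ x y, B x y = B y x) {e e' : ℕ → F}
    {k : ℕ → ℝ} (he0 : e 0 = 0) (hk0 : k 0 = 0) (he1 : B (e 1) (e 1) = 1)
    (hfrenet : ∀ i, e' (i + 1) + k i • e i = k (i + 1) • e (i + 2))
    (hskew : ∀ i j, B (e' i) (e j) = -B (e i) (e' j))
    (hunit : ∀ i, k (i + 1) ≠ 0 → B (e (i + 2)) (e (i + 2)) = 1)
    (hzero : ∀ i, k (i + 1) = 0 → e (i + 2) = 0 ∧ k (i + 2) = 0)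
    {W : Submodule ℝ F} [FiniteDimensional ℝ W] (hW : ∀ i, e i ∈ W) {N : ℕ}
    (hN : Module.finrank ℝ W ≤ N) {i : ℕ} (hi : N ≤ i) : k i = 0 := by
  have hne (n : ℕ) (hn : k (n + 1) ≠ 0) : ∀ j ≤ n, k (j + 1) ≠ 0 := by
    induction n with
    | zero =>
      intro j hj
      rwa [Nat.le_zero.1 hj]
    | succ n ih =>
      intro j hj
      rcases Nat.le_succ_iff.1 hj with hj | rfl
      · exact ih (fun h0 => hn (hzero n h0).2) j hj
      · exact hn
  have hone (n : ℕ) (hn : k (n + 1) ≠ 0) : ∀ j ≤ n + 1, B (e (j + 1)) (e (j + 1)) = 1 := by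
    rintro (_ | j) hj
    · exact he1
    · exact hunit j (hne n hn j (by omega))
  have horth (n : ℕ) : ∀ j ≤ n, B (e (n + 1)) (e j) = 0 := by
    induction n using Nat.strong_induction_on with
    | _ n ih =>
    intro j hj
    rcases n with _ | n
    · rw [Nat.le_zero.1 hj, he0, map_zero]
    rcases j with _ | m
    · rw [he0, map_zero]
    rcases eq_or_ne (k (n + 1)) 0 with hk | hk
    · rw [(hzero n hk).1, map_zero, LinearMap.zero_apply]
    have h1 : k (n + 1) * B (e (n + 2)) (e (m + 1)) =
        B (e' (n + 1)) (e (m + 1)) + k n * B (e n) (e (m + 1)) := by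
      have := congrArg (fun v => B v (e (m + 1))) (hfrenet n)
      simpa using this.symm
    have h2 : B (e (n + 1)) (e' (m + 1)) + k m * B (e (n + 1)) (e m) =
        k (m + 1) * B (e (n + 1)) (e (m + 2)) := by
      simpa using congrArg (fun v => B (e (n + 1)) v) (hfrenet m)
    have h3 := hskew (n + 1) (m + 1)
    have h4 : B (e (n + 1)) (e m) = 0 := ih n (by omega) m (by omega)
    refine (mul_eq_zero.1 ?_).resolve_left hk
    rcases (show m = n ∨ m + 1 = n ∨ m + 2 ≤ n by omega) with rfl | rfl | hmn
    · rw [hB (e m), h4] at h1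
      rw [hB (e (m + 1)) (e' (m + 1))] at h3
      linarith
    · rcases eq_or_ne (k (m + 1)) 0 with h0 | h0
      · rw [h0] at h1 h2
        rw [h4] at h2
        linarith
      · have e1 := hone m h0 m (by omega)
        have e2 := hone m h0 (m + 1) le_rfl
        rw [e1] at h1
        rw [h4, e2] at h2
        linarith
    · have h5 : B (e (n + 1)) (e (m + 2)) = 0 := ih n (by omega) _ hmn
      obtain ⟨n, rfl⟩ : ∃ n', n = n' + 1 := ⟨n - 1, by omega⟩
      have h6 : B (e (n + 1)) (e (m + 1)) = 0 := ih n (by omega) _ (by omega)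
      rw [h6] at h1
      rw [h4, h5] at h2
      linarith
  by_contra hk
  rcases i with _ | i
  · exact hk hk0
  have hlin : LinearIndependent ℝ fun j : Fin (i + 2) => (⟨e (j + 1), hW _⟩ : W) := by
    rw [Fintype.linearIndependent_iff]
    intro r hr j
    have hr' := congrArg (fun w : W => B (w : F) (e (j + 1))) hr
    simp only [Submodule.coe_sum, Submodule.coe_smul, map_sum, LinearMap.sum_apply, map_smul,
      LinearMap.smul_apply, smul_eq_mul, Submodule.coe_zero, map_zero, LinearMap.zero_apply] at hr'
    rw [Finset.sum_eq_single j (fun l _ hl => ?_) (by simp), hone i hk _ (by omega), mul_one] at hr'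
    · exact hr'
    · rcases lt_or_gt_of_ne (Fin.val_ne_of_ne hl) with hlt | hlt
      · rw [hB, horth _ _ (by omega), mul_zero]
      · rw [horth _ _ (by omega), mul_zero]
  have := hlin.fintype_card_le_finrank
  simp at this
  omega

end FrenetAlgebra

section FrenetCurves

variable {E : Type*} [NormedAddCommGroup E] [NormedSpace ℝ E]
  {M : Type*} [TopologicalSpace M] [ChartedSpace E M] [IsManifold 𝓘(ℝ, E) ∞ M]
  (g : RMetric E M)

lemma tnorm_eq_zero {x : M} {v : TangentSpace 𝓘(ℝ, E) x} : tnorm g v = 0 ↔ v = 0 := by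
  constructor
  · intro h
    by_contra hv
    exact (Real.sqrt_pos.2 (g.pos x v hv)).ne' h
  · rintro rfl
    simp [tnorm]

lemma inner_normalize {x : M} {v : TangentSpace 𝓘(ℝ, E) x} (hv : v ≠ 0) :
    g.inner x ((tnorm g v)⁻¹ • v) ((tnorm g v)⁻¹ • v) = 1 := by
  have hpos := g.pos x v hv
  have e : tnorm g v * tnorm g v = g.inner x v v := Real.mul_self_sqrt hpos.le
  have hne : tnorm g v ≠ 0 := fun h => hv ((tnorm_eq_zero g).1 h)
  simp only [map_smul, smul_apply, smul_eq_mul, ← e]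
  field_simp

variable [FiniteDimensional ℝ E] {γ : ℝ → M} {I : Set ℝ}

/-- The combination `∑ⱼ a j ∇_tʲ γ'` of the iterated covariant derivatives of the velocity. -/
def iterCovDerivComb (γ : ℝ → M) (a : ℕ →₀ ℝ) (t : ℝ) : TangentSpace 𝓘(ℝ, E) (γ t) :=
  Finsupp.linearCombination ℝ (fun j => iterCovDeriv g γ j t) a

/-- Covariant differentiation shifts the coefficients of a combination of iterated covariant
derivatives. -/
lemma covDeriv_iterCovDerivComb (hI : IsOpen I) (hγ : ContMDiffOn 𝓘(ℝ, ℝ) 𝓘(ℝ, E) ∞ γ I)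
    {V : ∀ t, TangentSpace 𝓘(ℝ, E) (γ t)} {a : ℕ →₀ ℝ}
    (hV : ∀ t ∈ I, V t = iterCovDerivComb g γ a t) {t : ℝ} (ht : t ∈ I) :
    covDeriv g γ V t = iterCovDerivComb g γ (Finsupp.lmapDomain ℝ ℝ Nat.succ a) t := by
  set p := γ t
  have hp : γ t ∈ (extChartAt 𝓘(ℝ, E) p).source := mem_extChartAt_source _
  have hT := isOpen_inter_preimage_source hI hγ p
  have hc := ((contDiffOn_coord hγ p).contDiffAt (hT.mem_nhds ⟨ht, hp⟩)).differentiableAt (by simp)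
  have hj (j : ℕ) : HasCovDerivAt (localMetric g p) (fun s => extChartAt 𝓘(ℝ, E) p (γ s))
      (fun s => toCoord p (γ s) (iterCovDeriv g γ j s))
      (toCoord p (γ t) (iterCovDeriv g γ (j + 1) t)) t := by
    have hd := (contDiffAt_toCoord_iterCovDeriv g hI hγ ⟨ht, hp⟩ j).differentiableAt (by simp)
    have e := HasCovDerivAt.of_differentiableAt (G := localMetric g p)
      (c := fun s => extChartAt 𝓘(ℝ, E) p (γ s)) hd
    rwa [← toCoord_covDeriv g hp (hγ.continuousOn.continuousAt (hI.mem_nhds ht)) hc hd] at e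
  have hsum := HasCovDerivAt.sum (s := a.support) fun j _ => (hj j).const_smul (a j)
  have hev : (fun s => toCoord p (γ s) (V s)) =ᶠ[𝓝 t] fun s =>
      ∑ j ∈ a.support, a j • toCoord p (γ s) (iterCovDeriv g γ j s) := by
    filter_upwards [hI.mem_nhds ht] with s hs
    rw [hV s hs, iterCovDerivComb, Finsupp.linearCombination_apply, Finsupp.sum, map_sum]
    simp only [map_smul]
  have hV' := hsum.congr_of_eventuallyEq hev
  refine toCoord_injective hp ?_
  rw [toCoord_covDeriv g hp (hγ.continuousOn.continuousAt (hI.mem_nhds ht)) hc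
    hV'.differentiableAt, hV'.covDerivAlong_eq, iterCovDerivComb, Finsupp.lmapDomain_apply,
    Finsupp.linearCombination_mapDomain, Finsupp.linearCombination_apply, Finsupp.sum, map_sum]
  simp only [map_smul]
  rfl

lemma smoothAlong_iterCovDerivComb (hI : IsOpen I) (hγ : ContMDiffOn 𝓘(ℝ, ℝ) 𝓘(ℝ, E) ∞ γ I)
    {V : ∀ t, TangentSpace 𝓘(ℝ, E) (γ t)} {a : ℕ →₀ ℝ}
    (hV : ∀ t ∈ I, V t = iterCovDerivComb g γ a t) : SmoothAlong γ V I := by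
  intro t ht
  have hp : γ t ∈ (extChartAt 𝓘(ℝ, E) (γ t)).source := mem_extChartAt_source _
  refine ((contMDiffAt_tangentBundle_iff (p := γ t) hp).2
    ⟨hγ.contMDiffAt (hI.mem_nhds ht), ?_⟩).contMDiffWithinAt
  have hs : ContDiffAt ℝ ∞ (fun s =>
      ∑ j ∈ a.support, a j • toCoord (γ t) (γ s) (iterCovDeriv g γ j s)) t :=
    ContDiffAt.sum fun j _ => contDiffAt_const.smul
      (contDiffAt_toCoord_iterCovDeriv g hI hγ ⟨ht, hp⟩ j)
  refine hs.congr_of_eventuallyEq ?_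
  filter_upwards [hI.mem_nhds ht] with s hs
  rw [hV s hs, iterCovDerivComb, Finsupp.linearCombination_apply, Finsupp.sum, map_sum]
  simp only [map_smul]

/-- If the inner products of the iterated covariant derivatives of `γ'` are constant, the Frenet
vectors are combinations of these derivatives with constant coefficients. -/
lemma exists_frenet_eq_comb (hI : IsOpen I) (hγ : ContMDiffOn 𝓘(ℝ, ℝ) 𝓘(ℝ, E) ∞ γ I)
    (hinner : ∀ i j, ∃ r : ℝ, ∀ t ∈ I,
      g.inner (γ t) (iterCovDeriv g γ i t) (iterCovDeriv g γ j t) = r) (i : ℕ) :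
    ∃ (a b : ℕ →₀ ℝ) (κ : ℝ), ∀ t ∈ I, (frenet g γ i).1 t = iterCovDerivComb g γ a t ∧
      (frenet g γ i).2.1 t = κ ∧ (frenet g γ i).2.2 t = iterCovDerivComb g γ b t := by
  have hnorm (a : ℕ →₀ ℝ) : ∃ κ : ℝ, ∀ t ∈ I, tnorm g (iterCovDerivComb g γ a t) = κ := by
    choose r hr using hinner
    refine ⟨√(∑ i ∈ a.support, ∑ j ∈ a.support, a i * (a j * r i j)), fun t ht => ?_⟩
    rw [tnorm, iterCovDerivComb, Finsupp.linearCombination_apply, Finsupp.sum]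
    simp only [map_sum, map_smul, sum_apply, smul_apply, hr _ _ t ht, smul_eq_mul,
      Finset.mul_sum]
    congr 1
    rw [Finset.sum_comm]
    refine Finset.sum_congr rfl fun i _ => Finset.sum_congr rfl fun j _ => by ring
  have hvel (t : ℝ) : velocity γ t = iterCovDerivComb g γ (Finsupp.single 0 1) t := by
    rw [iterCovDerivComb, Finsupp.linearCombination_single, one_smul]
    rfl
  obtain ⟨v, hv⟩ := hnorm (Finsupp.single 0 1)
  simp only [← hvel] at hv
  induction i with
  | zero =>
    refine ⟨0, v⁻¹ • Finsupp.single 0 1, 0, fun t ht => ⟨?_, rfl, ?_⟩⟩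
    · exact (map_zero _).symm
    · rw [iterCovDerivComb, map_smul]
      change (tnorm g (velocity γ t))⁻¹ • _ = _
      rw [hv t ht]
      congr 1
      exact hvel t
  | succ i ih =>
    obtain ⟨a, b, κ, h⟩ := ih
    have hrest : ∀ t ∈ I, frenetRest g γ (frenet g γ i).1 (frenet g γ i).2.1 (frenet g γ i).2.2 t =
        iterCovDerivComb g γ (v⁻¹ • Finsupp.lmapDomain ℝ ℝ Nat.succ b + κ • a) t := by
      intro t ht
      rw [frenetRest, hv t ht, (h t ht).1, (h t ht).2.1,
        covDeriv_iterCovDerivComb g hI hγ (fun s hs => (h s hs).2.2) ht]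
      simp only [iterCovDerivComb, map_add, map_smul]
    obtain ⟨κ', hκ'⟩ := hnorm (v⁻¹ • Finsupp.lmapDomain ℝ ℝ Nat.succ b + κ • a)
    refine ⟨b, κ'⁻¹ • (v⁻¹ • Finsupp.lmapDomain ℝ ℝ Nat.succ b + κ • a), κ', fun t ht =>
      ⟨(h t ht).2.2, ?_, ?_⟩⟩
    · rw [← hκ' t ht, ← hrest t ht]
      rfl
    · rw [iterCovDerivComb, map_smul]
      change (tnorm g (frenetRest g γ (frenet g γ i).1 (frenet g γ i).2.1
        (frenet g γ i).2.2 t))⁻¹ • frenetRest g γ (frenet g γ i).1 (frenet g γ i).2.1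
        (frenet g γ i).2.2 t = _
      rw [hrest t ht, hκ' t ht]
      rfl

/-- The geodesic curvatures of a regular curve are constant if the iterated covariant derivatives
of its velocity have constant inner products, and they vanish from `N` on if these derivatives span
spaces of dimension at most `N`. -/
theorem hasConstantCurvaturesVanishingFrom (hI : IsOpen I)
    (hγ : ContMDiffOn 𝓘(ℝ, ℝ) 𝓘(ℝ, E) ∞ γ I) {N : ℕ}
    (hreg : ∀ t ∈ I, (velocity γ t : TangentSpace 𝓘(ℝ, E) (γ t)) ≠ 0)
    (hinner : ∀ i j, ∃ r : ℝ, ∀ t ∈ I,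
      g.inner (γ t) (iterCovDeriv g γ i t) (iterCovDeriv g γ j t) = r)
    (hskew : ∀ i j, ∀ t ∈ I, g.inner (γ t) (iterCovDeriv g γ (i + 1) t) (iterCovDeriv g γ j t) =
      -g.inner (γ t) (iterCovDeriv g γ i t) (iterCovDeriv g γ (j + 1) t))
    (hdim : ∀ t ∈ I, ∃ W : Submodule ℝ (TangentSpace 𝓘(ℝ, E) (γ t)),
      (∀ m, iterCovDeriv g γ m t ∈ W) ∧ Module.finrank ℝ W ≤ N) :
    HasConstantCurvaturesVanishingFrom g γ I N := by
  choose a b κ h using exists_frenet_eq_comb g hI hγ hinner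
  refine ⟨hreg, fun i _ => smoothAlong_iterCovDerivComb g hI hγ fun t ht => (h i t ht).1,
    fun i _ => ⟨κ i, fun t ht => (h i t ht).2.1⟩, fun i hi t ht => ?_⟩
  obtain ⟨W, hW, hfin⟩ := hdim t ht
  set v := tnorm g (velocity γ t : TangentSpace 𝓘(ℝ, E) (γ t)) with hv
  have : FiniteDimensional ℝ (TangentSpace 𝓘(ℝ, E) (γ t)) := inferInstanceAs (FiniteDimensional ℝ E)
  let S : (ℕ →₀ ℝ) → ℕ →₀ ℝ := Finsupp.lmapDomain ℝ ℝ Nat.succ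
  let B : LinearMap.BilinForm ℝ (TangentSpace 𝓘(ℝ, E) (γ t)) :=
    LinearMap.mk₂ ℝ (fun x y => g.inner (γ t) x y) (by simp) (by simp) (by simp) (by simp)
  let rest (i : ℕ) := frenetRest g γ (frenet g γ i).1 (frenet g γ i).2.1 (frenet g γ i).2.2 t
  have hrest_eq (i : ℕ) (h0 : tnorm g (rest i) = 0) : rest i = 0 := (tnorm_eq_zero g).1 h0
  have hcov (i : ℕ) : covDeriv g γ (frenet g γ i).1 t = iterCovDerivComb g γ (S (a i)) t :=
    covDeriv_iterCovDerivComb g hI hγ (fun s hs => (h i s hs).1) ht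
  refine frenet_curvature_eq_zero (B := B) (fun x y => g.symm _ _ _)
    (e := fun i => (frenet g γ i).1 t) (e' := fun i => v⁻¹ • covDeriv g γ (frenet g γ i).1 t)
    (k := fun i => (frenet g γ i).2.1 t) rfl rfl (inner_normalize g (hreg t ht)) ?_ ?_ ?_ ?_
    (W := W) ?_ hfin hi
  · intro i
    change rest i = tnorm g (rest i) • ((tnorm g (rest i))⁻¹ • rest i)
    rcases eq_or_ne (tnorm g (rest i)) 0 with h0 | h0
    · rw [h0, zero_smul, hrest_eq i h0]
    · rw [smul_smul, mul_inv_cancel₀ h0, one_smul]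
  · have hS (p q : ℕ →₀ ℝ) : g.inner (γ t) (iterCovDerivComb g γ (S p) t) (iterCovDerivComb g γ q t)
        = -g.inner (γ t) (iterCovDerivComb g γ p t) (iterCovDerivComb g γ (S q) t) := by
      simp only [S, iterCovDerivComb, Finsupp.lmapDomain_apply, Finsupp.linearCombination_mapDomain]
      simp only [Finsupp.linearCombination_apply, Finsupp.sum, map_sum, map_smul, sum_apply,
        smul_apply, Function.comp_apply, Nat.succ_eq_add_one, hskew _ _ t ht, smul_neg,
        Finset.sum_neg_distrib]
    intro i j
    change g.inner (γ t) (v⁻¹ • _) _ = -g.inner (γ t) _ (v⁻¹ • _)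
    rw [hcov, hcov, (h i t ht).1, (h j t ht).1, map_smul, map_smul, smul_apply, hS, smul_neg]
  · intro i hi
    exact inner_normalize g fun h0 => hi (by
      change tnorm g (rest i) = 0
      rw [(tnorm_eq_zero g)]
      exact h0)
  · intro i hi
    -- `k_{i+1}` is constant, so `e_{i+2}` vanishes on all of `I`, and so does its derivative
    have he : ∀ s ∈ I, (frenet g γ (i + 2)).1 s = 0 := by
      intro s hs
      have hk : (frenet g γ (i + 1)).2.1 s = 0 := by
        rw [(h (i + 1) s hs).2.1, ← (h (i + 1) t ht).2.1]
        exact hi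
      change (tnorm g (frenetRest g γ (frenet g γ i).1 (frenet g γ i).2.1
        (frenet g γ i).2.2 s))⁻¹ • _ = (0 : TangentSpace 𝓘(ℝ, E) (γ s))
      change tnorm g (frenetRest g γ (frenet g γ i).1 (frenet g γ i).2.1
        (frenet g γ i).2.2 s) = 0 at hk
      rw [hk, inv_zero, zero_smul]
    refine ⟨he t ht, ?_⟩
    have hD : covDeriv g γ (frenet g γ (i + 2)).1 t = 0 := by
      rw [covDeriv_iterCovDerivComb g hI hγ (a := 0)
        (fun s hs => (he s hs).trans (map_zero _).symm) ht, map_zero]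
      exact map_zero _
    change tnorm g (v⁻¹ • covDeriv g γ (frenet g γ (i + 2)).1 t
      + (frenet g γ (i + 1)).2.1 t • (frenet g γ (i + 1)).1 t) = 0
    rw [hD, hi, smul_zero, zero_smul, add_zero, tnorm_eq_zero]
  · intro i
    rw [(h i t ht).1, iterCovDerivComb, Finsupp.linearCombination_apply]
    exact W.sum_mem fun j _ => W.smul_mem _ (hW j)

end FrenetCurves

/-! ### Projections of geodesics -/

section Projections

variable {E : Type*} [NormedAddCommGroup E] [NormedSpace ℝ E]
  {M : Type*} [TopologicalSpace M] [ChartedSpace E M] [IsManifold 𝓘(ℝ, E) ∞ M]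
  {g : RMetric E M} {I : Set ℝ}

/-- A curve whose velocity vanishes is constant. -/
lemma eq_of_velocity_eq_zero {γ : ℝ → M} (hI : IsOpen I) (hI' : IsPreconnected I)
    (hγ : ContMDiffOn 𝓘(ℝ, ℝ) 𝓘(ℝ, E) ∞ γ I)
    (hvel : ∀ t ∈ I, (velocity γ t : TangentSpace 𝓘(ℝ, E) (γ t)) = 0) {s t : ℝ} (hs : s ∈ I)
    (ht : t ∈ I) : γ s = γ t := by
  refine hI'.induction₂ (fun s t => γ s = γ t) (fun t ht => ?_) (fun _ _ _ _ _ _ => Eq.trans)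
    (fun _ _ _ _ => Eq.symm) hs ht
  have hT := isOpen_inter_preimage_source hI hγ (γ t)
  have htT : t ∈ I ∩ γ ⁻¹' (extChartAt 𝓘(ℝ, E) (γ t)).source := ⟨ht, mem_extChartAt_source _⟩
  obtain ⟨r, hr, hball⟩ := Metric.isOpen_iff.1 hT t htT
  refine mem_nhdsWithin_of_mem_nhds ?_
  filter_upwards [Metric.ball_mem_nhds t hr] with s hs
  refine (extChartAt 𝓘(ℝ, E) (γ t)).injOn htT.2 (hball hs).2 ?_
  refine Metric.isOpen_ball.is_const_of_deriv_eq_zero (convex_ball t r).isPreconnected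
    (((contDiffOn_coord hγ (γ t)).mono hball).differentiableOn (by simp)) (fun x hx => ?_)
    (Metric.mem_ball_self hr) hs
  have hxT := hball hx
  rw [← toCoord_velocity hxT.2 ((hγ.contMDiffAt (hI.mem_nhds hxT.1)).mdifferentiableAt (by simp)),
    hvel x hxT.1]
  exact map_zero _

variable [FiniteDimensional ℝ E]

/-- The derivative of the inner product of two iterated covariant derivatives of the velocity. -/
lemma hasDerivAt_inner_iterCovDeriv (g : RMetric E M) {γ : ℝ → M} (hI : IsOpen I)
    (hγ : ContMDiffOn 𝓘(ℝ, ℝ) 𝓘(ℝ, E) ∞ γ I) {t : ℝ} (ht : t ∈ I) (i j : ℕ) :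
    HasDerivAt (fun s => g.inner (γ s) (iterCovDeriv g γ i s) (iterCovDeriv g γ j s))
      (g.inner (γ t) (iterCovDeriv g γ (i + 1) t) (iterCovDeriv g γ j t)
        + g.inner (γ t) (iterCovDeriv g γ i t) (iterCovDeriv g γ (j + 1) t)) t := by
  set p := γ t
  have hp : γ t ∈ (extChartAt 𝓘(ℝ, E) p).source := mem_extChartAt_source _
  have hT := isOpen_inter_preimage_source hI hγ p
  have hc := contDiffOn_coord hγ p
  have hG := isMetricOn_localMetric g p
  have hd {f : ℝ → E} (hf : ContDiffOn ℝ ∞ f (I ∩ γ ⁻¹' (extChartAt 𝓘(ℝ, E) p).source)) :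
      DifferentiableAt ℝ f t :=
    (hf.contDiffAt (hT.mem_nhds ⟨ht, hp⟩)).differentiableAt (by simp)
  have hV := hG.contDiffOn_iterCovDerivAlong hT hc
    fun s hs => (extChartAt 𝓘(ℝ, E) p).map_source hs.2
  have e := hG.hasDerivAt_apply ((extChartAt 𝓘(ℝ, E) p).map_source hp) (hd hc) (hd (hV i))
    (hd (hV j))
  rw [inner_eq_localMetric g hp, inner_eq_localMetric g hp]
  simp only [toCoord_iterCovDeriv g hI hγ p _ t ⟨ht, hp⟩]
  refine e.congr_of_eventuallyEq ?_
  filter_upwards [hT.mem_nhds ⟨ht, hp⟩] with s hs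
  rw [inner_eq_localMetric g hs.2, toCoord_iterCovDeriv g hI hγ p _ s hs,
    toCoord_iterCovDeriv g hI hγ p _ s hs]

/-- At each time, covariant differentiation of the iterated covariant derivatives of `γ'` is
skew-symmetric, and these derivatives span a space of bounded dimension. -/
lemma IsLocallyModelSpace.iterCovDeriv_proj {n : ℕ} (h : IsLocallyModelSpace g n)
    {Γ : ℝ → TangentBundle 𝓘(ℝ, E) M} (hI : IsOpen I)
    (hΓ : IsTangentGeodesic g Γ I ∨ IsSphereGeodesic g Γ I)
    (hΓs : ContMDiffOn 𝓘(ℝ, ℝ) 𝓘(ℝ, E).tangent ∞ Γ I)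
    (hγ : ContMDiffOn 𝓘(ℝ, ℝ) 𝓘(ℝ, E) ∞ (fun t => (Γ t).proj) I) {t : ℝ} (ht : t ∈ I) :
    (∀ i j, g.inner (Γ t).proj (iterCovDeriv g (fun t => (Γ t).proj) (i + 1) t)
          (iterCovDeriv g (fun t => (Γ t).proj) j t) =
        -g.inner (Γ t).proj (iterCovDeriv g (fun t => (Γ t).proj) i t)
          (iterCovDeriv g (fun t => (Γ t).proj) (j + 1) t)) ∧
      ∃ W : Submodule ℝ (TangentSpace 𝓘(ℝ, E) (Γ t).proj),
        (∀ m, iterCovDeriv g (fun t => (Γ t).proj) m t ∈ W) ∧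
        Module.finrank ℝ W ≤ (if n = 0 then 1 else 2) + 2 * (n + 1) := by
  set p := (Γ t).proj with hpdef
  have hp : (Γ t).proj ∈ (extChartAt 𝓘(ℝ, E) p).source := mem_extChartAt_source _
  obtain ⟨O, κ, J, hpO, hO, hJ⟩ := h p
  have hT₀ := isOpen_inter_preimage_source hI hγ p
  have hc₀ := contDiffOn_coord hγ p
  set T₀ := I ∩ (fun t => (Γ t).proj) ⁻¹' (extChartAt 𝓘(ℝ, E) p).source with hT₀def
  set u : ℝ → E := fun s => extChartAt 𝓘(ℝ, E) p (Γ s).proj with hu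
  set ξ : ℝ → E := fun s => toCoord p (Γ s).proj (Γ s).snd with hξdef
  have hT : IsOpen (T₀ ∩ u ⁻¹' O) := hc₀.continuousOn.isOpen_inter_preimage hT₀ hJ.metric.isOpen
  set T := T₀ ∩ u ⁻¹' O with hTdef
  have htT : t ∈ T := ⟨⟨ht, hp⟩, hpO⟩
  have huT : ContDiffOn ℝ ∞ u T := hc₀.mono inter_subset_left
  have hmaps : MapsTo u T O := fun s hs => hs.2
  have hξ : ContDiffOn ℝ ∞ ξ T := fun s hs => ((contMDiffAt_tangentBundle_iff hs.1.2).1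
    (hΓs.contMDiffAt (hI.mem_nhds hs.1.1))).2.contDiffWithinAt
  have hsrc (s) (hs : s ∈ T) : (Γ s).proj ∈ (chartAt E p).source := by
    have := hs.1.2
    rwa [mem_preimage, extChartAt_source] at this
  have hgeo (s) (hs : s ∈ T) : covDerivAlong (localMetric g p) u (deriv u) s =
        -curvatureOp (localMetric g p) (u s) (ξ s) (covDerivAlong (localMetric g p) u ξ s)
          (deriv u s) ∧
      ∃ l : ℝ, covDerivAlong (localMetric g p) u (covDerivAlong (localMetric g p) u ξ) s =
        l • ξ s := by
    rcases hΓ with hΓ | hΓ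
    · obtain ⟨h1, h2⟩ := hJ.metric.tangentGeodesic_equations hT huT hmaps hξ hs
        (hΓ.geodesic p s hs.1.1 (hsrc s hs))
      exact ⟨h1, 0, by rw [h2, zero_smul]⟩
    · refine hJ.metric.sphereGeodesic_equations hT huT hmaps hξ hs ?_
        (hΓ.geodesic p s hs.1.1 (hsrc s hs))
      rw [← hΓ.unit s hs.1.1]
      exact (inner_eq_localMetric g hs.1.2 _ _).symm
  have hV (m : ℕ) : toCoord p (Γ t).proj (iterCovDeriv g (fun t => (Γ t).proj) m t) =
      iterCovDerivAlong (localMetric g p) u m t := toCoord_iterCovDeriv g hI hγ p m t ⟨ht, hp⟩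
  refine ⟨fun i j => ?_, ?_⟩
  · rw [inner_eq_localMetric g hp, inner_eq_localMetric g hp, hV, hV, hV, hV]
    exact hJ.inner_iterCovDerivAlong_succ hT huT hmaps hξ (fun s hs => (hgeo s hs).1)
      (fun s hs => (hgeo s hs).2) htT i j
  · obtain ⟨W, hW, hfin⟩ := hJ.exists_submodule_iterCovDerivAlong_mem hT huT hmaps hξ
      (fun s hs => (hgeo s hs).1) (fun s hs => (hgeo s hs).2) htT
    obtain ⟨L, hL⟩ := isInvertible_toCoord (E := E) hp
    refine ⟨W.map (L.symm : E →ₗ[ℝ] TangentSpace 𝓘(ℝ, E) (Γ t).proj), fun m => ?_,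
      (Submodule.finrank_map_le _ W).trans hfin⟩
    refine ⟨_, hW m, ?_⟩
    rw [← hV m, ← hL]
    exact L.symm_apply_apply _

lemma IsLocallyModelSpace.hasConstantCurvatures {n : ℕ} (h : IsLocallyModelSpace g n)
    {Γ : ℝ → TangentBundle 𝓘(ℝ, E) M} (hI : IsOpen I) (hI' : IsPreconnected I)
    (hΓ : IsTangentGeodesic g Γ I ∨ IsSphereGeodesic g Γ I) (hvert : ¬ IsVertical Γ I) :
    HasConstantCurvaturesVanishingFrom g (fun t => (Γ t).proj) I
      ((if n = 0 then 1 else 2) + 2 * (n + 1)) := by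
  have hΓs : ContMDiffOn 𝓘(ℝ, ℝ) 𝓘(ℝ, E).tangent ∞ Γ I := hΓ.elim (·.smooth) (·.smooth)
  have hγ : ContMDiffOn 𝓘(ℝ, ℝ) 𝓘(ℝ, E) ∞ (fun t => (Γ t).proj) I := fun t ht =>
    ((contMDiffAt_tangentBundle_iff (mem_extChartAt_source _)).1
      (hΓs.contMDiffAt (hI.mem_nhds ht))).1.contMDiffWithinAt
  have hskew (i j : ℕ) (t) (ht : t ∈ I) := (h.iterCovDeriv_proj hI hΓ hΓs hγ ht).1 i j
  have hconst (i j : ℕ) {s t : ℝ} (hs : s ∈ I) (ht : t ∈ I) :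
      g.inner (Γ s).proj (iterCovDeriv g (fun t => (Γ t).proj) i s)
          (iterCovDeriv g (fun t => (Γ t).proj) j s) =
        g.inner (Γ t).proj (iterCovDeriv g (fun t => (Γ t).proj) i t)
          (iterCovDeriv g (fun t => (Γ t).proj) j t) := by
    have hd (t) (ht : t ∈ I) := hasDerivAt_inner_iterCovDeriv g hI hγ ht i j
    refine hI.is_const_of_deriv_eq_zero hI'
      (f := fun s => g.inner (Γ s).proj (iterCovDeriv g (fun t => (Γ t).proj) i s)
          (iterCovDeriv g (fun t => (Γ t).proj) j s))
      (fun t ht => (hd t ht).differentiableAt.differentiableWithinAt) (fun t ht => ?_) hs ht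
    rw [(hd t ht).deriv, hskew i j t ht, neg_add_cancel]
    rfl
  refine hasConstantCurvaturesVanishingFrom g hI hγ (fun t ht h0 => hvert ?_) (fun i j => ?_)
    hskew fun t ht => (h.iterCovDeriv_proj hI hΓ hΓs hγ ht).2
  · -- the length of the velocity is constant, so the velocity vanishes on all of `I`
    refine ⟨(Γ t).proj, fun s hs => eq_of_velocity_eq_zero hI hI' hγ (fun r hr => ?_) hs ht⟩
    by_contra hne
    refine (g.pos _ _ hne).ne' ((hconst 0 0 hr ht).trans ?_)
    change g.inner (Γ t).proj (velocity (fun t => (Γ t).proj) t) _ = 0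
    rw [h0, map_zero, zero_apply]
  · rcases I.eq_empty_or_nonempty with rfl | ⟨t₀, ht₀⟩
    · exact ⟨0, fun t ht => ht.elim⟩
    · exact ⟨_, fun t ht => hconst i j ht ht₀⟩

end Projections

end

end SpaceFormGeodesics

theorem theorem1p1
    {E : Type*} [NormedAddCommGroup E] [NormedSpace ℝ E] [FiniteDimensional ℝ E]
    {M : Type*} [TopologicalSpace M] [ChartedSpace E M] [IsManifold 𝓘(ℝ, E) ∞ M]
    (g : RMetric E M) (c : ℝ) (hc : c ≠ 0)
    (I : Set ℝ) (hI : IsOpen I) (hI' : IsPreconnected I)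
    (Γ : ℝ → TangentBundle 𝓘(ℝ, E) M)
    (hΓ : IsTangentGeodesic g Γ I ∨ IsSphereGeodesic g Γ I)
    (hvert : ¬ IsVertical Γ I) :
    (IsRealSpaceForm g c →
      HasConstantCurvaturesVanishingFrom g (fun t => (Γ t).proj) I 3) ∧
    (∀ J : EndField E M, IsComplexSpaceForm g J c →
      HasConstantCurvaturesVanishingFrom g (fun t => (Γ t).proj) I 6) ∧
    (∀ Q : EndSubspaceField E M, IsQuaternionicSpaceForm g Q c →
      HasConstantCurvaturesVanishingFrom g (fun t => (Γ t).proj) I 10) :=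
  ⟨fun h => h.isLocallyModelSpace.hasConstantCurvatures hI hI' hΓ hvert,
    fun _ h => h.isLocallyModelSpace.hasConstantCurvatures hI hI' hΓ hvert,
    fun _ h => h.isLocallyModelSpace.hasConstantCurvatures hI hI' hΓ hvert⟩
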